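/- Let $\mathbb{K}$ be a field of characteristic zero. A collection is a presheaf of $\mathbb{K}$-vector spaces on the category of nonempty finite ordered sets and order-preserving bijections; put $[k]=\{1<\dots<k\}$ and $V(k)=V([k])$. A shuffle surjection is a surjection $f:I\twoheadrightarrow J$ of nonempty finite ordered sets with $\min f^{-1}\{j\}<\min f^{-1}\{j'\}$ for $j<j'$. A shuffle operad $(P,\mu,\eta)$ is a monoid in collections for the shuffle composition $(V\circ W)(I)=\bigoplus_{k}V(k)\otimes\bigoplus_{f}W(f^{-1}\{1\})\otimes\cdots\otimes W(f^{-1}\{k\})$, where $f$ runs over the shuffle surjections $I\twoheadrightarrow[k]$. A $P$-bimodule is a collection $A$ with a left crossed action $\lambda:P(k)\otimes P(f^{-1}\{1\})\otimes\cdots\otimes A(f^{-1}\{i\})\otimes\cdots\otimes P(f^{-1}\{k\})\to A(I)$ and a right action $\rho:A(k)\otimes P(f^{-1}\{1\})\otimes\cdots\otimes P(f^{-1}\{k\})\to A(I)$ for all $f$ and $i$, which are associative, unital and compatible with each other; $P$ is a bimodule over itself. A reflexive globular object is a sequence $(A_n)_{n\ge 0}$ with morphisms $s,t:A_{n+1}\to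 A_n$ and $i:A_n\to A_{n+1}$ such that $s^2=st$, $t^2=ts$ and $si=ti=\mathrm{id}$. The following two categories are isomorphic. 1. The category of shuffle $\omega$-operads, that is, of strict $\omega$-categories internal to the category of shuffle operads, with internal $\omega$-functors as morphisms. 2. The category whose objects are the pairs $(P,A)$ in which $P$ is a shuffle operad and $A=(A_n)_{n\ge 0}$ is a reflexive globular $P$-bimodule such that $A_0=P$ and such that, for every $n\ge 1$, the pair $(P,A_n)$ with $s=s_0,\,t=t_0:A_n\to P$ and the iterated identity $i:P\to A_n$ satisfies the linear exchange relation $\mu^{\uparrow}=\mu^{\downarrow}$, where $$\mu^{\uparrow}=\rho^{\odot}(1\odot s)+\lambda^{\odot}(t\odot 1)-i\,\mu^{\odot}(t\odot s),\qquad \mu^{\downarrow}=\lambda^{\odot}(s\odot 1)+\rho^{\odot}(1\odot t)-i\,\mu^{\odot}(s\odot t).$$ Here $\mu^{\odot},\lambda^{\odot},\rho^{\odot}$ denote the restrictions of $\mu,\lambda,\rho$ to elementary compositions, in which one element is grafted at one input of another, the other inputs receiving the unit of $P$. A morphism $(P,A)\to(Q,B)$ consists of a morphism of operads $\varphi:P\to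 Q$ and morphisms of collections $g_n:A_n\to B_n$, $n\ge 0$, that are compatible with $\lambda$ and $\rho$ along $\varphi$, commute with $s$, $t$ and $i$, and satisfy $g_0=\varphi$. -/

import Mathlib

open CategoryTheory

universe u v w

/-! ## Reflexive globular objects and strict ω-categories internal to a category -/

/-- A reflexive globular object in `C`: cells `X n`, with source, target and identity morphisms
subject to `s ∘ s = s ∘ t`, `t ∘ t = t ∘ s`, `s ∘ i = id`, `t ∘ i = id`. -/
structure RGlob (C : Type u) [Category.{v} C] where
  X : ℕ → C
  s : ∀ n, X (n + 1) ⟶ X n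
  t : ∀ n, X (n + 1) ⟶ X n
  i : ∀ n, X n ⟶ X (n + 1)
  ss : ∀ n, s (n + 1) ≫ s n = t (n + 1) ≫ s n
  tt : ∀ n, t (n + 1) ≫ t n = s (n + 1) ≫ t n
  is : ∀ n, i n ≫ s n = 𝟙 (X n)
  it : ∀ n, i n ≫ t n = 𝟙 (X n)

namespace RGlob

variable {C : Type u} [Category.{v} C]

/-- The iterated source `X l ⟶ X k`, for `k ≤ l`. -/
def src (A : RGlob C) {k l : ℕ} (h : k ≤ l) : A.X l ⟶ A.X k :=
  Nat.leRec (motive := fun m _ => A.X m ⟶ A.X k) (𝟙 (A.X k)) (fun m _ f => A.s m ≫ f) h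

/-- The iterated target `X l ⟶ X k`, for `k ≤ l`. -/
def tgt (A : RGlob C) {k l : ℕ} (h : k ≤ l) : A.X l ⟶ A.X k :=
  Nat.leRec (motive := fun m _ => A.X m ⟶ A.X k) (𝟙 (A.X k)) (fun m _ f => A.t m ≫ f) h

/-- The iterated identity `X k ⟶ X l`, for `k ≤ l`. -/
def idn (A : RGlob C) {k l : ℕ} (h : k ≤ l) : A.X k ⟶ A.X l :=
  Nat.leRec (motive := fun m _ => A.X k ⟶ A.X m) (𝟙 (A.X k)) (fun m _ f => f ≫ A.i m) h

/-- A morphism of reflexive globular objects. -/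
@[ext]
structure Hom (A B : RGlob C) where
  app : ∀ n, A.X n ⟶ B.X n
  s_comm : ∀ n, A.s n ≫ app n = app (n + 1) ≫ B.s n
  t_comm : ∀ n, A.t n ≫ app n = app (n + 1) ≫ B.t n
  i_comm : ∀ n, A.i n ≫ app (n + 1) = app n ≫ B.i n

instance : Category (RGlob C) where
  Hom := Hom
  id A := ⟨fun n => 𝟙 (A.X n), by simp, by simp, by simp⟩
  comp f g := ⟨fun n => f.app n ≫ g.app n,
    fun n => by rw [← Category.assoc, f.s_comm, Category.assoc, g.s_comm, Category.assoc],
    fun n => by rw [← Category.assoc, f.t_comm, Category.assoc, g.t_comm, Category.assoc],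
    fun n => by rw [← Category.assoc, f.i_comm, Category.assoc, g.i_comm, Category.assoc]⟩
  id_comp f := Hom.ext (funext fun n => Category.id_comp (f.app n))
  comp_id f := Hom.ext (funext fun n => Category.comp_id (f.app n))
  assoc f g h := Hom.ext (funext fun n => Category.assoc (f.app n) (g.app n) (h.app n))

end RGlob

/-- A (strict) ω-category internal to `C`: a reflexive globular object with a composition `⋆_k`
of `l`-cells for all `k < l`, making `X k ⇇ X l` an internal category for `k < l`, and
`X j ⇇ X k ⇇ X l` an internal 2-category for `j < k < l`.

The composition, a morphism from the fibre product of `t_k, s_k : X l ⟶ X k` to `X l`, is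
given on generalised elements: a natural operation on the pairs `a, b : T ⟶ X l` with
`t_k a = s_k b`, that is, on the morphisms from `T` to that fibre product. (By the Yoneda lemma
this is the same as a morphism on the fibre product, whenever the latter exists.) The
composability proofs that occur in the axioms follow from the composability of the initial
arguments and from the other axioms. -/
structure OmegaCat (C : Type u) [Category.{v} C] extends RGlob C where
  comp : ∀ {k l : ℕ} (h : k < l) {T : C} (a b : T ⟶ X l),
    a ≫ toRGlob.tgt h.le = b ≫ toRGlob.src h.le → (T ⟶ X l)
  /-- naturality in the generalised element -/
  precomp : ∀ {k l : ℕ} (h : k < l) {T T' : C} (p : T' ⟶ T) (a b : T ⟶ X l)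
    (hab : a ≫ toRGlob.tgt h.le = b ≫ toRGlob.src h.le)
    (hab' : (p ≫ a) ≫ toRGlob.tgt h.le = (p ≫ b) ≫ toRGlob.src h.le),
    comp h (p ≫ a) (p ≫ b) hab' = p ≫ comp h a b hab
  /-- the source of a composite is the source of its first factor -/
  comp_src : ∀ {k l : ℕ} (h : k < l) {T : C} (a b : T ⟶ X l)
    (hab : a ≫ toRGlob.tgt h.le = b ≫ toRGlob.src h.le),
    comp h a b hab ≫ toRGlob.src h.le = a ≫ toRGlob.src h.le
  /-- the target of a composite is the target of its second factor -/
  comp_tgt : ∀ {k l : ℕ} (h : k < l) {T : C} (a b : T ⟶ X l)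
    (hab : a ≫ toRGlob.tgt h.le = b ≫ toRGlob.src h.le),
    comp h a b hab ≫ toRGlob.tgt h.le = b ≫ toRGlob.tgt h.le
  /-- left neutrality of identities -/
  id_comp : ∀ {k l : ℕ} (h : k < l) {T : C} (a : T ⟶ X l)
    (ha : ((a ≫ toRGlob.src h.le) ≫ toRGlob.idn h.le) ≫ toRGlob.tgt h.le
      = a ≫ toRGlob.src h.le),
    comp h ((a ≫ toRGlob.src h.le) ≫ toRGlob.idn h.le) a ha = a
  /-- right neutrality of identities -/
  comp_id : ∀ {k l : ℕ} (h : k < l) {T : C} (a : T ⟶ X l)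
    (ha : a ≫ toRGlob.tgt h.le
      = ((a ≫ toRGlob.tgt h.le) ≫ toRGlob.idn h.le) ≫ toRGlob.src h.le),
    comp h a ((a ≫ toRGlob.tgt h.le) ≫ toRGlob.idn h.le) ha = a
  /-- associativity -/
  assoc : ∀ {k l : ℕ} (h : k < l) {T : C} (a b c : T ⟶ X l)
    (hab : a ≫ toRGlob.tgt h.le = b ≫ toRGlob.src h.le)
    (hbc : b ≫ toRGlob.tgt h.le = c ≫ toRGlob.src h.le)
    (h₁ : comp h a b hab ≫ toRGlob.tgt h.le = c ≫ toRGlob.src h.le)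
    (h₂ : a ≫ toRGlob.tgt h.le = comp h b c hbc ≫ toRGlob.src h.le),
    comp h (comp h a b hab) c h₁ = comp h a (comp h b c hbc) h₂
  /-- `s_k` commutes with the compositions `⋆_j` -/
  src_comp : ∀ {j k l : ℕ} (hj : j < k) (hk : k < l) {T : C} (a b : T ⟶ X l)
    (hab : a ≫ toRGlob.tgt (hj.trans hk).le = b ≫ toRGlob.src (hj.trans hk).le)
    (hab' : (a ≫ toRGlob.src hk.le) ≫ toRGlob.tgt hj.le
      = (b ≫ toRGlob.src hk.le) ≫ toRGlob.src hj.le),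
    comp (hj.trans hk) a b hab ≫ toRGlob.src hk.le
      = comp hj (a ≫ toRGlob.src hk.le) (b ≫ toRGlob.src hk.le) hab'
  /-- `t_k` commutes with the compositions `⋆_j` -/
  tgt_comp : ∀ {j k l : ℕ} (hj : j < k) (hk : k < l) {T : C} (a b : T ⟶ X l)
    (hab : a ≫ toRGlob.tgt (hj.trans hk).le = b ≫ toRGlob.src (hj.trans hk).le)
    (hab' : (a ≫ toRGlob.tgt hk.le) ≫ toRGlob.tgt hj.le
      = (b ≫ toRGlob.tgt hk.le) ≫ toRGlob.src hj.le),
    comp (hj.trans hk) a b hab ≫ toRGlob.tgt hk.le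
      = comp hj (a ≫ toRGlob.tgt hk.le) (b ≫ toRGlob.tgt hk.le) hab'
  /-- identities commute with the compositions `⋆_j` -/
  idn_comp : ∀ {j k l : ℕ} (hj : j < k) (hk : k < l) {T : C} (a b : T ⟶ X k)
    (hab : a ≫ toRGlob.tgt hj.le = b ≫ toRGlob.src hj.le)
    (hab' : (a ≫ toRGlob.idn hk.le) ≫ toRGlob.tgt (hj.trans hk).le
      = (b ≫ toRGlob.idn hk.le) ≫ toRGlob.src (hj.trans hk).le),
    comp (hj.trans hk) (a ≫ toRGlob.idn hk.le) (b ≫ toRGlob.idn hk.le) hab'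
      = comp hj a b hab ≫ toRGlob.idn hk.le
  /-- the exchange law `(a ⋆_k a') ⋆_j (b ⋆_k b') = (a ⋆_j b) ⋆_k (a' ⋆_j b')` -/
  exchange : ∀ {j k l : ℕ} (hj : j < k) (hk : k < l) {T : C} (a a' b b' : T ⟶ X l)
    (ha : a ≫ toRGlob.tgt hk.le = a' ≫ toRGlob.src hk.le)
    (hb : b ≫ toRGlob.tgt hk.le = b' ≫ toRGlob.src hk.le)
    (hab : a ≫ toRGlob.tgt (hj.trans hk).le = b ≫ toRGlob.src (hj.trans hk).le)
    (hab' : a' ≫ toRGlob.tgt (hj.trans hk).le = b' ≫ toRGlob.src (hj.trans hk).le)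
    (h₁ : comp hk a a' ha ≫ toRGlob.tgt (hj.trans hk).le
      = comp hk b b' hb ≫ toRGlob.src (hj.trans hk).le)
    (h₂ : comp (hj.trans hk) a b hab ≫ toRGlob.tgt hk.le
      = comp (hj.trans hk) a' b' hab' ≫ toRGlob.src hk.le),
    comp (hj.trans hk) (comp hk a a' ha) (comp hk b b' hb) h₁
      = comp hk (comp (hj.trans hk) a b hab) (comp (hj.trans hk) a' b' hab') h₂

namespace OmegaCat

variable {C : Type u} [Category.{v} C]

/-- An internal ω-functor: a morphism of reflexive globular objects preserving all `⋆_k`. -/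
@[ext]
structure Hom (A B : OmegaCat C) where
  hom : A.toRGlob ⟶ B.toRGlob
  comp_comm : ∀ {k l : ℕ} (h : k < l) {T : C} (a b : T ⟶ A.X l)
    (hab : a ≫ A.tgt h.le = b ≫ A.src h.le)
    (hab' : (a ≫ hom.app l) ≫ B.tgt h.le = (b ≫ hom.app l) ≫ B.src h.le),
    A.comp h a b hab ≫ hom.app l = B.comp h (a ≫ hom.app l) (b ≫ hom.app l) hab'

end OmegaCat

namespace RGlob

variable {C : Type u} [Category.{v} C] {A B : RGlob C}

theorem src_comm (f : A ⟶ B) {k l : ℕ} (h : k ≤ l) :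
    A.src h ≫ f.app k = f.app l ≫ B.src h := by
  induction h using Nat.leRec with
  | refl => simp [src]
  | le_succ_of_le h ih =>
    have hA : A.src (Nat.le_succ_of_le h) = A.s _ ≫ A.src h := Nat.leRec_succ _ _ h
    have hB : B.src (Nat.le_succ_of_le h) = B.s _ ≫ B.src h := Nat.leRec_succ _ _ h
    rw [hA, hB, Category.assoc, ih, ← Category.assoc, f.s_comm, Category.assoc]

theorem tgt_comm (f : A ⟶ B) {k l : ℕ} (h : k ≤ l) :
    A.tgt h ≫ f.app k = f.app l ≫ B.tgt h := by
  induction h using Nat.leRec with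
  | refl => simp [tgt]
  | le_succ_of_le h ih =>
    have hA : A.tgt (Nat.le_succ_of_le h) = A.t _ ≫ A.tgt h := Nat.leRec_succ _ _ h
    have hB : B.tgt (Nat.le_succ_of_le h) = B.t _ ≫ B.tgt h := Nat.leRec_succ _ _ h
    rw [hA, hB, Category.assoc, ih, ← Category.assoc, f.t_comm, Category.assoc]

theorem composable_comm (f : A ⟶ B) {k l : ℕ} (h : k ≤ l) {T : C} {a b : T ⟶ A.X l}
    (hab : a ≫ A.tgt h = b ≫ A.src h) :
    (a ≫ f.app l) ≫ B.tgt h = (b ≫ f.app l) ≫ B.src h := by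
  rw [Category.assoc, Category.assoc, ← tgt_comm, ← src_comm, ← Category.assoc, hab,
    Category.assoc]

end RGlob

theorem OmegaCat.comp_congr {C : Type u} [Category.{v} C] (A : OmegaCat C) {k l : ℕ} (h : k < l)
    {T : C} {a b a' b' : T ⟶ A.X l} (hab : a ≫ A.tgt h.le = b ≫ A.src h.le)
    (ha : a = a') (hb : b = b') (hab' : a' ≫ A.tgt h.le = b' ≫ A.src h.le) :
    A.comp h a b hab = A.comp h a' b' hab' := by
  subst ha hb; rfl

instance {C : Type u} [Category.{v} C] : Category (OmegaCat C) where
  Hom := OmegaCat.Hom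
  id A := ⟨𝟙 A.toRGlob, fun h _ a b hab hab' => by
    change A.comp h a b hab ≫ 𝟙 _ = _
    rw [Category.comp_id]
    exact A.comp_congr h hab (Category.comp_id a).symm (Category.comp_id b).symm hab'⟩
  comp {A B D} f g := ⟨f.hom ≫ g.hom, fun {k l} h T a b hab hab' => by
    change A.comp h a b hab ≫ f.hom.app l ≫ g.hom.app l = _
    have h₁ := RGlob.composable_comm f.hom h.le hab
    rw [← Category.assoc, f.comp_comm h a b hab h₁,
      g.comp_comm h _ _ h₁ (RGlob.composable_comm g.hom h.le h₁)]
    exact D.comp_congr h _ (Category.assoc _ _ _) (Category.assoc _ _ _) hab'⟩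
  id_comp f := OmegaCat.Hom.ext (Category.id_comp f.hom)
  comp_id f := OmegaCat.Hom.ext (Category.comp_id f.hom)
  assoc f g h := OmegaCat.Hom.ext (Category.assoc f.hom g.hom h.hom)

/-! ## Collections -/

/-- The category of nonempty finite (totally) ordered sets and order-preserving bijections. -/
abbrev FinOrd := Core NonemptyFinLinOrd.{0}

/-- Collections: presheaves of vector spaces on nonempty finite ordered sets. -/
abbrev Coll (K : Type u) [Field K] := FinOrdᵒᵖ ⥤ ModuleCat.{w} K

namespace Coll

variable {K : Type u} [Field K]

/-- The value `V(I)` of a collection. -/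
abbrev at' (V : Coll.{u, w} K) (I : NonemptyFinLinOrd.{0}) : ModuleCat.{w} K :=
  V.obj (Opposite.op ⟨I⟩)

/-- The restriction `V(J) → V(I)` along an order-preserving bijection `I ≃ J`. -/
def tr (V : Coll.{u, w} K) {I J : NonemptyFinLinOrd.{0}} (e : I ≃o J) : V.at' J →ₗ[K] V.at' I :=
  (V.map (Quiver.Hom.op (CoreHom.mk (NonemptyFinLinOrd.Iso.mk e) :
    (⟨I⟩ : FinOrd) ⟶ ⟨J⟩))).hom

/-- The component `V(I) → W(I)` of a morphism of collections. -/
abbrev ap {V W : Coll.{u, w} K} (φ : V ⟶ W) {I : NonemptyFinLinOrd.{0}} :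
    V.at' I →ₗ[K] W.at' I :=
  (φ.app (Opposite.op ⟨I⟩)).hom

theorem tr_tr (V : Coll.{u, w} K) {I J L : NonemptyFinLinOrd.{0}} (e : I ≃o J) (d : J ≃o L)
    (x : V.at' L) : V.tr e (V.tr d x) = V.tr (e.trans d) x := by
  have h := V.map_comp (Quiver.Hom.op (CoreHom.mk (NonemptyFinLinOrd.Iso.mk d) :
    (⟨J⟩ : FinOrd) ⟶ ⟨L⟩)) (Quiver.Hom.op (CoreHom.mk (NonemptyFinLinOrd.Iso.mk e) :
    (⟨I⟩ : FinOrd) ⟶ ⟨J⟩))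
  exact (congrArg (fun m => m.hom x) h).symm

theorem tr_refl (V : Coll.{u, w} K) {I : NonemptyFinLinOrd.{0}} (x : V.at' I) :
    V.tr (OrderIso.refl I) x = x :=
  congrArg (fun m => m.hom x) (V.map_id (Opposite.op (⟨I⟩ : FinOrd)))

theorem ap_tr {V W : Coll.{u, w} K} (φ : V ⟶ W) {I J : NonemptyFinLinOrd.{0}} (e : I ≃o J)
    (x : V.at' J) : ap φ (V.tr e x) = W.tr e (ap φ x) :=
  congrArg (fun m => m.hom x) (φ.naturality (Quiver.Hom.op
    (CoreHom.mk (NonemptyFinLinOrd.Iso.mk e) : (⟨I⟩ : FinOrd) ⟶ ⟨J⟩)))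

end Coll

/-! ## Shuffle surjections -/

/-- A shuffle surjection `I ↠ J`: a surjection `f` such that `min f⁻¹{j} < min f⁻¹{j'}` whenever
`j < j'` (equivalently, every element of `f⁻¹{j'}` is above some element of `f⁻¹{j}`). -/
structure Shuffle (I J : NonemptyFinLinOrd.{0}) where
  toFun : I → J
  surj : Function.Surjective toFun
  shuffle : ∀ j j' : J, j < j' → ∀ y, toFun y = j' → ∃ x, toFun x = j ∧ x < y

namespace Shuffle

variable {I J L I' J' : NonemptyFinLinOrd.{0}}

/-- The fibre `f⁻¹{j}`. -/
abbrev fiber (f : Shuffle I J) (j : J) : NonemptyFinLinOrd.{0} :=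
  haveI : Nonempty {x : I // f.toFun x = j} := let ⟨x, hx⟩ := f.surj j; ⟨⟨x, hx⟩⟩
  NonemptyFinLinOrd.of {x : I // f.toFun x = j}

/-- The composite `f ∘ g : L ↠ J ↠ I`. -/
def comp (f : Shuffle J I) (g : Shuffle L J) : Shuffle L I where
  toFun x := f.toFun (g.toFun x)
  surj := f.surj.comp g.surj
  shuffle i i' h y hy := by
    obtain ⟨j, hj, hlt⟩ := f.shuffle i i' h _ hy
    obtain ⟨x, hx, hxy⟩ := g.shuffle j _ hlt y rfl
    exact ⟨x, by rw [hx, hj], hxy⟩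

/-- The restriction `(f ∘ g)⁻¹{i} ↠ f⁻¹{i}` of `g`. -/
def restrict (f : Shuffle J I) (g : Shuffle L J) (i : I) :
    Shuffle ((f.comp g).fiber i) (f.fiber i) where
  toFun x := ⟨g.toFun x.1, x.2⟩
  surj j := let ⟨x, hx⟩ := g.surj j.1
    ⟨⟨x, (congrArg f.toFun hx).trans j.2⟩, Subtype.ext hx⟩
  shuffle j j' h y hy := by
    obtain ⟨x, hx, hxy⟩ := g.shuffle j.1 j'.1 h y.1 (congrArg Subtype.val hy)
    exact ⟨⟨x, (congrArg f.toFun hx).trans j.2⟩, Subtype.ext hx, hxy⟩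

/-- The fibre of the restriction of `g` at `j` is the fibre of `g` at `j`. -/
def restrictFiber (f : Shuffle J I) (g : Shuffle L J) (i : I) (j : f.fiber i) :
    (f.restrict g i).fiber j ≃o g.fiber j.1 where
  toFun x := ⟨x.1.1, congrArg Subtype.val x.2⟩
  invFun x := ⟨⟨x.1, (congrArg f.toFun x.2).trans j.2⟩, Subtype.ext x.2⟩
  left_inv _ := rfl
  right_inv _ := rfl
  map_rel_iff' := Iff.rfl

/-- The identity of `I`. -/
def refl (I : NonemptyFinLinOrd.{0}) : Shuffle I I where
  toFun x := x
  surj x := ⟨x, rfl⟩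
  shuffle j j' h y hy := ⟨j, rfl, by rw [hy]; exact h⟩

/-- The one-element ordered set `[1]`. -/
abbrev pt : NonemptyFinLinOrd.{0} := NonemptyFinLinOrd.of (Fin 1)

/-- The unique map `I ↠ [1]`. -/
def const (I : NonemptyFinLinOrd.{0}) : Shuffle I pt where
  toFun _ := (0 : Fin 1)
  surj j := ⟨Classical.arbitrary I, Subsingleton.elim (α := Fin 1) _ _⟩
  shuffle j j' h := absurd h (by rw [Subsingleton.elim (α := Fin 1) j j']; exact lt_irrefl _)

/-- The fibre of `I ↠ [1]` is `I`. -/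
def constFiber (I : NonemptyFinLinOrd.{0}) (j : pt) : (const I).fiber j ≃o I where
  toFun x := x.1
  invFun x := ⟨x, Subsingleton.elim (α := Fin 1) _ _⟩
  left_inv _ := rfl
  right_inv _ := rfl
  map_rel_iff' := Iff.rfl

/-- A one-element ordered set is isomorphic to `[1]`. -/
noncomputable def ptIso (I : NonemptyFinLinOrd.{0}) (h : Subsingleton I) : I ≃o pt where
  toFun _ := (0 : Fin 1)
  invFun _ := Classical.arbitrary I
  left_inv _ := h.elim _ _
  right_inv _ := Subsingleton.elim (α := Fin 1) _ _
  map_rel_iff' {a b} := by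
    have hab : a = b := h.elim a b
    subst hab
    exact ⟨fun _ => le_refl _, fun _ => le_refl _⟩

/-- Isomorphisms of shuffle surjections induce isomorphisms of fibres. -/
def fiberIso (f : Shuffle I J) (f' : Shuffle I' J') (e : I ≃o I') (d : J ≃o J')
    (h : ∀ x, d (f.toFun x) = f'.toFun (e x)) (j : J) : f.fiber j ≃o f'.fiber (d j) where
  toFun x := ⟨e x.1, by rw [← h, x.2]⟩
  invFun x := ⟨e.symm x.1, d.injective (by rw [h, e.apply_symm_apply, x.2])⟩
  left_inv x := Subtype.ext (e.symm_apply_apply x.1)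
  right_inv x := Subtype.ext (e.apply_symm_apply x.1)
  map_rel_iff' {a b} := e.le_iff_le

/-- All fibres of `f` except possibly the one over `j` have one element: `f` is the shape of an
elementary composition `∘_{j,τ}`, where a corolla is grafted at the `j`-th input of a corolla. -/
def IsElementary (f : Shuffle I J) (j : J) : Prop := ∀ j', j' ≠ j → Subsingleton (f.fiber j')

instance (I : NonemptyFinLinOrd.{0}) (j : I) : Subsingleton ((refl I).fiber j) :=
  ⟨fun x y => Subtype.ext (x.2.trans y.2.symm)⟩

end Shuffle

/-! ## Shuffle operads -/

/-- A shuffle operad: a monoid for the shuffle composition of collections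
`(V ∘ W)(I) = ⊕_f V(J) ⊗ ⨂_{j : J} W(f⁻¹{j})`, the sum being over shuffle surjections `f : I ↠ J`
up to isomorphism of `J`, that is, with `J = {1 < ⋯ < k}`. The multiplication `P ∘ P → P` is
written as the corresponding natural family of multilinear maps, and the unit as an element of
`P([1])`. -/
structure ShuffleOperad (K : Type u) [Field K] where
  V : Coll.{u, w} K
  mul : ∀ {I J : NonemptyFinLinOrd.{0}} (f : Shuffle I J),
    V.at' J → (∀ j, V.at' (f.fiber j)) → V.at' I
  one : V.at' Shuffle.pt
  linear_root : ∀ {I J : NonemptyFinLinOrd.{0}} (f : Shuffle I J) (v : ∀ j, V.at' (f.fiber j)),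
    IsLinearMap K (fun u => mul f u v)
  linear_leaf : ∀ {I J : NonemptyFinLinOrd.{0}} (f : Shuffle I J) (u : V.at' J)
    (v : ∀ j, V.at' (f.fiber j)) (j : J),
    IsLinearMap K (fun x => mul f u (Function.update v j x))
  natural : ∀ {I J I' J' : NonemptyFinLinOrd.{0}} (f : Shuffle I J) (f' : Shuffle I' J')
    (e : I ≃o I') (d : J ≃o J') (h : ∀ x, d (f.toFun x) = f'.toFun (e x))
    (u : V.at' J') (v : ∀ j, V.at' (f'.fiber j)),
    mul f (V.tr d u) (fun j => V.tr (f.fiberIso f' e d h j) (v (d j))) = V.tr e (mul f' u v)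
  assoc : ∀ {I J L : NonemptyFinLinOrd.{0}} (f : Shuffle J I) (g : Shuffle L J) (u : V.at' I)
    (v : ∀ i, V.at' (f.fiber i)) (w : ∀ j, V.at' (g.fiber j)),
    mul g (mul f u v) w = mul (f.comp g) u (fun i => mul (f.restrict g i) (v i)
      (fun j => V.tr (f.restrictFiber g i j) (w j.1)))
  one_mul : ∀ {I : NonemptyFinLinOrd.{0}} (a : V.at' I),
    mul (Shuffle.const I) one (fun j => V.tr (Shuffle.constFiber I j) a) = a
  mul_one : ∀ {I : NonemptyFinLinOrd.{0}} (a : V.at' I),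
    mul (Shuffle.refl I) a (fun _ => V.tr (Shuffle.ptIso _ inferInstance) one) = a

namespace ShuffleOperad

variable {K : Type u} [Field K]

/-- The unit of `P`, in `P(I)` for a one-element set `I`. -/
noncomputable def oneAt (P : ShuffleOperad.{u, w} K) (I : NonemptyFinLinOrd.{0}) (h : Subsingleton I) :
    P.V.at' I := P.V.tr (Shuffle.ptIso I h) P.one

/-- A morphism of shuffle operads. -/
@[ext]
structure Hom (P Q : ShuffleOperad.{u, w} K) where
  hom : P.V ⟶ Q.V
  map_mul : ∀ {I J : NonemptyFinLinOrd.{0}} (f : Shuffle I J) (u : P.V.at' J)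
    (v : ∀ j, P.V.at' (f.fiber j)),
    Coll.ap hom (P.mul f u v) = Q.mul f (Coll.ap hom u) (fun j => Coll.ap hom (v j))
  map_one : Coll.ap hom P.one = Q.one

instance : Category (ShuffleOperad.{u, w} K) where
  Hom := Hom
  id P := ⟨𝟙 P.V, fun _ _ _ => rfl, rfl⟩
  comp φ ψ := ⟨φ.hom ≫ ψ.hom,
    fun f u v => (congrArg (Coll.ap ψ.hom) (φ.map_mul f u v)).trans (ψ.map_mul f _ _),
    (congrArg (Coll.ap ψ.hom) φ.map_one).trans ψ.map_one⟩
  id_comp φ := Hom.ext (Category.id_comp φ.hom)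
  comp_id φ := Hom.ext (Category.comp_id φ.hom)
  assoc φ ψ χ := Hom.ext (Category.assoc φ.hom ψ.hom χ.hom)

end ShuffleOperad

/-- The category of shuffle ω-operads: ω-categories internal to shuffle operads. -/
abbrev ShuffleOmegaOperad (K : Type u) [Field K] := OmegaCat (ShuffleOperad.{u, w} K)

/-! ## Bimodules over a shuffle operad -/

/-- A bimodule over the shuffle operad `P`: a collection `A` with a right action `ρ`, defined on
`A(J) ⊗ ⨂_{j : J} P(f⁻¹{j})`, and a left crossed action `λ`, defined on
`P(J) ⊗ A(f⁻¹{j}) ⊗ ⨂_{j' ≠ j} P(f⁻¹{j'})`, for all shuffle surjections `f : I ↠ J` and `j : J`.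
The axioms are the associativity and unit axioms of an operad, for the tree monomials in which
exactly one vertex is labelled in `A` and the others in `P`. -/
structure OperadBimod {K : Type u} [Field K] (P : ShuffleOperad.{u, w} K) where
  V : Coll.{u, w} K
  lam : ∀ {I J : NonemptyFinLinOrd.{0}} (f : Shuffle I J) (j : J),
    P.V.at' J → (∀ j' : {j' // j' ≠ j}, P.V.at' (f.fiber j'.1)) → V.at' (f.fiber j) → V.at' I
  rho : ∀ {I J : NonemptyFinLinOrd.{0}} (f : Shuffle I J),
    V.at' J → (∀ j, P.V.at' (f.fiber j)) → V.at' I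
  lam_linear_root : ∀ {I J : NonemptyFinLinOrd.{0}} (f : Shuffle I J) (j : J)
    (p : ∀ j' : {j' // j' ≠ j}, P.V.at' (f.fiber j'.1)) (a : V.at' (f.fiber j)),
    IsLinearMap K (fun u => lam f j u p a)
  lam_linear_leaf : ∀ {I J : NonemptyFinLinOrd.{0}} (f : Shuffle I J) (j : J) (u : P.V.at' J)
    (p : ∀ j' : {j' // j' ≠ j}, P.V.at' (f.fiber j'.1)) (a : V.at' (f.fiber j))
    (j' : {j' // j' ≠ j}), IsLinearMap K (fun x => lam f j u (Function.update p j' x) a)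
  lam_linear : ∀ {I J : NonemptyFinLinOrd.{0}} (f : Shuffle I J) (j : J) (u : P.V.at' J)
    (p : ∀ j' : {j' // j' ≠ j}, P.V.at' (f.fiber j'.1)),
    IsLinearMap K (fun a => lam f j u p a)
  rho_linear : ∀ {I J : NonemptyFinLinOrd.{0}} (f : Shuffle I J) (p : ∀ j, P.V.at' (f.fiber j)),
    IsLinearMap K (fun a => rho f a p)
  rho_linear_leaf : ∀ {I J : NonemptyFinLinOrd.{0}} (f : Shuffle I J) (a : V.at' J)
    (p : ∀ j, P.V.at' (f.fiber j)) (j : J),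
    IsLinearMap K (fun x => rho f a (Function.update p j x))
  lam_natural : ∀ {I J I' J' : NonemptyFinLinOrd.{0}} (f : Shuffle I J) (f' : Shuffle I' J')
    (e : I ≃o I') (d : J ≃o J') (h : ∀ x, d (f.toFun x) = f'.toFun (e x)) (j : J)
    (u : P.V.at' J') (p : ∀ j' : {j' // j' ≠ d j}, P.V.at' (f'.fiber j'.1))
    (a : V.at' (f'.fiber (d j))),
    lam f j (P.V.tr d u)
      (fun j' => P.V.tr (f.fiberIso f' e d h j'.1) (p ⟨d j'.1, fun h => j'.2 (d.injective h)⟩))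
      (V.tr (f.fiberIso f' e d h j) a) = V.tr e (lam f' (d j) u p a)
  rho_natural : ∀ {I J I' J' : NonemptyFinLinOrd.{0}} (f : Shuffle I J) (f' : Shuffle I' J')
    (e : I ≃o I') (d : J ≃o J') (h : ∀ x, d (f.toFun x) = f'.toFun (e x))
    (a : V.at' J') (p : ∀ j, P.V.at' (f'.fiber j)),
    rho f (V.tr d a) (fun j => P.V.tr (f.fiberIso f' e d h j) (p (d j))) = V.tr e (rho f' a p)
  /-- unit axiom for `λ` -/
  one_lam : ∀ {I : NonemptyFinLinOrd.{0}} (j : Shuffle.pt)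
    (p : ∀ j' : {j' // j' ≠ j}, P.V.at' ((Shuffle.const I).fiber j'.1)) (a : V.at' I),
    lam (Shuffle.const I) j P.one p (V.tr (Shuffle.constFiber I j) a) = a
  /-- unit axiom for `ρ` -/
  rho_one : ∀ {I : NonemptyFinLinOrd.{0}} (a : V.at' I),
    rho (Shuffle.refl I) a (fun _ => P.oneAt _ inferInstance) = a
  /-- associativity for `λ` -/
  lam_lam : ∀ {I J L : NonemptyFinLinOrd.{0}} (f : Shuffle J I) (g : Shuffle L J) (j : J)
    (u : P.V.at' I) (v : ∀ i, P.V.at' (f.fiber i))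
    (w : ∀ j' : {j' // j' ≠ j}, P.V.at' (g.fiber j'.1)) (a : V.at' (g.fiber j)),
    lam g j (P.mul f u v) w a =
      lam (f.comp g) (f.toFun j) u
        (fun i => P.mul (f.restrict g i.1) (v i.1) (fun j' => P.V.tr (f.restrictFiber g i.1 j')
          (w ⟨j'.1, fun h => i.2 (by rw [← j'.2, h])⟩)))
        (lam (f.restrict g (f.toFun j)) ⟨j, rfl⟩ (v (f.toFun j))
          (fun j' => P.V.tr (f.restrictFiber g (f.toFun j) j'.1)
            (w ⟨j'.1.1, fun h => j'.2 (Subtype.ext h)⟩))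
          (V.tr (f.restrictFiber g (f.toFun j) ⟨j, rfl⟩) a))
  /-- associativity for `ρ` -/
  rho_rho : ∀ {I J L : NonemptyFinLinOrd.{0}} (f : Shuffle J I) (g : Shuffle L J) (a : V.at' I)
    (v : ∀ i, P.V.at' (f.fiber i)) (w : ∀ j, P.V.at' (g.fiber j)),
    rho g (rho f a v) w = rho (f.comp g) a (fun i => P.mul (f.restrict g i) (v i)
      (fun j => P.V.tr (f.restrictFiber g i j) (w j.1)))
  /-- compatibility of `λ` and `ρ` -/
  rho_lam : ∀ {I J L : NonemptyFinLinOrd.{0}} (f : Shuffle J I) (g : Shuffle L J) (i : I)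
    (u : P.V.at' I) (v : ∀ i' : {i' // i' ≠ i}, P.V.at' (f.fiber i'.1)) (a : V.at' (f.fiber i))
    (w : ∀ j, P.V.at' (g.fiber j)),
    rho g (lam f i u v a) w =
      lam (f.comp g) i u
        (fun i' => P.mul (f.restrict g i'.1) (v i')
          (fun j => P.V.tr (f.restrictFiber g i'.1 j) (w j.1)))
        (rho (f.restrict g i) a (fun j => P.V.tr (f.restrictFiber g i j) (w j.1)))

namespace OperadBimod

variable {K : Type u} [Field K]

/-- A morphism of `P`-bimodules. -/
@[ext]
structure Hom {P : ShuffleOperad.{u, w} K} (A B : OperadBimod P) where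
  hom : A.V ⟶ B.V
  map_lam : ∀ {I J : NonemptyFinLinOrd.{0}} (f : Shuffle I J) (j : J) (u : P.V.at' J)
    (p : ∀ j' : {j' // j' ≠ j}, P.V.at' (f.fiber j'.1)) (a : A.V.at' (f.fiber j)),
    Coll.ap hom (A.lam f j u p a) = B.lam f j u p (Coll.ap hom a)
  map_rho : ∀ {I J : NonemptyFinLinOrd.{0}} (f : Shuffle I J) (a : A.V.at' J)
    (p : ∀ j, P.V.at' (f.fiber j)),
    Coll.ap hom (A.rho f a p) = B.rho f (Coll.ap hom a) p

instance (P : ShuffleOperad.{u, w} K) : Category (OperadBimod P) where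
  Hom := Hom
  id A := ⟨𝟙 A.V, fun _ _ _ _ _ => rfl, fun _ _ _ => rfl⟩
  comp φ ψ := ⟨φ.hom ≫ ψ.hom,
    fun f j u p a => (congrArg (Coll.ap ψ.hom) (φ.map_lam f j u p a)).trans
      (ψ.map_lam f j u p _),
    fun f a p => (congrArg (Coll.ap ψ.hom) (φ.map_rho f a p)).trans (ψ.map_rho f _ p)⟩
  id_comp φ := Hom.ext (Category.id_comp φ.hom)
  comp_id φ := Hom.ext (Category.comp_id φ.hom)
  assoc φ ψ χ := Hom.ext (Category.assoc φ.hom ψ.hom χ.hom)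

end OperadBimod

/-- The family with value `x` at `j` and values `p j'` at the indices `j' ≠ j`. -/
def insertAt {J : Type} [DecidableEq J] {X : J → Type w} (j : J)
    (p : ∀ j' : {j' // j' ≠ j}, X j'.1) (x : X j) : ∀ j', X j' :=
  fun j' => if h : j' = j then h ▸ x else p ⟨j', h⟩

section insertAt

variable {J : Type} [DecidableEq J] {X : J → Type w} (j : J)
    (p : ∀ j' : {j' // j' ≠ j}, X j'.1) (x : X j)

theorem insertAt_self : insertAt j p x j = x := by simp [insertAt]

theorem insertAt_ne {j' : J} (h : j' ≠ j) : insertAt j p x j' = p ⟨j', h⟩ := by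
  simp [insertAt, h]

theorem eq_insertAt {q : ∀ j', X j'} (h₁ : q j = x)
    (h₂ : ∀ j' (h : j' ≠ j), q j' = p ⟨j', h⟩) : q = insertAt j p x := by
  funext j'
  by_cases h : j' = j
  · subst h; rw [insertAt_self, h₁]
  · rw [insertAt_ne _ _ _ h, h₂ j' h]

theorem insertAt_update_self (y : X j) :
    insertAt j p x = Function.update (insertAt j p y) j x := by
  refine (eq_insertAt j p x (Function.update_self _ _ _) fun j' h => ?_).symm
  rw [Function.update_of_ne h, insertAt_ne _ _ _ h]

theorem insertAt_update_leaf (j' : {j' // j' ≠ j}) (y : X j'.1) :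
    insertAt j (Function.update p j' y) x = Function.update (insertAt j p x) j'.1 y := by
  refine (eq_insertAt j _ x ?_ fun j'' h => ?_).symm
  · rw [Function.update_of_ne (Ne.symm j'.2), insertAt_self]
  · by_cases h' : j'' = j'.1
    · subst h'; simp
    · rw [Function.update_of_ne h', insertAt_ne _ _ _ h,
        Function.update_of_ne (fun e => h' (congrArg Subtype.val e))]

end insertAt

namespace ShuffleOperad

variable {K : Type u} [Field K]

/-- A shuffle operad as a bimodule over itself. -/
def regular (P : ShuffleOperad.{u, w} K) : OperadBimod P where
  V := P.V
  lam f j u p a := P.mul f u (insertAt j p a)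
  rho f a p := P.mul f a p
  lam_linear_root f j p a := P.linear_root f _
  lam_linear_leaf f j u p a j' := by
    simp only [insertAt_update_leaf]
    exact P.linear_leaf f u _ _
  lam_linear f j u p := by
    have h := P.linear_leaf f u (insertAt j p 0) j
    simp only [← insertAt_update_self] at h
    exact h
  rho_linear f p := P.linear_root f p
  rho_linear_leaf f a p j := P.linear_leaf f a p j
  lam_natural f f' e d h j u p a := by
    rw [← P.natural f f' e d h]
    congr 1
    refine (eq_insertAt j _ _ ?_ fun j' hj' => ?_).symm
    · rw [insertAt_self]
    · rw [insertAt_ne _ _ _ (fun h => hj' (d.injective h))]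
  rho_natural f f' e d h a p := P.natural f f' e d h a p
  one_lam {I} j p a := by
    rw [← eq_insertAt j p _ (q := fun j => P.V.tr (Shuffle.constFiber I j) a) rfl
      (fun j' h => absurd (Subsingleton.elim (α := Fin 1) j' j) h)]
    exact P.one_mul a
  rho_one a := P.mul_one a
  lam_lam f g j u v w a := by
    rw [P.assoc]
    congr 1
    refine eq_insertAt _ _ _ ?_ fun i hi => ?_
    · congr 1
      refine eq_insertAt _ _ _ ?_ fun j' hj' => ?_
      · rw [insertAt_self]
      · rw [insertAt_ne _ _ _ (fun h => hj' (Subtype.ext h))]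
    · congr 1
      funext j'
      rw [insertAt_ne]
  rho_rho f g a v w := P.assoc f g a v w
  rho_lam f g i u v a w := by
    rw [P.assoc]
    congr 1
    refine eq_insertAt _ _ _ ?_ fun i' hi' => ?_
    · rw [insertAt_self]
    · rw [insertAt_ne _ _ _ hi']

end ShuffleOperad

/-! ## The linear exchange relation -/

namespace OperadBimod

variable {K : Type u} [Field K] {P : ShuffleOperad.{u, w} K}

/-- The partial left action `λ^⊙ : P ⊙ A → A`: the left action on `u` and `a` along an elementary
composition, with units of `P` at the other inputs of `u`. -/
noncomputable def lamPartial (A : OperadBimod P) {I J : NonemptyFinLinOrd.{0}} (f : Shuffle I J)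
    (j : J) (hf : f.IsElementary j) (u : P.V.at' J) (a : A.V.at' (f.fiber j)) : A.V.at' I :=
  A.lam f j u (fun j' => P.oneAt _ (hf j'.1 j'.2)) a

/-- The partial right action `ρ^⊙ : A ⊙ P → A`. -/
noncomputable def rhoPartial (A : OperadBimod P) {I J : NonemptyFinLinOrd.{0}} (f : Shuffle I J)
    (j : J) (hf : f.IsElementary j) (a : A.V.at' J) (p : P.V.at' (f.fiber j)) : A.V.at' I :=
  A.rho f a (insertAt j (fun j' => P.oneAt _ (hf j'.1 j'.2)) p)

end OperadBimod

/-- The partial multiplication `μ^⊙ : P ⊙ P → P` of an operad. -/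
noncomputable def ShuffleOperad.mulPartial {K : Type u} [Field K] (P : ShuffleOperad.{u, w} K)
    {I J : NonemptyFinLinOrd.{0}} (f : Shuffle I J) (j : J) (hf : f.IsElementary j)
    (u : P.V.at' J) (p : P.V.at' (f.fiber j)) : P.V.at' I :=
  P.mul f u (insertAt j (fun j' => P.oneAt _ (hf j'.1 j'.2)) p)

section Exchange

variable {K : Type u} [Field K] {P : ShuffleOperad.{u, w} K} {A : OperadBimod P}
  (s t : A ⟶ P.regular) (i : P.regular ⟶ A) {I J : NonemptyFinLinOrd.{0}} (f : Shuffle I J)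
  (j : J) (hf : f.IsElementary j) (a : A.V.at' J) (b : A.V.at' (f.fiber j))

/-- `μ↑ = ρ^⊙(1 ⊙ s) + λ^⊙(t ⊙ 1) - i μ^⊙(t ⊙ s)`. -/
noncomputable def muUp : A.V.at' I :=
  A.rhoPartial f j hf a (Coll.ap s.hom b) + A.lamPartial f j hf (Coll.ap t.hom a) b
    - Coll.ap i.hom (P.mulPartial f j hf (Coll.ap t.hom a) (Coll.ap s.hom b))

/-- `μ↓ = λ^⊙(s ⊙ 1) + ρ^⊙(1 ⊙ t) - i μ^⊙(s ⊙ t)`. -/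
noncomputable def muDown : A.V.at' I :=
  A.lamPartial f j hf (Coll.ap s.hom a) b + A.rhoPartial f j hf a (Coll.ap t.hom b)
    - Coll.ap i.hom (P.mulPartial f j hf (Coll.ap s.hom a) (Coll.ap t.hom b))

end Exchange

/-- The linear exchange relation `μ↑ = μ↓` for a reflexive 1-globular `P`-bimodule
`s, t : A ⇉ P`, `i : P → A`. -/
def LinearExchange {K : Type u} [Field K] {P : ShuffleOperad.{u, w} K} {A : OperadBimod P}
    (s t : A ⟶ P.regular) (i : P.regular ⟶ A) : Prop :=
  ∀ {I J : NonemptyFinLinOrd.{0}} (f : Shuffle I J) (j : J) (hf : f.IsElementary j)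
    (a : A.V.at' J) (b : A.V.at' (f.fiber j)), muUp s t i f j hf a b = muDown s t i f j hf a b

/-! ## Reflexive globular bimodules over shuffle operads -/

/-- A reflexive globular bimodule over a shuffle operad: a pair `(P, A)` of a shuffle operad `P`
and a reflexive globular `P`-bimodule `A`. -/
structure GlobBimod (K : Type u) [Field K] where
  P : ShuffleOperad.{u, w} K
  A : RGlob (OperadBimod P)

namespace GlobBimod

variable {K : Type u} [Field K]

/-- A morphism `(P, A) ⟶ (Q, B)`: a morphism of operads `φ : P ⟶ Q` and morphisms of collections
`A_n ⟶ B_n`, equivariant along `φ` and compatible with sources, targets and identities. -/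
@[ext]
structure Hom (X Y : GlobBimod.{u, w} K) where
  base : X.P ⟶ Y.P
  app : ∀ n, (X.A.X n).V ⟶ (Y.A.X n).V
  map_lam : ∀ (n : ℕ) {I J : NonemptyFinLinOrd.{0}} (f : Shuffle I J) (j : J) (u : X.P.V.at' J)
    (p : ∀ j' : {j' // j' ≠ j}, X.P.V.at' (f.fiber j'.1)) (a : (X.A.X n).V.at' (f.fiber j)),
    Coll.ap (app n) ((X.A.X n).lam f j u p a) = (Y.A.X n).lam f j (Coll.ap base.hom u)
      (fun j' => Coll.ap base.hom (p j')) (Coll.ap (app n) a)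
  map_rho : ∀ (n : ℕ) {I J : NonemptyFinLinOrd.{0}} (f : Shuffle I J) (a : (X.A.X n).V.at' J)
    (p : ∀ j, X.P.V.at' (f.fiber j)),
    Coll.ap (app n) ((X.A.X n).rho f a p) = (Y.A.X n).rho f (Coll.ap (app n) a)
      (fun j => Coll.ap base.hom (p j))
  s_comm : ∀ n, (X.A.s n).hom ≫ app n = app (n + 1) ≫ (Y.A.s n).hom
  t_comm : ∀ n, (X.A.t n).hom ≫ app n = app (n + 1) ≫ (Y.A.t n).hom
  i_comm : ∀ n, (X.A.i n).hom ≫ app (n + 1) = app n ≫ (Y.A.i n).hom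

instance : Category (GlobBimod.{u, w} K) where
  Hom := Hom
  id X := ⟨𝟙 X.P, fun n => 𝟙 _, fun _ _ _ _ _ _ _ _ => rfl, fun _ _ _ _ _ _ => rfl,
    by simp, by simp, by simp⟩
  comp φ ψ := ⟨φ.base ≫ ψ.base, fun n => φ.app n ≫ ψ.app n,
    fun n _ _ f j u p a => (congrArg (Coll.ap (ψ.app n)) (φ.map_lam n f j u p a)).trans
      (ψ.map_lam n f j _ _ _),
    fun n _ _ f a p => (congrArg (Coll.ap (ψ.app n)) (φ.map_rho n f a p)).trans
      (ψ.map_rho n f _ _),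
    fun n => by rw [← Category.assoc, φ.s_comm, Category.assoc, ψ.s_comm, Category.assoc],
    fun n => by rw [← Category.assoc, φ.t_comm, Category.assoc, ψ.t_comm, Category.assoc],
    fun n => by rw [← Category.assoc, φ.i_comm, Category.assoc, ψ.i_comm, Category.assoc]⟩
  id_comp φ := Hom.ext (Category.id_comp φ.base) (funext fun n => Category.id_comp (φ.app n))
  comp_id φ := Hom.ext (Category.comp_id φ.base) (funext fun n => Category.comp_id (φ.app n))
  assoc φ ψ χ := Hom.ext (Category.assoc φ.base ψ.base χ.base)
    (funext fun n => Category.assoc (φ.app n) (ψ.app n) (χ.app n))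

end GlobBimod

/-- A pair `(P, A)` with `A_0 = P` as `P`-bimodules. -/
structure BasedGlobBimod (K : Type u) [Field K] extends GlobBimod.{u, w} K where
  zero : A.X 0 = P.regular

namespace BasedGlobBimod

variable {K : Type u} [Field K]

/-- The identification `A_0 = P`. -/
def toBase (X : BasedGlobBimod.{u, w} K) : X.A.X 0 ⟶ X.P.regular := eqToHom X.zero

/-- The identification `A_0 = P`, on underlying collections. -/
def toBaseColl (X : BasedGlobBimod.{u, w} K) : (X.A.X 0).V ⟶ X.P.V := X.toBase.hom

/-- The identification `P = A_0`. -/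
def ofBase (X : BasedGlobBimod.{u, w} K) : X.P.regular ⟶ X.A.X 0 := eqToHom X.zero.symm

/-- The 0-source `s_0 : A_n ⟶ P`. -/
def src₀ (X : BasedGlobBimod.{u, w} K) (n : ℕ) : X.A.X n ⟶ X.P.regular :=
  X.A.src (Nat.zero_le n) ≫ X.toBase

/-- The 0-target `t_0 : A_n ⟶ P`. -/
def tgt₀ (X : BasedGlobBimod.{u, w} K) (n : ℕ) : X.A.X n ⟶ X.P.regular :=
  X.A.tgt (Nat.zero_le n) ≫ X.toBase

/-- The iterated identity `P ⟶ A_n`. -/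
def idn₀ (X : BasedGlobBimod.{u, w} K) (n : ℕ) : X.P.regular ⟶ X.A.X n :=
  X.ofBase ≫ X.A.idn (Nat.zero_le n)

/-- A morphism of pairs `(P, A)` with `A_0 = P`: a morphism `(φ, (g_n))` of reflexive globular
bimodules that respects the identifications of the 0-cells, that is, `g_0 = φ`. -/
@[ext]
structure Hom (X Y : BasedGlobBimod.{u, w} K) where
  hom : X.toGlobBimod ⟶ Y.toGlobBimod
  zero_comm : hom.app 0 ≫ Y.toBaseColl = X.toBaseColl ≫ hom.base.hom

instance : Category (BasedGlobBimod.{u, w} K) where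
  Hom := Hom
  id X := ⟨𝟙 X.toGlobBimod, (Category.id_comp X.toBaseColl).trans
    (Category.comp_id X.toBaseColl).symm⟩
  comp {X Y Z} φ ψ := ⟨φ.hom ≫ ψ.hom, by
    change (φ.hom.app 0 ≫ ψ.hom.app 0) ≫ Z.toBaseColl
      = X.toBaseColl ≫ φ.hom.base.hom ≫ ψ.hom.base.hom
    rw [Category.assoc, ψ.zero_comm, ← Category.assoc, φ.zero_comm, Category.assoc]⟩
  id_comp φ := Hom.ext (Category.id_comp φ.hom)
  comp_id φ := Hom.ext (Category.comp_id φ.hom)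
  assoc φ ψ χ := Hom.ext (Category.assoc φ.hom ψ.hom χ.hom)

/-- All `(P, A_n)`, for `n ≥ 1`, satisfy the linear exchange relation. -/
def exchangeProperty (K : Type u) [Field K] : ObjectProperty (BasedGlobBimod.{u, w} K) :=
  fun X => ∀ n, 1 ≤ n → LinearExchange (X.src₀ n) (X.tgt₀ n) (X.idn₀ n)

end BasedGlobBimod

/-- The category of pairs `(P, A)` with `A_0 = P` such that every `(P, A_n)`, `n ≥ 1`, satisfies
the linear exchange relation. -/
abbrev ExchangeGlobBimod (K : Type u) [Field K] :=
  (BasedGlobBimod.exchangeProperty.{u, w} K).FullSubcategory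

/-!
An ω-category internal to shuffle operads is determined by its reflexive globular operad of cells:
the composition `⋆_k` is a morphism of operads out of the fibre product of `t_k` and `s_k`, hence a
linear map, and in that fibre product `(x, y) = (x, i t x) + (i s y, y) - (i t x, i t x)`. So
`x ⋆_k y = x + y - i t x` (`OmegaCat.comp_apply`). For this formula all axioms of an ω-category hold
automatically, except that `⋆_k` be compatible with the multiplications of the operads of cells
(`RGlob.toOmegaCat`, with `RGlob.LinMul` the remaining condition). The interchange of `⋆_0` with the
multiplication says that a product `μ(a; b₁, …, b_r)` depends only on the `t`-values of the other
arguments as soon as one argument lies in `ker s_0` (`OmegaCat.mul_of_root`,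
`OmegaCat.mul_of_leaf`). For elementary compositions this is the linear exchange relation
(`OmegaCat.linearExchange`).

Conversely, let `A ⇉ P` be a reflexive bimodule with linear exchange. On `ker s` the relation reads
`ρ^⊙(1 ⊙ t) = λ^⊙(t ⊙ 1)`, as in a crossed module. Every shuffle surjection factors through one
that is elementary at a given input (`Shuffle.exists_elementary`), which extends this identity from
elementary to arbitrary compositions, for a root and a leaf (`ReflBimod.peiffer_root`) and for two
leaves (`ReflBimod.peiffer_leaf`). The multiplication on `A` is
`μ(a; b₁, …, b_r) = ρ(a; s b₁, …, s b_r) + ∑_j λ(t a; t b₁, …, b_j - i s b_j, …, s b_r)`. By the two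
identities a factor in `ker s` acts through the `t`-values of all the others
(`ReflBimod.mul_of_root`, `ReflBimod.mul_of_leaf`). As `A = P ⊕ ker s`, this reduces associativity
to the associativity axioms of the bimodule (`ReflBimod.mul_assoc`), and makes this multiplication
the only one with those two properties that restricts to the multiplication of `P`
(`ReflBimod.eq_mul`). It also gives `RGlob.LinMul` for all `k`, since an increment by elements of
`ker s_k ⊆ ker s_0` depends only on the `t`-values of the remaining arguments
(`ReflBimod.mul_add_sub`).

Both constructions leave the underlying reflexive globular collection unchanged, so the round trips
are identities on cells and recover the multiplications by uniqueness. The equalities of functors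
are obtained from natural transformations all of whose components are `eqToHom`
(`CategoryTheory.Functor.eq_id_of_isEqToHom`).
-/

universe u' v'

/-! ### Maps that are additive in each variable -/

section Multiadditive

variable {J : Type} [DecidableEq J] {X : J → Type w} [∀ j, AddCommGroup (X j)] {Y : Type w}
  [AddCommGroup Y]

/-- A function of several variables that is additive in each of them. -/
def Multiadditive (F : (∀ j, X j) → Y) : Prop :=
  ∀ v j x y, F (Function.update v j (x + y)) = F (Function.update v j x) + F (Function.update v j y)

namespace Multiadditive

variable {F G : (∀ j, X j) → Y}

theorem map_insertAt_add (hF : Multiadditive F) (j : J) (p : ∀ j' : {j' // j' ≠ j}, X j'.1)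
    (x y : X j) : F (insertAt j p (x + y)) = F (insertAt j p x) + F (insertAt j p y) := by
  rw [insertAt_update_self j p (x + y) 0, hF, ← insertAt_update_self, ← insertAt_update_self]

theorem map_insertAt_zero (hF : Multiadditive F) (j : J) (p : ∀ j' : {j' // j' ≠ j}, X j'.1) :
    F (insertAt j p 0) = 0 := by
  have h := hF.map_insertAt_add j p 0 0
  rw [add_zero] at h
  exact left_eq_add.mp h

theorem map_insertAt_sub (hF : Multiadditive F) (j : J) (p : ∀ j' : {j' // j' ≠ j}, X j'.1)
    (x y : X j) : F (insertAt j p (x - y)) = F (insertAt j p x) - F (insertAt j p y) := by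
  rw [eq_sub_iff_add_eq, ← hF.map_insertAt_add, sub_add_cancel]

theorem map_eq_zero (hF : Multiadditive F) (v : ∀ j, X j) (j : J) (h : v j = 0) : F v = 0 := by
  rw [eq_insertAt j (fun j' => v j'.1) 0 h fun _ _ => rfl, hF.map_insertAt_zero]

/-- A telescoping sum: the variables are changed from `x` to `y` one after the other, in increasing
order. -/
theorem telescope {J : Type} [LinearOrder J] [Fintype J] {X : J → Type w}
    [∀ j, AddCommGroup (X j)] {F : (∀ j, X j) → Y} (hF : Multiadditive F) (x y : ∀ j, X j) :
    F y = F x + ∑ j, F (insertAt j (fun j' => if j'.1 < j then y j'.1 else x j'.1)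
      (y j - x j)) := by
  have key : ∀ S : Finset J, F (fun j => if j ∈ S then y j else x j) = F x + ∑ j ∈ S,
      F (insertAt j (fun j' => if j'.1 < j ∧ j'.1 ∈ S then y j'.1 else x j'.1) (y j - x j)) := by
    intro S
    induction S using Finset.induction_on_max with
    | empty => simp
    | insert a S hmax ih =>
      have ha : a ∉ S := fun h => lt_irrefl a (hmax a h)
      rw [Finset.sum_insert ha]
      have h₁ : ∀ j ∈ S, F (insertAt j (fun j' : {j' // j' ≠ j} =>
          if j'.1 < j ∧ j'.1 ∈ insert a S then y j'.1 else x j'.1) (y j - x j)) =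
          F (insertAt j (fun j' : {j' // j' ≠ j} =>
          if j'.1 < j ∧ j'.1 ∈ S then y j'.1 else x j'.1) (y j - x j)) := by
        intro j hj
        congr 2
        funext j'
        have : (j'.1 < j ∧ j'.1 ∈ insert a S) ↔ (j'.1 < j ∧ j'.1 ∈ S) := by
          constructor
          · rintro ⟨h, h'⟩
            rcases Finset.mem_insert.mp h' with h'' | h''
            · exact absurd (h''.symm ▸ h) (not_lt.mpr (hmax j hj).le)
            · exact ⟨h, h''⟩
          · exact fun h => ⟨h.1, Finset.mem_insert_of_mem h.2⟩
        simp only [this]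
      rw [Finset.sum_congr rfl h₁, hF.map_insertAt_sub]
      have h₂ : ∀ j' : {j' // j' ≠ a}, (j'.1 < a ∧ j'.1 ∈ insert a S) ↔ j'.1 ∈ S := fun j' =>
        ⟨fun h => (Finset.mem_insert.mp h.2).resolve_left j'.2,
          fun h => ⟨hmax _ h, Finset.mem_insert_of_mem h⟩⟩
      simp only [h₂]
      rw [← eq_insertAt a (fun j' => if j'.1 ∈ S then y j'.1 else x j'.1) (x a)
          (q := fun j => if j ∈ S then y j else x j) (by simp [ha]) (fun _ _ => rfl),
        ← eq_insertAt a (fun j' => if j'.1 ∈ S then y j'.1 else x j'.1) (y a)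
          (q := fun j => if j ∈ insert a S then y j else x j) (by simp)
          (fun j' h => by simp [h]), ih]
      abel
  simpa using key Finset.univ

/-- Two multiadditive maps agree if they agree on the image of a family `e` of maps, and as soon as
one variable is of the form `x - e x`. -/
theorem eq_of_split [Finite J] (hF : Multiadditive F) (hG : Multiadditive G)
    (e : ∀ j, X j → X j)
    (h : ∀ v j x, F (Function.update v j (x - e j x)) = G (Function.update v j (x - e j x)))
    (h₀ : ∀ v : ∀ j, X j, F (fun j => e j (v j)) = G (fun j => e j (v j)))
    (v : ∀ j, X j) : F v = G v := by
  cases nonempty_fintype J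
  have key : ∀ (S : Finset J) (v : ∀ j, X j),
      F (fun j => if j ∈ S then v j else e j (v j)) =
      G (fun j => if j ∈ S then v j else e j (v j)) := by
    intro S
    induction S using Finset.induction_on with
    | empty => intro v; simpa using h₀ v
    | insert a S ha ih =>
      intro v
      have h₁ : (fun j => if j ∈ insert a S then v j else e j (v j)) =
          Function.update (fun j => if j ∈ S then v j else e j (v j)) a
            (e a (v a) + (v a - e a (v a))) := by
        funext j
        by_cases hj : j = a
        · subst hj; simp
        · simp [hj]
      have h₂ : Function.update (fun j => if j ∈ S then v j else e j (v j)) a (e a (v a)) =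
          fun j => if j ∈ S then v j else e j (v j) := by
        refine Function.update_eq_self_iff.mpr ?_
        simp [ha]
      rw [h₁, hF, hG, h, h₂, ih]
  simpa using key Finset.univ v

/-- The increment `F (v + n) - F v` is determined by the restrictions of `F` to the vectors one
of whose components is a component of `n`. -/
theorem map_add_sub [Finite J] (hF : Multiadditive F) (hG : Multiadditive G) (v v' n : ∀ j, X j)
    (h : ∀ (S : Set J) [DecidablePred (· ∈ S)] (j : J),
      F (insertAt j (fun j' => if j'.1 ∈ S then v j'.1 + n j'.1 else v j'.1) (n j)) =
      G (insertAt j (fun j' => if j'.1 ∈ S then v' j'.1 + n j'.1 else v' j'.1) (n j))) :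
    F (fun j => v j + n j) - F v = G (fun j => v' j + n j) - G v' := by
  cases nonempty_fintype J
  have step : ∀ {H : (∀ j, X j) → Y} (_ : Multiadditive H) (v : ∀ j, X j) (S : Finset J) (a : J)
      (_ : a ∉ S), H (fun j => if j ∈ insert a S then v j + n j else v j) =
      H (fun j => if j ∈ S then v j + n j else v j) +
      H (insertAt a (fun j' => if j'.1 ∈ S then v j'.1 + n j'.1 else v j'.1) (n a)) := by
    intro H hH v S a ha
    rw [eq_insertAt a (fun j' => if j'.1 ∈ S then v j'.1 + n j'.1 else v j'.1) (v a)
          (q := fun j => if j ∈ S then v j + n j else v j) (by simp [ha]) (fun _ _ => rfl),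
      ← hH.map_insertAt_add]
    congr 1
    exact eq_insertAt a _ _ (by simp) fun j' h => by simp [h]
  have key : ∀ S : Finset J, F (fun j => if j ∈ S then v j + n j else v j) - F v =
      G (fun j => if j ∈ S then v' j + n j else v' j) - G v' := by
    intro S
    induction S using Finset.induction_on with
    | empty => simp
    | insert a S ha ih =>
      rw [step hF v S a ha, step hG v' S a ha, add_sub_right_comm, ih, add_sub_right_comm]
      congr 1
      exact h (S : Set J) a
  simpa using key Finset.univ

end Multiadditive

end Multiadditive

/-! ### Shuffle surjections and elementary compositions -/

namespace Shuffle

variable {I J L : NonemptyFinLinOrd.{0}}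

/-- A shuffle surjection with one-element fibres is an isomorphism. -/
noncomputable def orderIso (f : Shuffle I J) (hf : ∀ j, Subsingleton (f.fiber j)) : I ≃o J :=
  (StrictMono.orderIsoOfSurjective (fun j => Classical.choose (f.surj j))
    (fun j j' h => by
      obtain ⟨x, hx, hlt⟩ := f.shuffle j j' h _ (Classical.choose_spec (f.surj j'))
      have hx' : x = Classical.choose (f.surj j) :=
        congrArg Subtype.val ((hf j).elim ⟨x, hx⟩ ⟨_, Classical.choose_spec (f.surj j)⟩)
      exact lt_of_eq_of_lt hx'.symm hlt)
    (fun x => ⟨f.toFun x, congrArg Subtype.val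
      ((hf (f.toFun x)).elim ⟨_, Classical.choose_spec (f.surj (f.toFun x))⟩ ⟨x, rfl⟩)⟩)).symm

theorem orderIso_apply (f : Shuffle I J) (hf : ∀ j, Subsingleton (f.fiber j)) (x : I) :
    f.orderIso hf x = f.toFun x :=
  (OrderIso.symm_apply_eq _).mpr (congrArg Subtype.val
    ((hf (f.toFun x)).elim ⟨x, rfl⟩ ⟨_, Classical.choose_spec (f.surj (f.toFun x))⟩))

/-- If the target of `f` has one element, then the source is the only fibre. -/
def isoFiber (f : Shuffle I J) (hJ : Subsingleton J) (j : J) : I ≃o f.fiber j where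
  toFun x := ⟨x, hJ.elim _ _⟩
  invFun x := x.1
  left_inv _ := rfl
  right_inv _ := rfl
  map_rel_iff' := Iff.rfl

/-- Every shuffle surjection `f : I ↠ J` factors, for every `j : J`, through one that is elementary
at `j`, followed (in the tree: grafted on top of it) by compositions at the other inputs only. -/
theorem exists_elementary (f : Shuffle I J) (j : J) :
    ∃ (M : NonemptyFinLinOrd.{0}) (f₁ : Shuffle M J) (g : Shuffle I M), f₁.IsElementary j ∧
      (∀ x, f₁.toFun x = j → Subsingleton (g.fiber x)) ∧ f = f₁.comp g := by
  classical
  -- the smallest element of the fibre through `x`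
  have hmin : ∀ x : I, ∃ m : I, f.toFun m = f.toFun x ∧ ∀ y, f.toFun y = f.toFun x → m ≤ y := by
    intro x
    obtain ⟨m, hm, hle⟩ := (Finset.univ.filter fun y => f.toFun y = f.toFun x).exists_minimal
      ⟨x, by simp⟩
    refine ⟨m, (Finset.mem_filter.mp hm).2, fun y hy => ?_⟩
    rcases le_total m y with h | h
    · exact h
    · exact hle (by simpa using hy) h
  choose m hm hle using hmin
  have hmm : ∀ x y, f.toFun x = f.toFun y → m x = m y := fun x y h =>
    le_antisymm (hle x _ ((hm y).trans h.symm)) (hle y _ ((hm x).trans h))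
  let r : I → I := fun x => if f.toFun x = j then x else m x
  have hr : ∀ x, f.toFun (r x) = f.toFun x := by
    intro x
    by_cases h : f.toFun x = j
    · simp [r, h]
    · simp [r, h, hm]
  have hrle : ∀ x, r x ≤ x := by
    intro x
    by_cases h : f.toFun x = j
    · simp [r, h]
    · simp [r, h, hle x x rfl]
  have hrr : ∀ x, r (r x) = r x := by
    intro x
    by_cases h : f.toFun x = j
    · simp [r, h]
    · have h' : f.toFun (m x) ≠ j := by rw [hm]; exact h
      simp only [r, h, if_false, h']
      exact hmm _ _ (hm x)
  have : Nonempty {x : I // r x = x} := ⟨⟨r (Classical.arbitrary I), hrr _⟩⟩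
  refine ⟨NonemptyFinLinOrd.of {x : I // r x = x}, ⟨fun x => f.toFun x.1, ?_, ?_⟩,
    ⟨fun x => ⟨r x, hrr x⟩, ?_, ?_⟩, ?_, ?_, ?_⟩
  · intro j'
    obtain ⟨x, hx⟩ := f.surj j'
    exact ⟨⟨r x, hrr x⟩, (hr x).trans hx⟩
  · intro j₁ j₂ h y hy
    obtain ⟨x, hx, hlt⟩ := f.shuffle j₁ j₂ h y.1 hy
    exact ⟨⟨r x, hrr x⟩, (hr x).trans hx, (lt_of_le_of_lt (hrle x) hlt : r x < y.1)⟩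
  · exact fun y => ⟨y.1, Subtype.ext y.2⟩
  · intro y y' h z hz
    exact ⟨y.1, Subtype.ext y.2, lt_of_lt_of_le (b := y'.1) h (by
      rw [← congrArg Subtype.val hz]; exact hrle z)⟩
  · intro j' hj'
    refine ⟨fun x y => Subtype.ext (Subtype.ext ?_)⟩
    have hx : f.toFun x.1.1 = j' := x.2
    have hy : f.toFun y.1.1 = j' := y.2
    have hxm : m x.1.1 = x.1.1 := by simpa [r, hx, hj'] using x.1.2
    have hym : m y.1.1 = y.1.1 := by simpa [r, hy, hj'] using y.1.2
    rw [← hxm, ← hym]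
    exact hmm _ _ (hx.trans hy.symm)
  · intro x hx
    have key : ∀ z : I, (⟨r z, hrr z⟩ : {x : I // r x = x}) = x → z = x.1 := by
      intro z hz
      have h₁ : r z = x.1 := congrArg Subtype.val hz
      have h₂ : f.toFun z = j := by rw [← hr z, h₁]; exact hx
      rw [← h₁]
      simp [r, h₂]
    exact ⟨fun a b => Subtype.ext ((key _ a.2).trans (key _ b.2).symm)⟩
  · obtain ⟨F, hs, hsh⟩ := f
    have : F = fun x => F (r x) := funext fun x => (hr x).symm
    congr 1

end Shuffle

/-! ### Units and elementary properties of the actions -/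

namespace Coll

variable {K : Type u} [Field K] (V : Coll.{u, w} K) {I J : NonemptyFinLinOrd.{0}}

/-- Restriction is canonical: there is at most one order isomorphism between finite ordered sets. -/
theorem tr_canonical (e d : I ≃o J) (x : V.at' J) : V.tr e x = V.tr d x := by
  have : Subsingleton (I ≃o J) := OrderIso.subsingleton_of_wellFoundedLT
  rw [Subsingleton.elim e d]

theorem tr_self (e : I ≃o I) (x : V.at' I) : V.tr e x = x :=
  (V.tr_canonical e (OrderIso.refl I) x).trans (V.tr_refl x)

theorem tr_tr_self (e : I ≃o J) (d : J ≃o I) (x : V.at' I) : V.tr e (V.tr d x) = x := by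
  rw [tr_tr, tr_self]

end Coll

namespace OperadBimod

variable {K : Type u} [Field K] {P : ShuffleOperad.{u, w} K} (A : OperadBimod P)
  {I J : NonemptyFinLinOrd.{0}} (f : Shuffle I J)

theorem rho_multiadditive (a : A.V.at' J) : Multiadditive (A.rho f a) :=
  fun p j x y => (A.rho_linear_leaf f a p j).map_add x y

theorem lam_multiadditive (j : J) (u : P.V.at' J) (a : A.V.at' (f.fiber j)) :
    Multiadditive (fun p => A.lam f j u p a) :=
  fun p j' x y => (A.lam_linear_leaf f j u p a j').map_add x y

theorem lam_add (j : J) (u : P.V.at' J) (p : ∀ j' : {j' // j' ≠ j}, P.V.at' (f.fiber j'.1))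
    (a b : A.V.at' (f.fiber j)) : A.lam f j u p (a + b) = A.lam f j u p a + A.lam f j u p b :=
  (A.lam_linear f j u p).map_add a b

theorem lam_zero (j : J) (u : P.V.at' J) (p : ∀ j' : {j' // j' ≠ j}, P.V.at' (f.fiber j'.1)) :
    A.lam f j u p 0 = 0 := (A.lam_linear f j u p).map_zero

end OperadBimod

namespace ShuffleOperad

variable {K : Type u} [Field K] (P : ShuffleOperad.{u, w} K) {I J : NonemptyFinLinOrd.{0}}

theorem mul_multiadditive (f : Shuffle I J) (u : P.V.at' J) : Multiadditive (P.mul f u) :=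
  fun p j x y => (P.linear_leaf f u p j).map_add x y

theorem tr_oneAt (e : I ≃o J) (hI : Subsingleton I) (hJ : Subsingleton J) :
    P.V.tr e (P.oneAt J hJ) = P.oneAt I hI :=
  (P.V.tr_tr _ _ _).trans (P.V.tr_canonical _ _ _)

end ShuffleOperad

namespace OperadBimod

variable {K : Type u} [Field K] {P : ShuffleOperad.{u, w} K} (A : OperadBimod P)
  {I J : NonemptyFinLinOrd.{0}} (f : Shuffle I J)

/-- The right action of units at all inputs. -/
theorem rho_oneAt (hf : ∀ j, Subsingleton (f.fiber j)) (e : I ≃o J) (a : A.V.at' J) :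
    A.rho f a (fun j => P.oneAt _ (hf j)) = A.V.tr e a := by
  have h := A.rho_natural f (Shuffle.refl J) e (OrderIso.refl J)
    (fun x => by
      have : Subsingleton (I ≃o J) := OrderIso.subsingleton_of_wellFoundedLT
      rw [Subsingleton.elim e (f.orderIso hf)]
      exact (f.orderIso_apply hf x).symm) a
    (fun _ => P.oneAt _ inferInstance)
  rw [A.rho_one, Coll.tr_refl] at h
  rw [← h]
  congr 1
  funext j
  exact (P.tr_oneAt _ _ _).symm

/-- The left action of a unit. -/
theorem lam_oneAt (hJ : Subsingleton J) (j : J)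
    (p : ∀ j' : {j' // j' ≠ j}, P.V.at' (f.fiber j'.1)) (a : A.V.at' (f.fiber j))
    (e : I ≃o f.fiber j) : A.lam f j (P.oneAt J hJ) p a = A.V.tr e a := by
  have hd : ∀ x, Shuffle.ptIso J hJ (f.toFun x) = (Shuffle.const I).toFun (OrderIso.refl I x) :=
    fun x => Subsingleton.elim (α := Fin 1) _ _
  have h := A.lam_natural f (Shuffle.const I) (OrderIso.refl I) (Shuffle.ptIso J hJ) hd j P.one
    (fun j' => absurd (Subsingleton.elim (α := Fin 1) _ _) j'.2)
    (A.V.tr (Shuffle.constFiber I _) (A.V.tr e a))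
  rw [A.one_lam, Coll.tr_refl, Coll.tr_tr, Coll.tr_tr, Coll.tr_self] at h
  rw [← h]
  unfold ShuffleOperad.oneAt
  congr 1
  funext j'
  exact absurd (hJ.elim _ _) j'.2

end OperadBimod

namespace ShuffleOperad

variable {K : Type u} [Field K] (P : ShuffleOperad.{u, w} K) {I J : NonemptyFinLinOrd.{0}}
  (f : Shuffle I J)

theorem oneAt_mul (hJ : Subsingleton J) (j : J) (v : ∀ j, P.V.at' (f.fiber j))
    (e : I ≃o f.fiber j) : P.mul f (P.oneAt J hJ) v = P.V.tr e (v j) := by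
  exact (congrArg (P.mul f _) (eq_insertAt j _ _ rfl fun _ _ => rfl)).trans
    (P.regular.lam_oneAt f hJ j (fun j' => v j'.1) (v j) e)

end ShuffleOperad

/-! ### The Peiffer identities -/

/-- A reflexive `P`-bimodule `s, t : A ⇉ P`, `i : P → A` satisfying the linear exchange relation.
Up to the splitting `A = P ⊕ ker s` this is a crossed module: the relation says that on `ker s`
the two actions agree along `t`. -/
structure ReflBimod {K : Type u} [Field K] (P : ShuffleOperad.{u, w} K) where
  A : OperadBimod P
  s : A ⟶ P.regular
  t : A ⟶ P.regular
  i : P.regular ⟶ A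
  i_s : i ≫ s = 𝟙 _
  i_t : i ≫ t = 𝟙 _
  exchange : LinearExchange s t i

namespace ReflBimod

variable {K : Type u} [Field K] {P : ShuffleOperad.{u, w} K} (R : ReflBimod P)
  {I J M : NonemptyFinLinOrd.{0}}

/-- The source, on elements. -/
def S : R.A.V.at' I →ₗ[K] P.V.at' I := Coll.ap R.s.hom

/-- The target, on elements. -/
def T : R.A.V.at' I →ₗ[K] P.V.at' I := Coll.ap R.t.hom

/-- The identity, on elements. -/
def E : P.V.at' I →ₗ[K] R.A.V.at' I := Coll.ap R.i.hom

theorem S_E (p : P.V.at' I) : R.S (R.E p) = p :=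
  congrArg (fun φ : P.regular ⟶ P.regular => Coll.ap φ.hom p) R.i_s

theorem T_E (p : P.V.at' I) : R.T (R.E p) = p :=
  congrArg (fun φ : P.regular ⟶ P.regular => Coll.ap φ.hom p) R.i_t

theorem S_tr (e : I ≃o J) (a : R.A.V.at' J) : R.S (R.A.V.tr e a) = P.V.tr e (R.S a) :=
  Coll.ap_tr R.s.hom e a

theorem T_tr (e : I ≃o J) (a : R.A.V.at' J) : R.T (R.A.V.tr e a) = P.V.tr e (R.T a) :=
  Coll.ap_tr R.t.hom e a

theorem E_tr (e : I ≃o J) (p : P.V.at' J) : R.E (P.V.tr e p) = R.A.V.tr e (R.E p) :=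
  Coll.ap_tr R.i.hom e p

variable (f : Shuffle I J)

theorem S_rho (a : R.A.V.at' J) (p : ∀ j, P.V.at' (f.fiber j)) :
    R.S (R.A.rho f a p) = P.mul f (R.S a) p := R.s.map_rho f a p

theorem T_rho (a : R.A.V.at' J) (p : ∀ j, P.V.at' (f.fiber j)) :
    R.T (R.A.rho f a p) = P.mul f (R.T a) p := R.t.map_rho f a p

theorem S_lam (j : J) (u : P.V.at' J) (p : ∀ j' : {j' // j' ≠ j}, P.V.at' (f.fiber j'.1))
    (a : R.A.V.at' (f.fiber j)) : R.S (R.A.lam f j u p a) = P.mul f u (insertAt j p (R.S a)) :=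
  R.s.map_lam f j u p a

theorem T_lam (j : J) (u : P.V.at' J) (p : ∀ j' : {j' // j' ≠ j}, P.V.at' (f.fiber j'.1))
    (a : R.A.V.at' (f.fiber j)) : R.T (R.A.lam f j u p a) = P.mul f u (insertAt j p (R.T a)) :=
  R.t.map_lam f j u p a

theorem rho_E (u : P.V.at' J) (p : ∀ j, P.V.at' (f.fiber j)) :
    R.A.rho f (R.E u) p = R.E (P.mul f u p) := (R.i.map_rho f u p).symm

theorem lam_E (j : J) (u : P.V.at' J) (p : ∀ j' : {j' // j' ≠ j}, P.V.at' (f.fiber j'.1))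
    (q : P.V.at' (f.fiber j)) : R.A.lam f j u p (R.E q) = R.E (P.mul f u (insertAt j p q)) :=
  (R.i.map_lam f j u p q).symm

theorem exchange_apply (j : J) (hf : f.IsElementary j) (a : R.A.V.at' J)
    (b : R.A.V.at' (f.fiber j)) :
    R.A.rhoPartial f j hf a (R.S b) + R.A.lamPartial f j hf (R.T a) b
      - R.E (P.mulPartial f j hf (R.T a) (R.S b)) =
    R.A.lamPartial f j hf (R.S a) b + R.A.rhoPartial f j hf a (R.T b)
      - R.E (P.mulPartial f j hf (R.S a) (R.T b)) := R.exchange f j hf a b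

/-- The linear exchange relation on `ker s`. -/
theorem peiffer_elementary (j : J) (hf : f.IsElementary j) (a : R.A.V.at' J)
    (b : R.A.V.at' (f.fiber j)) (ha : R.S a = 0) (hb : R.S b = 0) :
    R.A.rhoPartial f j hf a (R.T b) = R.A.lamPartial f j hf (R.T a) b := by
  have h := R.exchange_apply f j hf a b
  have e₁ : R.A.rhoPartial f j hf a 0 = 0 := (R.A.rho_multiadditive f a).map_insertAt_zero j _
  have e₂ : P.mulPartial f j hf (R.T a) 0 = 0 := (P.mul_multiadditive f _).map_insertAt_zero j _
  have e₃ : R.A.lamPartial f j hf 0 b = 0 := (R.A.lam_linear_root f j _ b).map_zero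
  have e₄ : P.mulPartial f j hf 0 (R.T b) = 0 := (P.linear_root f _).map_zero
  rw [ha, hb, e₁, e₂, e₃, e₄, map_zero, sub_zero, sub_zero, zero_add, zero_add] at h
  exact h.symm

section Fill

variable (f₁ : Shuffle M J) (g : Shuffle I M) (j : J) (hf : f₁.IsElementary j)
  (hg : ∀ x, f₁.toFun x = j → Subsingleton (g.fiber x))

/-- For `f₁` elementary at `j`, the fibres of `g` outside the one over `j` are those of `f₁ ∘ g`. -/
def fiberCompIso {x : M} (hx : Subsingleton (f₁.fiber (f₁.toFun x))) :
    g.fiber x ≃o (f₁.comp g).fiber (f₁.toFun x) :=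
  (Shuffle.restrictFiber f₁ g (f₁.toFun x) ⟨x, rfl⟩).symm.trans
    ((f₁.restrict g (f₁.toFun x)).isoFiber hx ⟨x, rfl⟩).symm

/-- Given labels `q` of the fibres of `f₁ ∘ g`, the labels of the fibres of `g` that are units over
`j` and are given by `q` elsewhere. -/
noncomputable def fill (q : ∀ i, P.V.at' ((f₁.comp g).fiber i)) (x : M) : P.V.at' (g.fiber x) :=
  if h : f₁.toFun x = j then P.oneAt _ (hg x h)
  else P.V.tr (fiberCompIso f₁ g (hf _ h)) (q (f₁.toFun x))

/-- The composition of a unit of `f₁` outside `j` with the labels `fill q` is `q`. -/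
theorem oneAt_mul_fill (q : ∀ i, P.V.at' ((f₁.comp g).fiber i)) (i : J) (hi : i ≠ j) :
    P.mul (f₁.restrict g i) (P.oneAt _ (hf i hi))
      (fun x => P.V.tr (f₁.restrictFiber g i x) (fill f₁ g j hf hg q x.1)) = q i := by
  obtain ⟨x, rfl⟩ := f₁.surj i
  rw [P.oneAt_mul (f₁.restrict g (f₁.toFun x)) (hf _ hi) ⟨x, rfl⟩ _
    (Shuffle.isoFiber _ (hf _ hi) _), fill, dif_neg hi, Coll.tr_tr, Coll.tr_tr, Coll.tr_self]

/-- Over `j` the labels `fill q` are units, so they act on an element there as a relabelling. -/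
theorem rho_fill (A : OperadBimod P) (q : ∀ i, P.V.at' ((f₁.comp g).fiber i))
    (a : A.V.at' (f₁.fiber j)) (e : (f₁.comp g).fiber j ≃o f₁.fiber j) :
    A.rho (f₁.restrict g j) a
      (fun x => P.V.tr (f₁.restrictFiber g j x) (fill f₁ g j hf hg q x.1)) = A.V.tr e a := by
  have h : ∀ x : f₁.fiber j, Subsingleton ((f₁.restrict g j).fiber x) := fun x =>
    (f₁.restrictFiber g j x).toEquiv.subsingleton_congr.mpr (hg x.1 x.2)
  rw [← A.rho_oneAt (f₁.restrict g j) h e a]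
  congr 1
  funext x
  rw [fill, dif_pos x.2, P.tr_oneAt]

/-- The restriction of `g` to the fibre over `j`, where `g` is bijective. -/
noncomputable def fiberIsoOver (hg : ∀ x, f₁.toFun x = j → Subsingleton (g.fiber x)) :
    (f₁.comp g).fiber j ≃o f₁.fiber j :=
  (f₁.restrict g j).orderIso fun x =>
    (f₁.restrictFiber g j x).toEquiv.subsingleton_congr.mpr (hg x.1 x.2)

end Fill

/-- The Peiffer identity for the root and a leaf: for `a` and `b` in `ker s`, the right action of
`t b` on `a` is the left action of `t a` on `b`. It follows from the elementary case by grafting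
the remaining labels on top of an elementary composition. -/
theorem peiffer_root (j : J) (a : R.A.V.at' J) (b : R.A.V.at' (f.fiber j)) (ha : R.S a = 0)
    (hb : R.S b = 0) (q : ∀ j, P.V.at' (f.fiber j)) :
    R.A.rho f a (insertAt j (fun j' => q j'.1) (R.T b)) =
      R.A.lam f j (R.T a) (fun j' => q j'.1) b := by
  obtain ⟨M, f₁, g, hf, hg, rfl⟩ := f.exists_elementary j
  let ε := fiberIsoOver f₁ g j hg
  have h := congrArg (fun c => R.A.rho g c (fill f₁ g j hf hg q))
    (R.peiffer_elementary f₁ j hf a (R.A.V.tr ε.symm b) ha (by rw [S_tr, hb, map_zero]))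
  simp only [OperadBimod.rhoPartial, OperadBimod.lamPartial, R.A.rho_rho, R.A.rho_lam] at h
  rw [rho_fill f₁ g j hf hg R.A q _ ε, Coll.tr_tr_self] at h
  refine Eq.trans (congrArg _ (eq_insertAt j _ _ ?_ ?_).symm) (h.trans ?_)
  · rw [insertAt_self]
    refine (rho_fill f₁ g j hf hg P.regular q _ ε).trans ?_
    rw [T_tr]
    exact Coll.tr_tr_self _ _ _ _
  · intro i hi
    rw [insertAt_ne _ _ _ hi]
    exact oneAt_mul_fill f₁ g j hf hg q i hi
  · congr 1
    funext i
    exact oneAt_mul_fill f₁ g j hf hg q i.1 i.2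

/-- The Peiffer identity for two leaves `a` and `b` in `ker s`. It is that for the root and a leaf,
applied to the root obtained by grafting `a` on `u`. -/
theorem peiffer_leaf (j k : J) (hk : k ≠ j) (u : P.V.at' J) (a : R.A.V.at' (f.fiber j))
    (b : R.A.V.at' (f.fiber k)) (ha : R.S a = 0) (hb : R.S b = 0)
    (q : ∀ j, P.V.at' (f.fiber j)) :
    R.A.lam f j u (fun j' => Function.update q k (R.T b) j'.1) a =
      R.A.lam f k u (fun j' => Function.update q j (R.T a) j'.1) b := by
  obtain ⟨M, f₁, g, hf, hg, rfl⟩ := f.exists_elementary j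
  obtain ⟨x, rfl⟩ := f₁.surj k
  let ε := fiberIsoOver f₁ g j hg
  let q' := Function.update q (f₁.toFun x) (R.T b)
  let m := R.A.lam f₁ j u (fun j' => P.oneAt _ (hf j'.1 j'.2)) (R.A.V.tr ε.symm a)
  have hm : R.S m = 0 := by
    rw [S_lam, S_tr, ha, map_zero]
    exact (P.mul_multiadditive f₁ u).map_insertAt_zero _ _
  have hx := hf _ hk
  have h := R.peiffer_root g x m (R.A.V.tr (fiberCompIso f₁ g hx) b) hm
    (by rw [S_tr, hb, map_zero]) (fill f₁ g j hf hg q')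
  rw [← eq_insertAt x (q := fill f₁ g j hf hg q') _ _ ?_ fun _ _ => rfl] at h
  · rw [R.A.rho_lam, T_lam, R.A.lam_lam, rho_fill f₁ g j hf hg R.A q' _ ε, Coll.tr_tr_self,
      insertAt_ne _ _ _ hk, R.A.lam_oneAt _ _ _ _ _ (Shuffle.isoFiber _ hx _), Coll.tr_tr,
      Coll.tr_tr, Coll.tr_self] at h
    convert h using 2
    · funext i
      exact (oneAt_mul_fill f₁ g j hf hg q' i.1 i.2).symm
    · funext i
      by_cases hi : i.1 = j
      · obtain ⟨i, hi'⟩ := i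
        dsimp only at hi
        subst hi
        rw [Function.update_self, insertAt_self]
        refine Eq.symm ((rho_fill f₁ g i hf hg P.regular q' _ ε).trans ?_)
        rw [T_tr]
        exact Coll.tr_tr_self _ _ _ _
      · rw [Function.update_of_ne hi, insertAt_ne _ _ _ hi]
        refine Eq.symm ((oneAt_mul_fill f₁ g j hf hg q' i.1 hi).trans ?_)
        exact Function.update_of_ne i.2 _ _
  · rw [fill, dif_neg hk, T_tr]
    exact congrArg _ (Function.update_self _ _ _)

end ReflBimod

/-! ### The operad of a reflexive bimodule -/

theorem IsLinearMap.comp_linearMap {K : Type u} [Field K] {X Y Z : Type w} [AddCommGroup X]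
    [AddCommGroup Y] [AddCommGroup Z] [Module K X] [Module K Y] [Module K Z] {F : Y → Z}
    (hF : IsLinearMap K F) (φ : X →ₗ[K] Y) : IsLinearMap K (fun x => F (φ x)) :=
  ((hF.mk' F).comp φ).isLinear

namespace ReflBimod

variable {K : Type u} [Field K] {P : ShuffleOperad.{u, w} K} (R : ReflBimod P)
  {I J L : NonemptyFinLinOrd.{0}}

/-- The projection `b ↦ b - i s b` onto `ker s`. -/
def bar : R.A.V.at' I →ₗ[K] R.A.V.at' I := LinearMap.id - R.E ∘ₗ R.S

theorem bar_apply (a : R.A.V.at' I) : R.bar a = a - R.E (R.S a) := rfl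

theorem S_bar (a : R.A.V.at' I) : R.S (R.bar a) = 0 := by
  rw [bar_apply, map_sub, S_E, sub_self]

theorem T_bar (a : R.A.V.at' I) : R.T (R.bar a) = R.T a - R.S a := by
  rw [bar_apply, map_sub, T_E]

theorem bar_E (p : P.V.at' I) : R.bar (R.E p) = 0 := by
  rw [bar_apply, S_E, sub_self]

theorem bar_eq (a : R.A.V.at' I) (h : R.S a = 0) : R.bar a = a := by
  rw [bar_apply, h, map_zero, sub_zero]

theorem bar_tr (e : I ≃o J) (a : R.A.V.at' J) : R.bar (R.A.V.tr e a) = R.A.V.tr e (R.bar a) := by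
  rw [bar_apply, bar_apply, S_tr, E_tr, map_sub]

variable (f : Shuffle I J)

/-- The labels `t b` to the left of `j` and `s b` to the right of `j`. -/
def pass (b : ∀ j, R.A.V.at' (f.fiber j)) (j : J) (j' : {j' // j' ≠ j}) :
    P.V.at' (f.fiber j'.1) :=
  if j'.1 < j then R.T (b j'.1) else R.S (b j'.1)

/-- The multiplication on `A`: the elements `a, b₁, …, b_k` are passed from their sources to their
targets one after the other, in this order. -/
noncomputable def mul (a : R.A.V.at' J) (b : ∀ j, R.A.V.at' (f.fiber j)) : R.A.V.at' I :=
  R.A.rho f a (fun j => R.S (b j)) + ∑ j, R.A.lam f j (R.T a) (R.pass f b j) (R.bar (b j))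

theorem mul_linear_root (b : ∀ j, R.A.V.at' (f.fiber j)) :
    IsLinearMap K (fun a => R.mul f a b) := by
  have h := ((R.A.rho_linear f (fun j => R.S (b j))).mk' _ + ∑ j,
    ((R.A.lam_linear_root f j (R.pass f b j) (R.bar (b j))).comp_linearMap R.T).mk' _).isLinear
  convert h using 2 with a
  simp [mul, LinearMap.sum_apply]

theorem mul_linear_leaf (a : R.A.V.at' J) (b : ∀ j, R.A.V.at' (f.fiber j)) (j : J) :
    IsLinearMap K (fun x => R.mul f a (Function.update b j x)) := by
  have h₀ : IsLinearMap K fun x => R.A.rho f a (fun k => R.S (Function.update b j x k)) := by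
    convert (R.A.rho_linear_leaf f a (fun k => R.S (b k)) j).comp_linearMap R.S using 3 with x
    funext k
    exact Function.apply_update (fun k => R.S (I := f.fiber k)) b j x k
  have h₁ : ∀ k, IsLinearMap K fun x => R.A.lam f k (R.T a)
      (R.pass f (Function.update b j x) k) (R.bar (Function.update b j x k)) := by
    intro k
    by_cases hk : k = j
    · subst hk
      convert (R.A.lam_linear f k (R.T a) (R.pass f b k)).comp_linearMap R.bar using 3 with x
      · funext k'
        simp only [pass, Function.update_of_ne k'.2]
      · rw [Function.update_self]
    · convert (R.A.lam_linear_leaf f k (R.T a) (R.pass f b k) (R.bar (b k))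
        ⟨j, Ne.symm hk⟩).comp_linearMap (if j < k then R.T else R.S) using 3 with x
      · funext k'
        by_cases hk' : k' = ⟨j, Ne.symm hk⟩
        · subst hk'
          simp only [pass, Function.update_self]
          split_ifs <;> rfl
        · rw [Function.update_of_ne hk']
          simp only [pass, Function.update_of_ne (fun h => hk' (Subtype.ext h))]
      · rw [Function.update_of_ne hk]
  convert (h₀.mk' _ + ∑ k, (h₁ k).mk' _).isLinear using 2 with x
  simp [mul, LinearMap.sum_apply]

theorem mul_multiadditive (a : R.A.V.at' J) : Multiadditive (R.mul f a) :=
  fun b j x y => (R.mul_linear_leaf f a b j).map_add x y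

theorem mul_add (a a' : R.A.V.at' J) (b : ∀ j, R.A.V.at' (f.fiber j)) :
    R.mul f (a + a') b = R.mul f a b + R.mul f a' b := (R.mul_linear_root f b).map_add a a'

theorem mul_E (a : R.A.V.at' J) (q : ∀ j, P.V.at' (f.fiber j)) :
    R.mul f a (fun j => R.E (q j)) = R.A.rho f a q := by
  simp only [mul, S_E, bar_E, OperadBimod.lam_zero, Finset.sum_const_zero, add_zero]

theorem S_mul (a : R.A.V.at' J) (b : ∀ j, R.A.V.at' (f.fiber j)) :
    R.S (R.mul f a b) = P.mul f (R.S a) (fun j => R.S (b j)) := by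
  simp only [mul, map_add, map_sum, S_rho, S_lam, S_bar]
  rw [Finset.sum_eq_zero, add_zero]
  exact fun j _ => (P.mul_multiadditive f _).map_insertAt_zero j _

theorem T_mul (a : R.A.V.at' J) (b : ∀ j, R.A.V.at' (f.fiber j)) :
    R.T (R.mul f a b) = P.mul f (R.T a) (fun j => R.T (b j)) := by
  rw [(P.mul_multiadditive f (R.T a)).telescope (fun j => R.S (b j))]
  simp only [mul, map_add, map_sum, T_rho, T_lam, T_bar]
  rfl

/-- If the root is in `ker s`, the multiplication is the right action along `t`. -/
theorem mul_of_root (a : R.A.V.at' J) (ha : R.S a = 0) (b : ∀ j, R.A.V.at' (f.fiber j)) :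
    R.mul f a b = R.A.rho f a (fun j => R.T (b j)) := by
  rw [(R.A.rho_multiadditive f a).telescope (fun j => R.S (b j)), mul]
  congr 1
  refine Finset.sum_congr rfl fun j _ => ?_
  have h := R.peiffer_root f j a (R.bar (b j)) ha (R.S_bar _)
    (fun j' => if j' < j then R.T (b j') else R.S (b j'))
  rw [T_bar] at h
  exact h.symm

/-- If a leaf is in `ker s`, the multiplication is the left action along `t`. -/
theorem mul_of_leaf (a : R.A.V.at' J) (b : ∀ j, R.A.V.at' (f.fiber j)) (j : J)
    (hj : R.S (b j) = 0) :
    R.mul f a b = R.A.lam f j (R.T a) (fun j' => R.T (b j'.1)) (b j) := by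
  rw [mul, (R.A.rho_multiadditive f a).map_eq_zero _ j hj, zero_add,
    Fintype.sum_eq_add_sum_subtype_ne _ j, R.bar_eq _ hj]
  have hG := R.A.lam_multiadditive f j (R.T a) (b j)
  rw [hG.telescope (R.pass f b j) (fun j' => R.T (b j'.1))]
  congr 1
  refine Finset.sum_congr rfl fun k _ => ?_
  by_cases hk : k.1 < j
  · -- to the left of `j` both sides vanish
    have h₁ : R.pass f b k.1 ⟨j, Ne.symm k.2⟩ = 0 := by
      rw [pass, if_neg (not_lt.mpr hk.le)]
      exact hj
    have h₂ : R.T (b k.1) - R.pass f b j k = 0 := by rw [pass, if_pos hk, sub_self]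
    rw [(R.A.lam_multiadditive f k.1 (R.T a) (R.bar (b k.1))).map_eq_zero _ _ h₁, h₂]
    exact (hG.map_insertAt_zero k _).symm
  · have hk' : j < k.1 := lt_of_le_of_ne (not_lt.mp hk) (Ne.symm k.2)
    have h := R.peiffer_leaf f k.1 j (Ne.symm k.2) (R.T a) (R.bar (b k.1)) (b j) (R.S_bar _) hj
      (fun j' => if j' < k.1 then R.T (b j') else R.S (b j'))
    refine Eq.trans (congrArg₂ _ ?_ rfl) (h.trans (congrArg₂ _ ?_ rfl))
    · funext j'
      by_cases hj' : j'.1 = j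
      · obtain ⟨j', h₁⟩ := j'
        dsimp only at hj'
        subst hj'
        rw [Function.update_self, pass, if_pos hk']
      · rw [Function.update_of_ne hj']
        rfl
    · refine eq_insertAt (X := fun j' : {j' // j' ≠ j} => P.V.at' (f.fiber j'.1)) k
        (fun j' => if j'.1 < k then R.T (b j'.1.1) else R.pass f b j j'.1) _ ?_ ?_
      · rw [Function.update_self, T_bar, pass, if_neg hk]
      · intro j' hj'
        rw [Function.update_of_ne (fun h => hj' (Subtype.ext h))]
        by_cases hlt : j'.1 < k.1
        · have hlt' : j' < k := hlt
          simp only [hlt, hlt', if_true]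
        · have hlt' : ¬ j' < k := hlt
          have hj'' : ¬ j'.1 < j := fun h => hlt (h.trans hk')
          simp only [hlt, hlt', if_false, pass, hj'']

/-- A multilinear operation with the values of `mul_of_root` and `mul_of_leaf` on `ker s`, and that
of the multiplication of `P` on `P`, is the multiplication. -/
theorem eq_mul (m : R.A.V.at' J → (∀ j, R.A.V.at' (f.fiber j)) → R.A.V.at' I)
    (hadd : ∀ a a' b, m (a + a') b = m a b + m a' b) (hm : ∀ a, Multiadditive (m a))
    (hroot : ∀ a b, R.S a = 0 → m a b = R.A.rho f a (fun j => R.T (b j)))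
    (hleaf : ∀ a b j, R.S (b j) = 0 → m a b = R.A.lam f j (R.T a) (fun j' => R.T (b j'.1)) (b j))
    (hE : ∀ p q, m (R.E p) (fun j => R.E (q j)) = R.E (P.mul f p q))
    (a : R.A.V.at' J) (b : ∀ j, R.A.V.at' (f.fiber j)) : m a b = R.mul f a b := by
  have ha : a = R.E (R.S a) + R.bar a := by rw [bar_apply, add_sub_cancel]
  rw [ha, hadd, R.mul_add, hroot _ _ (R.S_bar a), R.mul_of_root f _ (R.S_bar a)]
  congr 1
  refine (hm _).eq_of_split (R.mul_multiadditive f _) (fun j x => R.E (R.S x))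
    (fun v j x => ?_) (fun v => ?_) b
  · have h : R.S (Function.update v j (x - R.E (R.S x)) j) = 0 := by
      rw [Function.update_self]
      exact R.S_bar x
    rw [hleaf _ _ j h, R.mul_of_leaf f _ _ j h]
  · rw [hE, mul_E, rho_E]

theorem mul_update_restrict {f : Shuffle J I} (g : Shuffle L J) (v : ∀ i, R.A.V.at' (f.fiber i))
    (w : ∀ j, R.A.V.at' (g.fiber j)) (j : J) (x : R.A.V.at' (g.fiber j)) :
    (fun i => R.mul (f.restrict g i) (v i)
      (fun k => R.A.V.tr (f.restrictFiber g i k) (Function.update w j x k.1))) =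
    Function.update (fun i => R.mul (f.restrict g i) (v i)
      (fun k => R.A.V.tr (f.restrictFiber g i k) (w k.1))) (f.toFun j)
      (R.mul (f.restrict g (f.toFun j)) (v (f.toFun j))
        (fun k => R.A.V.tr (f.restrictFiber g (f.toFun j) k) (Function.update w j x k.1))) := by
  funext i
  by_cases hi : i = f.toFun j
  · subst hi
    rw [Function.update_self]
  · rw [Function.update_of_ne hi]
    congr 1
    funext k
    rw [Function.update_of_ne]
    rintro h
    exact hi (by rw [← h]; exact k.2.symm)

theorem mul_restrict_add {f : Shuffle J I} (g : Shuffle L J) (j : J)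
    (a : R.A.V.at' (f.fiber (f.toFun j))) (w : ∀ j, R.A.V.at' (g.fiber j))
    (x y : R.A.V.at' (g.fiber j)) :
    R.mul (f.restrict g (f.toFun j)) a
      (fun k => R.A.V.tr (f.restrictFiber g (f.toFun j) k) (Function.update w j (x + y) k.1)) =
    R.mul (f.restrict g (f.toFun j)) a
      (fun k => R.A.V.tr (f.restrictFiber g (f.toFun j) k) (Function.update w j x k.1)) +
    R.mul (f.restrict g (f.toFun j)) a
      (fun k => R.A.V.tr (f.restrictFiber g (f.toFun j) k) (Function.update w j y k.1)) := by
  have h : ∀ z, (fun k : f.fiber (f.toFun j) => R.A.V.tr (f.restrictFiber g (f.toFun j) k)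
      (Function.update w j z k.1)) =
      Function.update (fun k : f.fiber (f.toFun j) =>
        R.A.V.tr (f.restrictFiber g (f.toFun j) k) (w k.1)) ⟨j, rfl⟩
        (R.A.V.tr (f.restrictFiber g (f.toFun j) ⟨j, rfl⟩) z) := by
    intro z
    funext k
    by_cases hk : k = ⟨j, rfl⟩
    · subst hk
      rw [Function.update_self, Function.update_self]
    · rw [Function.update_of_ne hk, Function.update_of_ne (fun h => hk (Subtype.ext h))]
  rw [h, h, h, map_add]
  exact R.mul_multiadditive (f.restrict g (f.toFun j)) a _ _ _ _

theorem mul_assoc (f : Shuffle J I) (g : Shuffle L J) (u : R.A.V.at' I)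
    (v : ∀ i, R.A.V.at' (f.fiber i)) (w : ∀ j, R.A.V.at' (g.fiber j)) :
    R.mul g (R.mul f u v) w = R.mul (f.comp g) u (fun i => R.mul (f.restrict g i) (v i)
      (fun j => R.A.V.tr (f.restrictFiber g i j) (w j.1))) := by
  -- the root
  have hroot : ∀ u, R.S u = 0 → R.mul g (R.mul f u v) w =
      R.mul (f.comp g) u (fun i => R.mul (f.restrict g i) (v i)
        (fun j => R.A.V.tr (f.restrictFiber g i j) (w j.1))) := by
    intro u hu
    have h : R.S (R.A.rho f u (fun j => R.T (v j))) = 0 := by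
      rw [S_rho, hu]
      exact (P.linear_root f _).map_zero
    rw [R.mul_of_root f u hu, R.mul_of_root g _ h, R.A.rho_rho, R.mul_of_root _ u hu]
    simp only [T_mul, T_tr]
  have hu : u = R.E (R.S u) + R.bar u := by rw [bar_apply, add_sub_cancel]
  rw [hu, R.mul_add, R.mul_add, R.mul_add, hroot _ (R.S_bar u)]
  congr 1
  generalize R.S u = u
  -- the middle vertices
  revert v
  refine fun v _ => Multiadditive.eq_of_split (F := fun v => R.mul g (R.mul f (R.E u) v) w)
    (G := fun v => R.mul (f.comp g) (R.E u) (fun i => R.mul (f.restrict g i) (v i)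
      (fun j => R.A.V.tr (f.restrictFiber g i j) (w j.1)))) ?_ ?_ (fun i x => R.E (R.S x))
      (fun v i x => ?_) (fun v => ?_) v
  · intro v i x y
    dsimp only
    rw [R.mul_multiadditive, R.mul_add]
  · intro v i x y
    have h : ∀ z, (fun i' => R.mul (f.restrict g i') (Function.update v i z i')
        (fun j => R.A.V.tr (f.restrictFiber g i' j) (w j.1))) =
        Function.update (fun i' => R.mul (f.restrict g i') (v i')
          (fun j => R.A.V.tr (f.restrictFiber g i' j) (w j.1))) i
          (R.mul (f.restrict g i) z (fun j => R.A.V.tr (f.restrictFiber g i j) (w j.1))) := by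
      intro z
      funext i'
      exact Function.apply_update (fun i' z => R.mul (f.restrict g i') z
        (fun j => R.A.V.tr (f.restrictFiber g i' j) (w j.1))) v i z i'
    dsimp only
    rw [h, h, h, R.mul_add, R.mul_multiadditive]
  · generalize hv' : Function.update v i (x - R.E (R.S x)) = v'
    have hi : R.S (v' i) = 0 := by
      rw [← hv', Function.update_self]
      exact R.S_bar x
    have h₁ : R.S (R.A.lam f i u (fun i' => R.T (v' i'.1)) (v' i)) = 0 := by
      rw [S_lam, hi]
      exact (P.mul_multiadditive f _).map_insertAt_zero _ _
    have h₂ : R.S (R.mul (f.restrict g i) (v' i)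
        (fun j => R.A.V.tr (f.restrictFiber g i j) (w j.1))) = 0 := by
      rw [S_mul, hi]
      exact (P.linear_root _ _).map_zero
    rw [R.mul_of_leaf f _ v' i hi, T_E, R.mul_of_root g _ h₁, R.A.rho_lam,
      R.mul_of_leaf _ _ _ i h₂, R.mul_of_root _ _ hi, T_E]
    simp only [T_mul, T_tr]
  · dsimp only
    rw [mul_E, rho_E]
    -- the upper vertices
    refine (?_ : ∀ v : ∀ i, P.V.at' (f.fiber i), R.mul g (R.E (P.mul f u v)) w =
      R.mul (f.comp g) (R.E u) (fun i => R.mul (f.restrict g i) (R.E (v i))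
        (fun j => R.A.V.tr (f.restrictFiber g i j) (w j.1)))) (fun i => R.S (v i))
    intro v
    refine Multiadditive.eq_of_split (F := fun w => R.mul g (R.E (P.mul f u v)) w)
      (G := fun w => R.mul (f.comp g) (R.E u) (fun i => R.mul (f.restrict g i) (R.E (v i))
        (fun j => R.A.V.tr (f.restrictFiber g i j) (w j.1)))) (R.mul_multiadditive _ _) ?_
        (fun i x => R.E (R.S x)) (fun w j x => ?_) (fun w => ?_) w
    · intro w j x y
      dsimp only
      rw [R.mul_update_restrict, R.mul_update_restrict g _ w j x, R.mul_update_restrict g _ w j y,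
        mul_restrict_add, R.mul_multiadditive]
    · generalize hw' : Function.update w j (x - R.E (R.S x)) = w'
      have hj : R.S (w' j) = 0 := by
        rw [← hw', Function.update_self]
        exact R.S_bar x
      have h₁ : R.S (R.A.V.tr (f.restrictFiber g (f.toFun j) ⟨j, rfl⟩) (w' j)) = 0 := by
        rw [S_tr, hj, map_zero]
      have h₂ : R.S (R.mul (f.restrict g (f.toFun j)) (R.E (v (f.toFun j)))
          (fun k => R.A.V.tr (f.restrictFiber g (f.toFun j) k) (w' k.1))) = 0 := by
        rw [S_mul]
        exact (P.mul_multiadditive _ _).map_eq_zero _ ⟨j, rfl⟩ h₁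
      rw [R.mul_of_leaf g _ w' j hj, T_E, R.A.lam_lam, R.mul_of_leaf _ _ _ (f.toFun j) h₂,
        R.mul_of_leaf (f.restrict g (f.toFun j)) _ _ ⟨j, rfl⟩ h₁]
      simp only [T_mul, T_tr, T_E]
    · simp only [← E_tr, mul_E, rho_E]
      rw [P.assoc]

/-- The operad structure on `A` extending that of `P ⊆ A`. -/
noncomputable def total : ShuffleOperad.{u, w} K where
  V := R.A.V
  mul f a b := R.mul f a b
  one := R.E P.one
  linear_root f b := R.mul_linear_root f b
  linear_leaf f a b j := R.mul_linear_leaf f a b j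
  natural {I J I' J'} f f' e d h a b := by
    rw [mul, mul, map_add]
    simp only [S_tr, T_tr, bar_tr]
    rw [R.A.rho_natural f f' e d h a (fun j => R.S (b j)), map_sum,
      ← Equiv.sum_comp d.toEquiv]
    congr 1
    refine Finset.sum_congr rfl fun j _ => ?_
    refine Eq.trans (congrArg₂ _ ?_ rfl) (R.A.lam_natural f f' e d h j _ _ _)
    funext j'
    have hd : d j'.1 < d.toEquiv j ↔ j'.1 < j := d.lt_iff_lt
    simp only [pass, S_tr, T_tr, hd]
    split_ifs <;> rfl
  assoc f g u v w := R.mul_assoc f g u v w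
  one_mul {I} a := by
    rw [mul, rho_E, T_E]
    simp only [S_tr, bar_tr]
    rw [P.one_mul, Fintype.sum_unique, R.A.one_lam, bar_apply, add_sub_cancel]
  mul_one {I} a := by
    simp only [← E_tr]
    rw [mul_E]
    exact R.A.rho_one a

end ReflBimod

/-! ### Iterated sources, targets and identities -/

namespace RGlob

variable {C : Type u} [Category.{v} C] (A : RGlob C) {j k l : ℕ}

theorem src_self (h : k ≤ k) : A.src h = 𝟙 (A.X k) := Nat.leRec_self _ _

theorem tgt_self (h : k ≤ k) : A.tgt h = 𝟙 (A.X k) := Nat.leRec_self _ _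

theorem idn_self (h : k ≤ k) : A.idn h = 𝟙 (A.X k) := Nat.leRec_self _ _

theorem src_succ (h : k ≤ l) (h' : k ≤ l + 1) : A.src h' = A.s l ≫ A.src h :=
  Nat.leRec_succ _ _ h

theorem tgt_succ (h : k ≤ l) (h' : k ≤ l + 1) : A.tgt h' = A.t l ≫ A.tgt h :=
  Nat.leRec_succ _ _ h

theorem idn_succ (h : k ≤ l) (h' : k ≤ l + 1) : A.idn h' = A.idn h ≫ A.i l :=
  Nat.leRec_succ _ _ h

theorem src_src (hj : j ≤ k) (hk : k ≤ l) (h : j ≤ l) : A.src hk ≫ A.src hj = A.src h := by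
  induction hk using Nat.leRec with
  | refl => rw [src_self, Category.id_comp]
  | le_succ_of_le hk ih =>
    rw [A.src_succ hk, A.src_succ (hj.trans hk), Category.assoc, ih (hj.trans hk)]

theorem tgt_tgt (hj : j ≤ k) (hk : k ≤ l) (h : j ≤ l) : A.tgt hk ≫ A.tgt hj = A.tgt h := by
  induction hk using Nat.leRec with
  | refl => rw [tgt_self, Category.id_comp]
  | le_succ_of_le hk ih =>
    rw [A.tgt_succ hk, A.tgt_succ (hj.trans hk), Category.assoc, ih (hj.trans hk)]

theorem idn_idn (hj : j ≤ k) (hk : k ≤ l) (h : j ≤ l) : A.idn hj ≫ A.idn hk = A.idn h := by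
  induction hk using Nat.leRec with
  | refl => rw [idn_self, Category.comp_id]
  | le_succ_of_le hk ih =>
    rw [A.idn_succ hk, A.idn_succ (hj.trans hk), ← Category.assoc, ih (hj.trans hk)]

theorem idn_src (hk : k ≤ l) : A.idn hk ≫ A.src hk = 𝟙 _ := by
  induction hk using Nat.leRec with
  | refl => rw [idn_self, src_self, Category.comp_id]
  | le_succ_of_le hk ih =>
    rw [A.idn_succ hk, A.src_succ hk, Category.assoc, ← Category.assoc (A.i _), A.is,
      Category.id_comp, ih]

theorem idn_tgt (hk : k ≤ l) : A.idn hk ≫ A.tgt hk = 𝟙 _ := by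
  induction hk using Nat.leRec with
  | refl => rw [idn_self, tgt_self, Category.comp_id]
  | le_succ_of_le hk ih =>
    rw [A.idn_succ hk, A.tgt_succ hk, Category.assoc, ← Category.assoc (A.i _), A.it,
      Category.id_comp, ih]

theorem s_tgt (h : j < l) (h' : j ≤ l + 1) : A.s l ≫ A.tgt h.le = A.tgt h' := by
  obtain ⟨m, rfl⟩ : ∃ m, l = m + 1 := ⟨l - 1, by omega⟩
  rw [A.tgt_succ h.le, A.tgt_succ (Nat.lt_succ_iff.mp h), ← Category.assoc, ← A.tt,
    Category.assoc]

theorem t_src (h : j < l) (h' : j ≤ l + 1) : A.t l ≫ A.src h.le = A.src h' := by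
  obtain ⟨m, rfl⟩ : ∃ m, l = m + 1 := ⟨l - 1, by omega⟩
  rw [A.src_succ h.le, A.src_succ (Nat.lt_succ_iff.mp h), ← Category.assoc, ← A.ss,
    Category.assoc]

theorem src_tgt (hj : j < k) (hk : k ≤ l) (h : j ≤ l) : A.src hk ≫ A.tgt hj.le = A.tgt h := by
  induction hk using Nat.leRec with
  | refl => rw [src_self, Category.id_comp]
  | le_succ_of_le hk ih =>
    rw [A.src_succ hk, Category.assoc, ih (hj.le.trans hk), A.s_tgt (hj.trans_le hk)]

theorem idn_tgt_of_le (hj : j ≤ k) (hk : k ≤ l) (h : j ≤ l) : A.idn hk ≫ A.tgt h = A.tgt hj := by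
  rw [← A.tgt_tgt hj hk, ← Category.assoc, idn_tgt, Category.id_comp]

theorem idn_of_le_src (hj : j ≤ k) (hk : k ≤ l) (h : j ≤ l) : A.idn h ≫ A.src hk = A.idn hj := by
  rw [← A.idn_idn hj hk, Category.assoc, idn_src, Category.comp_id]

theorem idn_of_le_tgt (hj : j ≤ k) (hk : k ≤ l) (h : j ≤ l) : A.idn h ≫ A.tgt hk = A.idn hj := by
  rw [← A.idn_idn hj hk, Category.assoc, idn_tgt, Category.comp_id]

theorem idn_comm {A B : RGlob C} (f : A ⟶ B) (h : k ≤ l) :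
    A.idn h ≫ f.app l = f.app k ≫ B.idn h := by
  induction h using Nat.leRec with
  | refl => rw [idn_self, idn_self, Category.id_comp, Category.comp_id]
  | le_succ_of_le h ih =>
    rw [A.idn_succ h, B.idn_succ h, Category.assoc, f.i_comm, ← Category.assoc, ih,
      Category.assoc]

variable {D : Type u'} [Category.{v'} D] (U : C ⥤ D)

/-- The image of a reflexive globular object under a functor. -/
abbrev map : RGlob D where
  X n := U.obj (A.X n)
  s n := U.map (A.s n)
  t n := U.map (A.t n)
  i n := U.map (A.i n)
  ss n := by rw [← U.map_comp, A.ss, U.map_comp]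
  tt n := by rw [← U.map_comp, A.tt, U.map_comp]
  is n := by rw [← U.map_comp, A.is, U.map_id]
  it n := by rw [← U.map_comp, A.it, U.map_id]

theorem map_src (h : k ≤ l) : U.map (A.src h) = (A.map U).src h := by
  induction h using Nat.leRec with
  | refl => rw [src_self, src_self, U.map_id]
  | le_succ_of_le h ih => rw [A.src_succ h, (A.map U).src_succ h, U.map_comp, ih]

theorem map_tgt (h : k ≤ l) : U.map (A.tgt h) = (A.map U).tgt h := by
  induction h using Nat.leRec with
  | refl => rw [tgt_self, tgt_self, U.map_id]
  | le_succ_of_le h ih => rw [A.tgt_succ h, (A.map U).tgt_succ h, U.map_comp, ih]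

theorem map_idn (h : k ≤ l) : U.map (A.idn h) = (A.map U).idn h := by
  induction h using Nat.leRec with
  | refl => rw [idn_self, idn_self, U.map_id]
  | le_succ_of_le h ih => rw [A.idn_succ h, (A.map U).idn_succ h, U.map_comp, ih]

end RGlob

/-! ### The linear composition of cells -/

namespace RGlob

open Preadditive

variable {C : Type u} [Category.{v} C] [Preadditive C] (A : RGlob C) {j k l : ℕ} {T T' : C}

/-- The composition `a ⋆_k b = a + b - i t_k a`, the only one that is linear. -/
def lin (h : k ≤ l) (a b : T ⟶ A.X l) : T ⟶ A.X l := a + b - (a ≫ A.tgt h) ≫ A.idn h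

theorem precomp_lin (h : k ≤ l) (p : T' ⟶ T) (a b : T ⟶ A.X l) :
    A.lin h (p ≫ a) (p ≫ b) = p ≫ A.lin h a b := by
  simp only [lin, comp_sub, comp_add, Category.assoc]

theorem lin_src (h : k ≤ l) (a b : T ⟶ A.X l) (hab : a ≫ A.tgt h = b ≫ A.src h) :
    A.lin h a b ≫ A.src h = a ≫ A.src h := by
  simp only [lin, sub_comp, add_comp, Category.assoc, idn_src, Category.comp_id]
  rw [hab, add_sub_cancel_right]

theorem lin_tgt (h : k ≤ l) (a b : T ⟶ A.X l) : A.lin h a b ≫ A.tgt h = b ≫ A.tgt h := by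
  simp only [lin, sub_comp, add_comp, Category.assoc, idn_tgt, Category.comp_id]
  rw [add_sub_cancel_left]

theorem id_lin (h : k ≤ l) (a : T ⟶ A.X l) :
    A.lin h ((a ≫ A.src h) ≫ A.idn h) a = a := by
  simp only [lin, Category.assoc, idn_tgt, Category.comp_id, add_sub_cancel_left]

theorem lin_id (h : k ≤ l) (a : T ⟶ A.X l) :
    A.lin h a ((a ≫ A.tgt h) ≫ A.idn h) = a := by
  simp only [lin, add_sub_cancel_right]

theorem lin_assoc (h : k ≤ l) (a b c : T ⟶ A.X l) :
    A.lin h (A.lin h a b) c = A.lin h a (A.lin h b c) := by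
  rw [lin, lin_tgt]
  simp only [lin]
  abel

theorem lin_src_of_lt (hj : j < k) (hk : k ≤ l) (h : j ≤ l) (a b : T ⟶ A.X l) :
    A.lin h a b ≫ A.src hk = A.lin hj.le (a ≫ A.src hk) (b ≫ A.src hk) := by
  simp only [lin, sub_comp, add_comp, Category.assoc, A.idn_of_le_src hj.le hk]
  rw [← Category.assoc (A.src hk), A.src_tgt hj hk h]

theorem lin_tgt_of_lt (hj : j < k) (hk : k ≤ l) (h : j ≤ l) (a b : T ⟶ A.X l) :
    A.lin h a b ≫ A.tgt hk = A.lin hj.le (a ≫ A.tgt hk) (b ≫ A.tgt hk) := by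
  simp only [lin, sub_comp, add_comp, Category.assoc, A.idn_of_le_tgt hj.le hk]
  rw [← Category.assoc (A.tgt hk), A.tgt_tgt hj.le hk h]

theorem lin_idn (hj : j ≤ k) (hk : k ≤ l) (h : j ≤ l) (a b : T ⟶ A.X k) :
    A.lin h (a ≫ A.idn hk) (b ≫ A.idn hk) = A.lin hj a b ≫ A.idn hk := by
  simp only [lin, sub_comp, add_comp, Category.assoc, A.idn_idn hj hk h]
  rw [← Category.assoc (A.idn hk), A.idn_tgt_of_le hj hk h]

theorem lin_exchange (hj : j < k) (hk : k ≤ l) (h : j ≤ l) (a a' b b' : T ⟶ A.X l) :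
    A.lin h (A.lin hk a a') (A.lin hk b b') = A.lin hk (A.lin h a b) (A.lin h a' b') := by
  have h₁ : A.lin hk a a' ≫ A.tgt h = a' ≫ A.tgt h := by
    rw [← A.tgt_tgt hj.le hk h, ← Category.assoc, lin_tgt, Category.assoc]
  rw [lin, h₁, lin, lin, lin, A.lin_tgt_of_lt hj hk h, lin]
  simp only [lin, sub_comp, add_comp, Category.assoc, A.idn_idn hj.le hk h]
  rw [← Category.assoc (A.tgt hk), A.tgt_tgt hj.le hk h]
  abel

end RGlob

/-! ### Strict ω-categories from exchange of the linear composition with the multiplication -/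

namespace ShuffleOperad

/-- The forgetful functor from shuffle operads to collections. -/
abbrev forget (K : Type u) [Field K] : ShuffleOperad.{u, w} K ⥤ Coll.{u, w} K where
  obj P := P.V
  map φ := φ.hom

end ShuffleOperad

namespace RGlob

variable {K : Type u} [Field K] (A : RGlob (ShuffleOperad.{u, w} K)) {k l : ℕ}
  {I J : NonemptyFinLinOrd.{0}}

/-- The linear composition, on elements. -/
def linAt (h : k ≤ l) (x y : (A.X l).V.at' I) : (A.X l).V.at' I :=
  x + y - Coll.ap (A.idn h).hom (Coll.ap (A.tgt h).hom x)

/-- The linear compositions are compatible with the multiplications of the operads `A.X l`. -/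
def LinMul : Prop :=
  ∀ (k l : ℕ) (h : k < l) (I J : NonemptyFinLinOrd.{0}) (f : Shuffle I J)
    (u u' : (A.X l).V.at' J) (v v' : ∀ j, (A.X l).V.at' (f.fiber j))
    (_ : Coll.ap (A.tgt h.le).hom u = Coll.ap (A.src h.le).hom u')
    (_ : ∀ j, Coll.ap (A.tgt h.le).hom (v j) = Coll.ap (A.src h.le).hom (v' j)),
    (A.X l).mul f (A.linAt h.le u u') (fun j => A.linAt h.le (v j) (v' j)) =
      A.linAt h.le ((A.X l).mul f u v) ((A.X l).mul f u' v')

variable {A}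

/-- The linear composition of operad morphisms. -/
def linHom (hA : A.LinMul) (h : k < l) {T : ShuffleOperad.{u, w} K} (a b : T ⟶ A.X l)
    (hab : a ≫ A.tgt h.le = b ≫ A.src h.le) : T ⟶ A.X l where
  hom := a.hom + b.hom - (a.hom ≫ (A.tgt h.le).hom) ≫ (A.idn h.le).hom
  map_mul f u v := by
    have hab' : ∀ {I : NonemptyFinLinOrd.{0}} (x : T.V.at' I),
        Coll.ap (A.tgt h.le).hom (Coll.ap a.hom x) = Coll.ap (A.src h.le).hom (Coll.ap b.hom x) :=
      fun x => congrArg (fun φ : T ⟶ A.X k => Coll.ap φ.hom x) hab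
    have key := hA _ _ h _ _ f (Coll.ap a.hom u) (Coll.ap b.hom u) (fun j => Coll.ap a.hom (v j))
      (fun j => Coll.ap b.hom (v j)) (hab' u) (fun j => hab' (v j))
    rw [← a.map_mul, ← b.map_mul] at key
    exact key.symm
  map_one := by
    have h₁ : (A.X l).one + (A.X l).one - Coll.ap (A.idn h.le).hom
        (Coll.ap (A.tgt h.le).hom (A.X l).one) = (A.X l).one := by
      rw [(A.tgt h.le).map_one, (A.idn h.le).map_one, add_sub_cancel_right]
    refine Eq.trans ?_ h₁
    rw [← a.map_one]
    nth_rewrite 2 [a.map_one]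
    rw [← b.map_one]
    rfl

/-- The underlying reflexive globular collection. -/
abbrev coll (A : RGlob (ShuffleOperad.{u, w} K)) : RGlob (Coll.{u, w} K) :=
  A.map (ShuffleOperad.forget K)

theorem src_hom (h : k ≤ l) : (A.src h).hom = A.coll.src h := A.map_src (ShuffleOperad.forget K) h

theorem tgt_hom (h : k ≤ l) : (A.tgt h).hom = A.coll.tgt h := A.map_tgt (ShuffleOperad.forget K) h

theorem idn_hom (h : k ≤ l) : (A.idn h).hom = A.coll.idn h := A.map_idn (ShuffleOperad.forget K) h

section

variable {T : ShuffleOperad.{u, w} K}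

theorem comp_src_hom (a : T ⟶ A.X l) (h : k ≤ l) : (a ≫ A.src h).hom =
    CategoryStruct.comp (X := T.V) (Y := A.coll.X l) (Z := A.coll.X k) a.hom (A.coll.src h) :=
  congrArg (a.hom ≫ ·) (src_hom h)

theorem comp_tgt_hom (a : T ⟶ A.X l) (h : k ≤ l) : (a ≫ A.tgt h).hom =
    CategoryStruct.comp (X := T.V) (Y := A.coll.X l) (Z := A.coll.X k) a.hom (A.coll.tgt h) :=
  congrArg (a.hom ≫ ·) (tgt_hom h)

theorem comp_idn_hom (a : T ⟶ A.X k) (h : k ≤ l) : (a ≫ A.idn h).hom =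
    CategoryStruct.comp (X := T.V) (Y := A.coll.X k) (Z := A.coll.X l) a.hom (A.coll.idn h) :=
  congrArg (a.hom ≫ ·) (idn_hom h)

theorem linHom_hom (hA : A.LinMul) (h : k < l) (a b : T ⟶ A.X l)
    (hab : a ≫ A.tgt h.le = b ≫ A.src h.le) :
    (linHom hA h a b hab).hom = A.coll.lin (T := T.V) h.le a.hom b.hom := by
  refine Eq.trans (?_ : _ = a.hom + b.hom - (a.hom ≫ (A.tgt h.le).hom) ≫ (A.idn h.le).hom) ?_
  · rfl
  · rw [tgt_hom, idn_hom]
    rfl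

end

/-- The ω-category with the linear compositions. -/
def toOmegaCat (hA : A.LinMul) : OmegaCat (ShuffleOperad.{u, w} K) where
  toRGlob := A
  comp h _ a b hab := linHom hA h a b hab
  precomp h _ _ p a b hab hab' := ShuffleOperad.Hom.ext <|
    (linHom_hom hA h _ _ hab').trans <| (A.coll.precomp_lin h.le p.hom a.hom b.hom).trans
      (congrArg (p.hom ≫ ·) (linHom_hom hA h a b hab).symm)
  comp_src h _ a b hab := ShuffleOperad.Hom.ext <| by
    have hab' := congrArg ShuffleOperad.Hom.hom hab
    rw [comp_tgt_hom, comp_src_hom] at hab'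
    rw [comp_src_hom, comp_src_hom, linHom_hom]
    exact A.coll.lin_src _ _ _ hab'
  comp_tgt h _ a b hab := ShuffleOperad.Hom.ext <| by
    rw [comp_tgt_hom, comp_tgt_hom, linHom_hom]
    exact A.coll.lin_tgt _ _ _
  id_comp h _ a ha := ShuffleOperad.Hom.ext <| by
    rw [linHom_hom, comp_idn_hom, comp_src_hom]
    exact A.coll.id_lin _ _
  comp_id h _ a ha := ShuffleOperad.Hom.ext <| by
    rw [linHom_hom, comp_idn_hom, comp_tgt_hom]
    exact A.coll.lin_id _ _
  assoc h _ a b c hab hbc h₁ h₂ := ShuffleOperad.Hom.ext <| by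
    rw [linHom_hom, linHom_hom, linHom_hom, linHom_hom]
    exact A.coll.lin_assoc _ _ _ _
  src_comp hj hk _ a b hab hab' := ShuffleOperad.Hom.ext <| by
    rw [comp_src_hom, linHom_hom, linHom_hom, comp_src_hom, comp_src_hom]
    exact A.coll.lin_src_of_lt hj hk.le _ _ _
  tgt_comp hj hk _ a b hab hab' := ShuffleOperad.Hom.ext <| by
    rw [comp_tgt_hom, linHom_hom, linHom_hom, comp_tgt_hom, comp_tgt_hom]
    exact A.coll.lin_tgt_of_lt hj hk.le _ _ _
  idn_comp hj hk _ a b hab hab' := ShuffleOperad.Hom.ext <| by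
    rw [comp_idn_hom, linHom_hom, linHom_hom, comp_idn_hom, comp_idn_hom]
    exact A.coll.lin_idn hj.le hk.le _ _ _
  exchange hj hk _ a a' b b' ha hb hab hab' h₁ h₂ := ShuffleOperad.Hom.ext <| by
    rw [linHom_hom, linHom_hom, linHom_hom, linHom_hom, linHom_hom, linHom_hom]
    exact A.coll.lin_exchange hj hk.le _ _ _ _ _

end RGlob

/-! ### Compositions in an ω-category of shuffle operads are linear -/

namespace ShuffleOperad

variable {K : Type u} [Field K] {Q R : ShuffleOperad.{u, w} K} (t s : Q ⟶ R)

/-- The collection of pairs `(x, y)` with `t x = s y`. -/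
def fiberProductColl : Coll.{u, w} K where
  obj I := ModuleCat.of K (LinearMap.eqLocus
    ((t.hom.app I).hom ∘ₗ LinearMap.fst K (Q.V.obj I) (Q.V.obj I))
    ((s.hom.app I).hom ∘ₗ LinearMap.snd K (Q.V.obj I) (Q.V.obj I)))
  map φ := ModuleCat.ofHom (LinearMap.restrict
    (LinearMap.prodMap (Q.V.map φ).hom (Q.V.map φ).hom) (fun x hx => by
      have h₁ := congrArg (fun m => m.hom x.1) (t.hom.naturality φ)
      have h₂ := congrArg (fun m => m.hom x.2) (s.hom.naturality φ)
      exact h₁.trans ((congrArg (R.V.map φ).hom hx).trans h₂.symm)))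
  map_id I := by
    refine ModuleCat.hom_ext (LinearMap.ext fun x => Subtype.ext (Prod.ext ?_ ?_))
    · exact congrArg (fun m => m.hom x.1.1) (Q.V.map_id I)
    · exact congrArg (fun m => m.hom x.1.2) (Q.V.map_id I)
  map_comp φ ψ := by
    refine ModuleCat.hom_ext (LinearMap.ext fun x => Subtype.ext (Prod.ext ?_ ?_))
    · exact congrArg (fun m => m.hom x.1.1) (Q.V.map_comp φ ψ)
    · exact congrArg (fun m => m.hom x.1.2) (Q.V.map_comp φ ψ)

namespace fiberProductColl

variable {t s} {I J : NonemptyFinLinOrd.{0}}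

/-- The pair `(x, y)` as an element of the fibre product. -/
def mk (x y : Q.V.at' I) (h : Coll.ap t.hom x = Coll.ap s.hom y) : (fiberProductColl t s).at' I :=
  ⟨(x, y), h⟩

/-- The first component. -/
def fst : (fiberProductColl t s).at' I →ₗ[K] Q.V.at' I := LinearMap.fst K _ _ ∘ₗ Submodule.subtype _

/-- The second component. -/
def snd : (fiberProductColl t s).at' I →ₗ[K] Q.V.at' I := LinearMap.snd K _ _ ∘ₗ Submodule.subtype _

theorem condition (x : (fiberProductColl t s).at' I) :
    Coll.ap t.hom (fst x) = Coll.ap s.hom (snd x) := x.2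

theorem ext {x y : (fiberProductColl t s).at' I} (h₁ : fst x = fst y) (h₂ : snd x = snd y) :
    x = y := Subtype.ext (Prod.ext h₁ h₂)

theorem fst_mk (x y : Q.V.at' I) (h : Coll.ap t.hom x = Coll.ap s.hom y) : fst (mk x y h) = x := rfl

theorem snd_mk (x y : Q.V.at' I) (h : Coll.ap t.hom x = Coll.ap s.hom y) : snd (mk x y h) = y := rfl

end fiberProductColl

open fiberProductColl in
/-- The fibre product of `t, s : Q ⟶ R`, as an operad. -/
def fiberProduct : ShuffleOperad.{u, w} K where
  V := fiberProductColl t s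
  mul f a b := fiberProductColl.mk (Q.mul f (fst a) (fun j => fst (b j)))
      (Q.mul f (snd a) (fun j => snd (b j))) <| by
    rw [t.map_mul, s.map_mul, condition]
    simp only [condition]
  one := fiberProductColl.mk Q.one Q.one (t.map_one.trans s.map_one.symm)
  linear_root f b :=
    { map_add x y := fiberProductColl.ext
        ((Q.linear_root f _).map_add (fst x) (fst y)) ((Q.linear_root f _).map_add (snd x) (snd y))
      map_smul c x := fiberProductColl.ext
        ((Q.linear_root f _).map_smul c (fst x)) ((Q.linear_root f _).map_smul c (snd x)) }
  linear_leaf f a b j := by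
    have h₁ : ∀ x, (fun k => fst (Function.update b j x k)) =
        Function.update (fun k => fst (b k)) j (fst x) := fun x => funext fun k =>
      Function.apply_update (fun k => fst (t := t) (s := s) (I := f.fiber k)) b j x k
    have h₂ : ∀ x, (fun k => snd (Function.update b j x k)) =
        Function.update (fun k => snd (b k)) j (snd x) := fun x => funext fun k =>
      Function.apply_update (fun k => snd (t := t) (s := s) (I := f.fiber k)) b j x k
    refine ⟨fun x y => fiberProductColl.ext ?_ ?_, fun c x => fiberProductColl.ext ?_ ?_⟩
    · simp only [fst_mk, map_add, h₁]
      exact (Q.linear_leaf f _ _ j).map_add _ _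
    · simp only [snd_mk, map_add, h₂]
      exact (Q.linear_leaf f _ _ j).map_add _ _
    · simp only [fst_mk, map_smul, h₁]
      exact (Q.linear_leaf f _ _ j).map_smul _ _
    · simp only [snd_mk, map_smul, h₂]
      exact (Q.linear_leaf f _ _ j).map_smul _ _
  natural f f' e d h u v := fiberProductColl.ext (Q.natural f f' e d h _ (fun j => fst (v j)))
    (Q.natural f f' e d h _ (fun j => snd (v j)))
  assoc f g u v w := fiberProductColl.ext (Q.assoc f g _ _ _) (Q.assoc f g _ _ _)
  one_mul a := fiberProductColl.ext (Q.one_mul _) (Q.one_mul _)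
  mul_one a := fiberProductColl.ext (Q.mul_one _) (Q.mul_one _)

namespace fiberProduct

open fiberProductColl

variable {t s}

/-- The first projection. -/
def π₁ : fiberProduct t s ⟶ Q where
  hom := { app := fun _ => ModuleCat.ofHom (LinearMap.fst K _ _ ∘ₗ Submodule.subtype _) }
  map_mul _ _ _ := rfl
  map_one := rfl

/-- The second projection. -/
def π₂ : fiberProduct t s ⟶ Q where
  hom := { app := fun _ => ModuleCat.ofHom (LinearMap.snd K _ _ ∘ₗ Submodule.subtype _) }
  map_mul _ _ _ := rfl
  map_one := rfl

theorem π₁_t : π₁ (t := t) (s := s) ≫ t = π₂ ≫ s := by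
  refine ShuffleOperad.Hom.ext (NatTrans.ext (funext fun I => ModuleCat.hom_ext
    (LinearMap.ext fun x => ?_)))
  exact x.2

/-- The element `(x, y)` of the fibre product. -/
def mk {I : NonemptyFinLinOrd.{0}} (x y : Q.V.at' I) (h : Coll.ap t.hom x = Coll.ap s.hom y) :
    (fiberProduct t s).V.at' I := fiberProductColl.mk x y h

variable {T : ShuffleOperad.{u, w} K} (a b : T ⟶ Q) (h : a ≫ t = b ≫ s)

theorem lift_condition (h : a ≫ t = b ≫ s) {I : FinOrdᵒᵖ} (x : T.V.obj I) :
    (t.hom.app I).hom ((a.hom.app I).hom x) = (s.hom.app I).hom ((b.hom.app I).hom x) :=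
  congrArg (fun φ : T ⟶ R => (φ.hom.app I).hom x) h

/-- The morphism into the fibre product with given components. -/
def lift : T ⟶ fiberProduct t s where
  hom :=
    { app := fun I => ModuleCat.ofHom (LinearMap.codRestrict _
        (LinearMap.prod (a.hom.app I).hom (b.hom.app I).hom) (lift_condition a b h))
      naturality := fun I J φ => by
        refine ModuleCat.hom_ext (LinearMap.ext fun x => Subtype.ext (Prod.ext ?_ ?_))
        · exact congrArg (fun m => m.hom x) (a.hom.naturality φ)
        · exact congrArg (fun m => m.hom x) (b.hom.naturality φ) }
  map_mul f u v := fiberProductColl.ext (a.map_mul f u v) (b.map_mul f u v)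
  map_one := fiberProductColl.ext a.map_one b.map_one

end fiberProduct

end ShuffleOperad

namespace OmegaCat

open ShuffleOperad ShuffleOperad.fiberProduct

variable {K : Type u} [Field K] (O : ShuffleOmegaOperad.{u, w} K) {k l : ℕ} (h : k < l)
  {I J : NonemptyFinLinOrd.{0}}

/-- The composite of the two projections of the fibre product. -/
def univComp : fiberProduct (O.tgt h.le) (O.src h.le) ⟶ O.X l := O.comp h π₁ π₂ π₁_t

theorem comp_eq_univComp {T : ShuffleOperad.{u, w} K} (a b : T ⟶ O.X l)
    (hab : a ≫ O.tgt h.le = b ≫ O.src h.le) :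
    O.comp h a b hab = lift a b hab ≫ O.univComp h := by
  rw [univComp, ← O.precomp h (lift a b hab) π₁ π₂ π₁_t hab]
  rfl

theorem univComp_source (y : (O.X l).V.at' I) :
    Coll.ap (O.univComp h).hom (fiberProduct.mk
      (Coll.ap (O.idn h.le).hom (Coll.ap (O.src h.le).hom y)) y
      (congrArg (fun φ : O.X k ⟶ O.X k => Coll.ap φ.hom (Coll.ap (O.src h.le).hom y))
        (O.idn_tgt h.le))) = y := by
  have ha : ((𝟙 _ ≫ O.src h.le) ≫ O.idn h.le) ≫ O.tgt h.le = 𝟙 (O.X l) ≫ O.src h.le := by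
    rw [Category.assoc, O.idn_tgt, Category.comp_id]
  have := O.id_comp h (𝟙 _) ha
  rw [comp_eq_univComp] at this
  exact congrArg (fun φ : O.X l ⟶ O.X l => Coll.ap φ.hom y) this

theorem univComp_target (x : (O.X l).V.at' I) :
    Coll.ap (O.univComp h).hom (fiberProduct.mk x
      (Coll.ap (O.idn h.le).hom (Coll.ap (O.tgt h.le).hom x))
      (congrArg (fun φ : O.X k ⟶ O.X k => Coll.ap φ.hom (Coll.ap (O.tgt h.le).hom x))
        (O.idn_src h.le)).symm) = x := by
  have ha : 𝟙 (O.X l) ≫ O.tgt h.le = ((𝟙 _ ≫ O.tgt h.le) ≫ O.idn h.le) ≫ O.src h.le := by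
    rw [Category.assoc, O.idn_src, Category.comp_id]
  have := O.comp_id h (𝟙 _) ha
  rw [comp_eq_univComp] at this
  exact congrArg (fun φ : O.X l ⟶ O.X l => Coll.ap φ.hom x) this

/-- Composition is linear, and `(x, y) = (x, i t x) + (i s y, y) - (i t x, i t x)`. -/
theorem univComp_mk (x y : (O.X l).V.at' I)
    (hxy : Coll.ap (O.tgt h.le).hom x = Coll.ap (O.src h.le).hom y) :
    Coll.ap (O.univComp h).hom (fiberProduct.mk x y hxy) = O.linAt h.le x y := by
  have hs : ∀ z : (O.X k).V.at' I, Coll.ap (O.src h.le).hom (Coll.ap (O.idn h.le).hom z) = z :=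
    fun z => congrArg (fun φ : O.X k ⟶ O.X k => Coll.ap φ.hom z) (O.idn_src h.le)
  set z := Coll.ap (O.idn h.le).hom (Coll.ap (O.src h.le).hom y) with hz
  have h₁ := O.univComp_target h x
  have h₂ := O.univComp_source h y
  have h₃ := O.univComp_source h z
  have hz' : Coll.ap (O.idn h.le).hom (Coll.ap (O.src h.le).hom z) = z := by rw [hz, hs]
  have ht : ∀ z : (O.X k).V.at' I, Coll.ap (O.tgt h.le).hom (Coll.ap (O.idn h.le).hom z) = z :=
    fun z => congrArg (fun φ : O.X k ⟶ O.X k => Coll.ap φ.hom z) (O.idn_tgt h.le)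
  have key : (fiberProduct.mk x y hxy : (fiberProduct (O.tgt h.le) (O.src h.le)).V.at' I) =
      fiberProduct.mk x (Coll.ap (O.idn h.le).hom (Coll.ap (O.tgt h.le).hom x)) (by rw [hs])
      + fiberProduct.mk z y (by rw [hz, ht])
      - fiberProduct.mk (Coll.ap (O.idn h.le).hom (Coll.ap (O.src h.le).hom z)) z
        (by rw [ht]) := by
    refine Subtype.ext (Prod.ext ?_ ?_)
    · change x = x + z - Coll.ap (O.idn h.le).hom (Coll.ap (O.src h.le).hom z)
      rw [hz', add_sub_cancel_right]
    · change y = Coll.ap (O.idn h.le).hom (Coll.ap (O.tgt h.le).hom x) + y - z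
      rw [hxy, ← hz, add_sub_cancel_left]
  rw [key]
  rw [map_sub, map_add, h₁, h₂, h₃, hz, ← hxy]
  rfl

theorem comp_apply {T : ShuffleOperad.{u, w} K} (a b : T ⟶ O.X l)
    (hab : a ≫ O.tgt h.le = b ≫ O.src h.le) (x : T.V.at' I) :
    Coll.ap (O.comp h a b hab).hom x = O.linAt h.le (Coll.ap a.hom x) (Coll.ap b.hom x) := by
  rw [comp_eq_univComp, ← O.univComp_mk h _ _ (lift_condition a b hab x)]
  rfl

theorem linMul : O.LinMul := by
  intro k l h I J f u u' v v' hu hv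
  rw [← O.univComp_mk h _ _ hu]
  simp only [fun j => (O.univComp_mk h _ _ (hv j)).symm]
  rw [← (O.univComp h).map_mul, ← O.univComp_mk h]
  rfl

/-- The compositions of an ω-category of shuffle operads are determined by the underlying reflexive
globular object. -/
theorem ext_toRGlob {O O' : ShuffleOmegaOperad.{u, w} K} (h : O.toRGlob = O'.toRGlob) : O = O' := by
  have hc : ∀ {k l : ℕ} (h : k < l) {T : ShuffleOperad.{u, w} K} (a b : T ⟶ O.X l)
      (hab : a ≫ O.tgt h.le = b ≫ O.src h.le),
      O.comp h a b hab = RGlob.linHom O.linMul h a b hab := fun h T a b hab => by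
    refine ShuffleOperad.Hom.ext (NatTrans.ext (funext fun I => ModuleCat.hom_ext
      (LinearMap.ext fun x => ?_)))
    exact O.comp_apply h a b hab x
  have hc' : ∀ {k l : ℕ} (h : k < l) {T : ShuffleOperad.{u, w} K} (a b : T ⟶ O'.X l)
      (hab : a ≫ O'.tgt h.le = b ≫ O'.src h.le),
      O'.comp h a b hab = RGlob.linHom O'.linMul h a b hab := fun h T a b hab => by
    refine ShuffleOperad.Hom.ext (NatTrans.ext (funext fun I => ModuleCat.hom_ext
      (LinearMap.ext fun x => ?_)))
    exact O'.comp_apply h a b hab x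
  generalize O.linMul = m at hc
  generalize O'.linMul = m' at hc'
  cases O
  cases O'
  dsimp only at h
  subst h
  congr 1
  funext k l h T a b hab
  exact (hc h a b hab).trans (hc' h a b hab).symm

/-- A morphism of reflexive globular operads preserves the compositions. -/
def homOfRGlob {O O' : ShuffleOmegaOperad.{u, w} K} (φ : O.toRGlob ⟶ O'.toRGlob) : O ⟶ O' where
  hom := φ
  comp_comm {k l} h T a b hab hab' := by
    refine ShuffleOperad.Hom.ext (NatTrans.ext (funext fun I => ModuleCat.hom_ext
      (LinearMap.ext fun x => ?_)))
    refine (congrArg ((φ.app l).hom.app I).hom (O.comp_apply h a b hab x)).trans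
      (Eq.trans ?_ (O'.comp_apply h _ _ hab' x).symm)
    have ht := congrArg (fun ψ : O.X l ⟶ O'.X k => Coll.ap ψ.hom (Coll.ap a.hom x))
      (RGlob.tgt_comm φ h.le)
    have hi := congrArg (fun ψ : O.X k ⟶ O'.X l => Coll.ap ψ.hom
      (Coll.ap (O.tgt h.le).hom (Coll.ap a.hom x))) (RGlob.idn_comm φ h.le)
    refine (map_sub (Coll.ap (φ.app l).hom) _ _).trans ?_
    refine (congrArg (· - _) (map_add (Coll.ap (φ.app l).hom) _ _)).trans ?_
    refine congrArg (_ - ·) (hi.trans ?_)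
    exact congrArg (Coll.ap (O'.idn h.le).hom) ht

end OmegaCat

/-! ### The bimodule of an operad morphism -/

namespace OperadBimod

variable {K : Type u} [Field K]

/-- The forgetful functor from bimodules to collections. -/
abbrev forget (P : ShuffleOperad.{u, w} K) : OperadBimod P ⥤ Coll.{u, w} K where
  obj A := A.V
  map φ := φ.hom

theorem eqToHom_hom {P : ShuffleOperad.{u, w} K} {A B : OperadBimod P} (h : A = B) :
    (eqToHom h).hom = eqToHom (congrArg OperadBimod.V h) := by
  subst h; rfl

end OperadBimod

namespace ShuffleOperad

variable {K : Type u} [Field K] {P Q R : ShuffleOperad.{u, w} K}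

theorem ap_oneAt (φ : P ⟶ Q) {I : NonemptyFinLinOrd.{0}} (h : Subsingleton I) :
    Coll.ap φ.hom (P.oneAt I h) = Q.oneAt I h := by
  rw [oneAt, Coll.ap_tr, φ.map_one]
  rfl

theorem map_insertAt {J : Type} [DecidableEq J] {X Y : J → Type w} (φ : ∀ j, X j → Y j) (j : J)
    (p : ∀ j' : {j' // j' ≠ j}, X j'.1) (x : X j) :
    (fun j' => φ j' (insertAt j p x j')) = insertAt j (fun j' => φ j'.1 (p j')) (φ j x) :=
  eq_insertAt j _ _ (by rw [insertAt_self]) fun j' h => by rw [insertAt_ne _ _ _ h]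

/-- The `P`-bimodule `Q` given by a morphism of operads `φ : P ⟶ Q`. -/
def bimodule (φ : P ⟶ Q) : OperadBimod P where
  V := Q.V
  lam f j u p a := Q.mul f (Coll.ap φ.hom u) (insertAt j (fun j' => Coll.ap φ.hom (p j')) a)
  rho f a p := Q.mul f a (fun j => Coll.ap φ.hom (p j))
  lam_linear_root f j p a := (Q.linear_root f _).comp_linearMap (Coll.ap φ.hom)
  lam_linear_leaf f j u p a j' := by
    refine (congrArg (fun F => IsLinearMap K F) (funext fun x => ?_)).mpr
      ((Q.regular.lam_linear_leaf f j (Coll.ap φ.hom u) (fun j' => Coll.ap φ.hom (p j')) a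
        j').comp_linearMap (Coll.ap φ.hom))
    exact congrArg (fun q => Q.mul f _ (insertAt j q a)) (funext fun k =>
      Function.apply_update (fun k : {j' // j' ≠ j} => Coll.ap φ.hom (I := f.fiber k.1)) p j' x k)
  lam_linear f j u p := Q.regular.lam_linear f j _ _
  rho_linear f p := Q.linear_root f _
  rho_linear_leaf f a p j := by
    convert (Q.linear_leaf f a (fun j => Coll.ap φ.hom (p j)) j).comp_linearMap (Coll.ap φ.hom)
      using 3 with x
    funext k
    exact Function.apply_update (fun k => Coll.ap φ.hom (I := f.fiber k)) p j x k
  lam_natural f f' e d h j u p a := by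
    simp only [Coll.ap_tr]
    exact Q.regular.lam_natural f f' e d h j _ (fun j' => Coll.ap φ.hom (p j')) a
  rho_natural f f' e d h a p := by
    simp only [Coll.ap_tr]
    exact Q.natural f f' e d h a (fun j => Coll.ap φ.hom (p j))
  one_lam j p a := by
    rw [φ.map_one]
    exact Q.regular.one_lam j _ a
  rho_one a := by
    simp only [ap_oneAt]
    exact Q.mul_one a
  lam_lam f g j u v w a := by
    simp only [φ.map_mul, Coll.ap_tr]
    exact Q.regular.lam_lam f g j _ _ (fun j' => Coll.ap φ.hom (w j')) a
  rho_rho f g a v w := by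
    simp only [φ.map_mul, Coll.ap_tr]
    exact Q.assoc f g a _ _
  rho_lam f g i u v a w := by
    simp only [φ.map_mul, Coll.ap_tr]
    exact Q.regular.rho_lam f g i _ _ a _

/-- A morphism of operads under `P` is a morphism of `P`-bimodules. -/
def bimoduleMap {φ : P ⟶ Q} {φ' : P ⟶ R} (ψ : Q ⟶ R) (h : φ ≫ ψ = φ') :
    bimodule φ ⟶ bimodule φ' where
  hom := ψ.hom
  map_lam f j u p a := by
    subst h
    exact (ψ.map_mul f _ _).trans
      (congrArg (R.mul f _) (map_insertAt (fun j' => Coll.ap ψ.hom (I := f.fiber j')) _ _ _))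
  map_rho f a p := by
    subst h
    exact ψ.map_mul f _ _

end ShuffleOperad

section

variable {K : Type u} [Field K] {P : ShuffleOperad.{u, w} K} {A : OperadBimod P}
  (s t : A ⟶ P.regular) (i : P.regular ⟶ A) {I J : NonemptyFinLinOrd.{0}} (f : Shuffle I J)
  (j : J) (hf : f.IsElementary j) (a : A.V.at' J) (b : A.V.at' (f.fiber j))

theorem muUp_eq {ta : P.V.at' J} {sb : P.V.at' (f.fiber j)} {c : A.V.at' I}
    (ha : Coll.ap t.hom a = ta) (hb : Coll.ap s.hom b = sb)
    (hc : Coll.ap i.hom (P.mulPartial f j hf ta sb) = c) :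
    muUp s t i f j hf a b = A.rhoPartial f j hf a sb + A.lamPartial f j hf ta b - c := by
  subst ha hb hc; rfl

theorem muDown_eq {sa : P.V.at' J} {tb : P.V.at' (f.fiber j)} {c : A.V.at' I}
    (ha : Coll.ap s.hom a = sa) (hb : Coll.ap t.hom b = tb)
    (hc : Coll.ap i.hom (P.mulPartial f j hf sa tb) = c) :
    muDown s t i f j hf a b = A.lamPartial f j hf sa b + A.rhoPartial f j hf a tb - c := by
  subst ha hb hc; rfl

end

/-! ### The reflexive globular bimodule of an ω-category -/

namespace OmegaCat

variable {K : Type u} [Field K] (O : ShuffleOmegaOperad.{u, w} K) {n : ℕ}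
  {I J : NonemptyFinLinOrd.{0}}

/-- The source `O.X n → O.X 0`, on elements. -/
def S (n : ℕ) : (O.X n).V.at' I →ₗ[K] (O.X 0).V.at' I := Coll.ap (O.src (Nat.zero_le n)).hom

/-- The target `O.X n → O.X 0`, on elements. -/
def T (n : ℕ) : (O.X n).V.at' I →ₗ[K] (O.X 0).V.at' I := Coll.ap (O.tgt (Nat.zero_le n)).hom

/-- The identity `O.X 0 → O.X n`, on elements. -/
def E (n : ℕ) : (O.X 0).V.at' I →ₗ[K] (O.X n).V.at' I := Coll.ap (O.idn (Nat.zero_le n)).hom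

theorem S_E (p : (O.X 0).V.at' I) : O.S n (O.E n p) = p :=
  congrArg (fun φ : O.X 0 ⟶ O.X 0 => Coll.ap φ.hom p) (O.idn_src (Nat.zero_le n))

theorem T_zero (p : (O.X 0).V.at' I) : O.T 0 p = p :=
  congrArg (fun φ : O.X 0 ⟶ O.X 0 => Coll.ap φ.hom p) (O.tgt_self (Nat.zero_le 0))

theorem E_zero (p : (O.X 0).V.at' I) : O.E 0 p = p :=
  congrArg (fun φ : O.X 0 ⟶ O.X 0 => Coll.ap φ.hom p) (O.idn_self (Nat.zero_le 0))

variable (f : Shuffle I J)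

/-- The interchange of `a = a ⋆ i t a` with `b = 0 ⋆ b` at one leaf and `b = b ⋆ i t b` at the
others. -/
theorem mul_of_leaf (a : (O.X n).V.at' J) (b : ∀ j, (O.X n).V.at' (f.fiber j)) (j : J)
    (hj : O.S n (b j) = 0) :
    (O.X n).mul f a b = (O.X n).mul f (O.E n (O.T n a))
      (insertAt j (fun j' => O.E n (O.T n (b j'.1))) (b j)) := by
  rcases Nat.eq_zero_or_pos n with rfl | hn
  · simp only [T_zero, E_zero]
    rw [← eq_insertAt j _ _ rfl fun _ _ => rfl]
  · have hz : (O.X n).mul f a (insertAt j (fun j' => b j'.1) 0) = 0 :=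
      ((O.X n).mul_multiadditive f a).map_insertAt_zero j _
    have h := O.linMul 0 n hn I J f a (O.E n (O.T n a)) (insertAt j (fun j' => b j'.1) 0)
      (insertAt j (fun j' => O.E n (O.T n (b j'.1))) (b j)) (O.S_E _).symm (fun k => by
        by_cases hk : k = j
        · subst hk
          rw [insertAt_self, insertAt_self, map_zero]
          exact hj.symm
        · rw [insertAt_ne _ _ _ hk, insertAt_ne _ _ _ hk]
          exact (O.S_E _).symm)
    rw [hz] at h
    have h₁ : ∀ {I : NonemptyFinLinOrd.{0}} (x : (O.X n).V.at' I), O.linAt hn.le 0 x = x := by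
      intro I x
      rw [RGlob.linAt, map_zero, map_zero, zero_add, sub_zero]
    have h₂ : ∀ {I : NonemptyFinLinOrd.{0}} (x : (O.X n).V.at' I),
        O.linAt hn.le x (O.E n (O.T n x)) = x := fun x => add_sub_cancel_right x _
    rw [h₁, h₂] at h
    rw [← h]
    congr 1
    funext k
    by_cases hk : k = j
    · subst hk
      rw [insertAt_self, insertAt_self, h₁]
    · rw [insertAt_ne _ _ _ hk, insertAt_ne _ _ _ hk, h₂]

/-- The interchange of `a = 0 ⋆ a` with `b = b ⋆ i t b`. -/
theorem mul_of_root (a : (O.X n).V.at' J) (ha : O.S n a = 0)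
    (b : ∀ j, (O.X n).V.at' (f.fiber j)) :
    (O.X n).mul f a b = (O.X n).mul f a (fun j => O.E n (O.T n (b j))) := by
  rcases Nat.eq_zero_or_pos n with rfl | hn
  · simp only [T_zero, E_zero]
  · have hz : (O.X n).mul f 0 b = 0 := ((O.X n).linear_root f b).map_zero
    have h := O.linMul 0 n hn I J f 0 a b (fun j => O.E n (O.T n (b j)))
      ((map_zero _).trans ha.symm) (fun k => (O.S_E _).symm)
    rw [hz] at h
    have h₁ : ∀ {I : NonemptyFinLinOrd.{0}} (x : (O.X n).V.at' I), O.linAt hn.le 0 x = x := by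
      intro I x
      rw [RGlob.linAt, map_zero, map_zero, zero_add, sub_zero]
    have h₂ : ∀ {I : NonemptyFinLinOrd.{0}} (x : (O.X n).V.at' I),
        O.linAt hn.le x (O.E n (O.T n x)) = x := fun x => add_sub_cancel_right x _
    simp only [h₁, h₂] at h
    exact h

/-- The reflexive globular bimodule of an ω-category of operads. -/
def globBimod : BasedGlobBimod.{u, w} K where
  P := O.X 0
  A :=
    { X := fun n => (O.X 0).bimodule (O.idn (Nat.zero_le n))
      s := fun n => ShuffleOperad.bimoduleMap (O.s n) (by
        rw [O.idn_succ (Nat.zero_le n), Category.assoc, O.is, Category.comp_id])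
      t := fun n => ShuffleOperad.bimoduleMap (O.t n) (by
        rw [O.idn_succ (Nat.zero_le n), Category.assoc, O.it, Category.comp_id])
      i := fun n => ShuffleOperad.bimoduleMap (O.i n) (by rw [O.idn_succ (Nat.zero_le n)])
      ss := fun n => OperadBimod.Hom.ext (congrArg ShuffleOperad.Hom.hom (O.ss n))
      tt := fun n => OperadBimod.Hom.ext (congrArg ShuffleOperad.Hom.hom (O.tt n))
      is := fun n => OperadBimod.Hom.ext (congrArg ShuffleOperad.Hom.hom (O.is n))
      it := fun n => OperadBimod.Hom.ext (congrArg ShuffleOperad.Hom.hom (O.it n)) }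
  zero := congrArg (fun φ => ShuffleOperad.bimodule φ) (O.idn_self (Nat.zero_le 0))

theorem globBimod_toBase : O.globBimod.toBase.hom = 𝟙 (O.X 0).V :=
  OperadBimod.eqToHom_hom O.globBimod.zero

theorem globBimod_ofBase : O.globBimod.ofBase.hom = 𝟙 (O.X 0).V :=
  OperadBimod.eqToHom_hom O.globBimod.zero.symm

theorem globBimod_src₀ (n : ℕ) :
    (O.globBimod.src₀ n).hom = (O.src (Nat.zero_le n)).hom := by
  refine (congrArg (_ ≫ ·) O.globBimod_toBase).trans ((Category.comp_id _).trans ?_)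
  rw [RGlob.src_hom]
  exact O.globBimod.A.map_src (OperadBimod.forget _) _

theorem globBimod_tgt₀ (n : ℕ) :
    (O.globBimod.tgt₀ n).hom = (O.tgt (Nat.zero_le n)).hom := by
  refine (congrArg (_ ≫ ·) O.globBimod_toBase).trans ((Category.comp_id _).trans ?_)
  rw [RGlob.tgt_hom]
  exact O.globBimod.A.map_tgt (OperadBimod.forget _) _

theorem globBimod_idn₀ (n : ℕ) :
    (O.globBimod.idn₀ n).hom = (O.idn (Nat.zero_le n)).hom := by
  refine (congrArg (· ≫ _) O.globBimod_ofBase).trans ((Category.id_comp _).trans ?_)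
  rw [RGlob.idn_hom]
  exact O.globBimod.A.map_idn (OperadBimod.forget _) _

theorem S_bar (a : (O.X n).V.at' I) : O.S n (a - O.E n (O.S n a)) = 0 := by
  rw [map_sub, S_E, sub_self]

theorem linearExchange : BasedGlobBimod.exchangeProperty K O.globBimod := by
  intro n _ I J f j hf (a : (O.X n).V.at' J) (b : (O.X n).V.at' (f.fiber j))
  have hE : ∀ {I : NonemptyFinLinOrd.{0}} (p : (O.X 0).V.at' I),
      Coll.ap (O.globBimod.idn₀ n).hom p = O.E n p := fun p =>
    congrArg (fun φ : (O.X 0).V ⟶ (O.X n).V => Coll.ap φ p) (O.globBimod_idn₀ n)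
  have hS : ∀ {I : NonemptyFinLinOrd.{0}} (a : (O.X n).V.at' I),
      Coll.ap (O.globBimod.src₀ n).hom a = O.S n a := fun a =>
    congrArg (fun φ : (O.X n).V ⟶ (O.X 0).V => Coll.ap φ a) (O.globBimod_src₀ n)
  have hT : ∀ {I : NonemptyFinLinOrd.{0}} (a : (O.X n).V.at' I),
      Coll.ap (O.globBimod.tgt₀ n).hom a = O.T n a := fun a =>
    congrArg (fun φ : (O.X n).V ⟶ (O.X 0).V => Coll.ap φ a) (O.globBimod_tgt₀ n)
  -- the multiplication of `O.X n` along elementary compositions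
  let m : (O.X n).V.at' J → (O.X n).V.at' (f.fiber j) → (O.X n).V.at' I := fun a b =>
    (O.X n).mul f a (insertAt j (fun j' => (O.X n).oneAt _ (hf j'.1 j'.2)) b)
  have m_add : ∀ a a' b, m (a + a') b = m a b + m a' b := fun a a' b =>
    ((O.X n).linear_root f _).map_add a a'
  have m_add' : ∀ a b b', m a (b + b') = m a b + m a b' := fun a b b' =>
    ((O.X n).mul_multiadditive f a).map_insertAt_add j _ b b'
  have hone : ∀ {I : NonemptyFinLinOrd.{0}} (h : Subsingleton I),
      O.E n ((O.X 0).oneAt I h) = (O.X n).oneAt I h := fun h =>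
    ShuffleOperad.ap_oneAt (O.idn (Nat.zero_le n)) h
  have htone : ∀ {I : NonemptyFinLinOrd.{0}} (h : Subsingleton I),
      O.T n ((O.X n).oneAt I h) = (O.X 0).oneAt I h := fun h =>
    ShuffleOperad.ap_oneAt (O.tgt (Nat.zero_le n)) h
  have m_leaf : ∀ a b, O.S n b = 0 → m a b = m (O.E n (O.T n a)) b := by
    intro a b hb
    have h := O.mul_of_leaf f a (insertAt j (fun j' => (O.X n).oneAt _ (hf j'.1 j'.2)) b) j
      (by rw [insertAt_self]; exact hb)
    refine h.trans ?_
    change _ = (O.X n).mul f _ _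
    congr 1
    refine eq_insertAt j _ _ ?_ fun j' hj' => ?_
    · rw [insertAt_self, insertAt_self]
    · rw [insertAt_ne _ _ _ hj', insertAt_ne _ _ _ hj', htone, hone]
  have m_root : ∀ a b, O.S n a = 0 → m a b = m a (O.E n (O.T n b)) := by
    intro a b ha
    refine (O.mul_of_root f a ha _).trans ?_
    change _ = (O.X n).mul f _ _
    congr 1
    refine eq_insertAt j _ _ ?_ fun j' hj' => ?_
    · rw [insertAt_self]
    · rw [insertAt_ne _ _ _ hj', htone, hone]
  have hins : ∀ p : (O.X 0).V.at' (f.fiber j),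
      (fun j' => O.E n (insertAt (X := fun k => (O.X 0).V.at' (f.fiber k)) j
        (fun j' => (O.X 0).oneAt _ (hf j'.1 j'.2)) p j')) =
      insertAt (X := fun k => (O.X n).V.at' (f.fiber k)) j
        (fun j' => (O.X n).oneAt _ (hf j'.1 j'.2)) (O.E n p) := fun p =>
    (ShuffleOperad.map_insertAt (fun j' => O.E n (I := f.fiber j')) _ _ _).trans
      (congrArg (fun q => insertAt j q _) (funext fun j' => hone _))
  have hrho : ∀ (a : (O.X n).V.at' J) (p : (O.X 0).V.at' (f.fiber j)),
      (O.globBimod.A.X n).rhoPartial f j hf a p = m a (O.E n p) := fun a p =>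
    congrArg ((O.X n).mul f a) (hins p)
  have hlam : ∀ (p : (O.X 0).V.at' J) (a : (O.X n).V.at' (f.fiber j)),
      (O.globBimod.A.X n).lamPartial f j hf p a = m (O.E n p) a := fun p a =>
    congrArg (fun q => (O.X n).mul f (O.E n p) (insertAt j q a)) (funext fun j' => hone _)
  have hmul : ∀ (p : (O.X 0).V.at' J) (q : (O.X 0).V.at' (f.fiber j)),
      O.E n ((O.X 0).mulPartial f j hf p q) = m (O.E n p) (O.E n q) := fun p q =>
    ((O.idn (Nat.zero_le n)).map_mul f _ _).trans (congrArg ((O.X n).mul f (O.E n p)) (hins q))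
  -- both sides are the product `m a b`
  have up : muUp (O.globBimod.src₀ n) (O.globBimod.tgt₀ n) (O.globBimod.idn₀ n) f j hf a b =
      m a b := by
    rw [muUp_eq _ _ _ f j hf a b (hT a) (hS b) ((hE _).trans (hmul _ _)), hrho, hlam]
    have hb : b = O.E n (O.S n b) + (b - O.E n (O.S n b)) := by rw [add_sub_cancel]
    have h₁ : m a b = m a (O.E n (O.S n b)) + m (O.E n (O.T n a)) (b - O.E n (O.S n b)) := by
      rw [← m_leaf _ _ (O.S_bar b), ← m_add', ← hb]
    have h₂ : m (O.E n (O.T n a)) b = m (O.E n (O.T n a)) (O.E n (O.S n b)) +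
        m (O.E n (O.T n a)) (b - O.E n (O.S n b)) := by rw [← m_add', ← hb]
    rw [h₁, h₂]
    exact (by intros; abel : ∀ x y z : (O.X n).V.at' I, x + (y + z) - y = x + z) _ _ _
  have down : muDown (O.globBimod.src₀ n) (O.globBimod.tgt₀ n) (O.globBimod.idn₀ n) f j hf a b =
      m a b := by
    rw [muDown_eq _ _ _ f j hf a b (hS a) (hT b) ((hE _).trans (hmul _ _)), hrho, hlam]
    have ha : a = O.E n (O.S n a) + (a - O.E n (O.S n a)) := by rw [add_sub_cancel]
    have h₁ : m a b = m (O.E n (O.S n a)) b + m (a - O.E n (O.S n a)) (O.E n (O.T n b)) := by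
      rw [← m_root _ _ (O.S_bar a), ← m_add, ← ha]
    have h₂ : m a (O.E n (O.T n b)) = m (O.E n (O.S n a)) (O.E n (O.T n b)) +
        m (a - O.E n (O.S n a)) (O.E n (O.T n b)) := by rw [← m_add, ← ha]
    rw [h₁, h₂]
    exact (by intros; abel : ∀ x y z : (O.X n).V.at' I, x + (y + z) - y = x + z) _ _ _
  rw [up, down]

end OmegaCat

/-! ### The ω-category of a reflexive globular bimodule -/

namespace ReflBimod

variable {K : Type u} [Field K] {P Q : ShuffleOperad.{u, w} K} (R : ReflBimod P)
  {I J : NonemptyFinLinOrd.{0}} (f : Shuffle I J)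

/-- Increments by elements of `ker s` depend on the other arguments only through their targets. -/
theorem mul_add_sub (a a' n₀ : R.A.V.at' J) (b b' n : ∀ j, R.A.V.at' (f.fiber j))
    (ha : R.T a = R.T a') (hb : ∀ j, R.T (b j) = R.T (b' j)) (hn₀ : R.S n₀ = 0)
    (hn : ∀ j, R.S (n j) = 0) :
    R.mul f (a + n₀) (fun j => b j + n j) - R.mul f a b =
      R.mul f (a' + n₀) (fun j => b' j + n j) - R.mul f a' b' := by
  rw [mul_add, mul_add, R.mul_of_root f n₀ hn₀, R.mul_of_root f n₀ hn₀, add_sub_right_comm,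
    add_sub_right_comm]
  simp only [map_add, hb]
  congr 1
  refine (R.mul_multiadditive f a).map_add_sub (R.mul_multiadditive f a') b b' n fun S _ j => ?_
  rw [R.mul_of_leaf f a _ j (by rw [insertAt_self]; exact hn j),
    R.mul_of_leaf f a' _ j (by rw [insertAt_self]; exact hn j), ha]
  congr 1
  · funext j'
    rw [insertAt_ne _ _ _ j'.2, insertAt_ne _ _ _ j'.2]
    split_ifs
    · rw [map_add, map_add, hb]
    · exact hb _
  · rw [insertAt_self, insertAt_self]

/-- The multiplication by elements of `P` around one element of `A` is the left action. -/
theorem mul_E_insertAt (j : J) (u : P.V.at' J)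
    (p : ∀ j' : {j' // j' ≠ j}, P.V.at' (f.fiber j'.1)) (a : R.A.V.at' (f.fiber j)) :
    R.mul f (R.E u) (insertAt j (fun j' => R.E (p j')) a) = R.A.lam f j u p a := by
  have ha : a = R.E (R.S a) + R.bar a := by rw [bar_apply, add_sub_cancel]
  have h₁ : R.mul f (R.E u) (insertAt j (fun j' => R.E (p j')) (R.E (R.S a))) =
      R.A.lam f j u p (R.E (R.S a)) := by
    have h := R.mul_E f (R.E u) (insertAt j p (R.S a))
    rw [ShuffleOperad.map_insertAt (fun j' => R.E (I := f.fiber j'))] at h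
    rw [h, rho_E, lam_E]
  have h₂ : R.mul f (R.E u) (insertAt j (fun j' => R.E (p j')) (R.bar a)) =
      R.A.lam f j u p (R.bar a) := by
    rw [R.mul_of_leaf f _ _ j (by rw [insertAt_self]; exact R.S_bar a), insertAt_self, T_E]
    congr 1
    funext j'
    rw [insertAt_ne _ _ _ j'.2, T_E]
  rw [ha, (R.mul_multiadditive f _).map_insertAt_add, h₁, h₂, R.A.lam_add]

/-- Naturality of the multiplication with respect to morphisms of bimodules over a morphism of
operads. -/
theorem mul_map (R' : ReflBimod Q) (φ : P.V ⟶ Q.V) (g : R.A.V ⟶ R'.A.V)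
    (hlam : ∀ (j : J) (u : P.V.at' J) (p : ∀ j' : {j' // j' ≠ j}, P.V.at' (f.fiber j'.1))
      (a : R.A.V.at' (f.fiber j)), Coll.ap g (R.A.lam f j u p a) = R'.A.lam f j (Coll.ap φ u)
        (fun j' => Coll.ap φ (p j')) (Coll.ap g a))
    (hrho : ∀ (a : R.A.V.at' J) (p : ∀ j, P.V.at' (f.fiber j)),
      Coll.ap g (R.A.rho f a p) = R'.A.rho f (Coll.ap g a) (fun j => Coll.ap φ (p j)))
    (hS : ∀ {I : NonemptyFinLinOrd.{0}} (a : R.A.V.at' I),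
      R'.S (Coll.ap g a) = Coll.ap φ (R.S a))
    (hT : ∀ {I : NonemptyFinLinOrd.{0}} (a : R.A.V.at' I),
      R'.T (Coll.ap g a) = Coll.ap φ (R.T a))
    (hE : ∀ {I : NonemptyFinLinOrd.{0}} (p : P.V.at' I), Coll.ap g (R.E p) = R'.E (Coll.ap φ p))
    (a : R.A.V.at' J) (b : ∀ j, R.A.V.at' (f.fiber j)) :
    Coll.ap g (R.mul f a b) = R'.mul f (Coll.ap g a) (fun j => Coll.ap g (b j)) := by
  rw [mul, mul, map_add, map_sum, hrho]
  simp only [hlam, hS, hT, bar_apply, map_sub, hE]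
  congr 1
  refine Finset.sum_congr rfl fun j _ => ?_
  congr 1
  funext j'
  simp only [pass, hS, hT]
  split_ifs <;> rfl

/-- The source, as a morphism of operads. -/
noncomputable def source : R.total ⟶ P where
  hom := R.s.hom
  map_mul f a b := R.S_mul f a b
  map_one := R.S_E P.one

end ReflBimod

theorem linearExchange_self {K : Type u} [Field K] {P : ShuffleOperad.{u, w} K}
    {A : OperadBimod P} (s : A ⟶ P.regular) (i : P.regular ⟶ A) : LinearExchange s s i := by
  intro I J f j hf a b
  rw [muUp, muDown, add_comm]

namespace BasedGlobBimod

variable {K : Type u} [Field K] (X : BasedGlobBimod.{u, w} K)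

theorem src₀_zero : X.src₀ 0 = X.toBase := by
  rw [src₀, RGlob.src_self, Category.id_comp]

theorem tgt₀_zero : X.tgt₀ 0 = X.toBase := by
  rw [tgt₀, RGlob.tgt_self, Category.id_comp]

theorem ofBase_toBase : X.ofBase ≫ X.toBase = 𝟙 _ := by simp [ofBase, toBase]

theorem toBase_ofBase : X.toBase ≫ X.ofBase = 𝟙 _ := by simp [ofBase, toBase]

theorem toBase_idn₀ (n : ℕ) : X.toBase ≫ X.idn₀ n = X.A.idn (Nat.zero_le n) := by
  rw [idn₀, ← Category.assoc, toBase_ofBase, Category.id_comp]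

theorem idn₀_src₀ (n : ℕ) : X.idn₀ n ≫ X.src₀ n = 𝟙 _ := by
  rw [idn₀, src₀, Category.assoc, ← Category.assoc (X.A.idn _), RGlob.idn_src, Category.id_comp,
    ofBase_toBase]

theorem idn₀_tgt₀ (n : ℕ) : X.idn₀ n ≫ X.tgt₀ n = 𝟙 _ := by
  rw [idn₀, tgt₀, Category.assoc, ← Category.assoc (X.A.idn _), RGlob.idn_tgt, Category.id_comp,
    ofBase_toBase]

theorem s_src₀ (n : ℕ) : X.A.s n ≫ X.src₀ n = X.src₀ (n + 1) := by
  rw [src₀, src₀, X.A.src_succ (Nat.zero_le n), Category.assoc]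

theorem t_tgt₀ (n : ℕ) : X.A.t n ≫ X.tgt₀ n = X.tgt₀ (n + 1) := by
  rw [tgt₀, tgt₀, X.A.tgt_succ (Nat.zero_le n), Category.assoc]

theorem s_tgt₀ (n : ℕ) : X.A.s (n + 1) ≫ X.tgt₀ (n + 1) = X.tgt₀ (n + 2) := by
  rw [tgt₀, tgt₀, ← Category.assoc, X.A.s_tgt (Nat.succ_pos n)]

theorem t_src₀ (n : ℕ) : X.A.t (n + 1) ≫ X.src₀ (n + 1) = X.src₀ (n + 2) := by
  rw [src₀, src₀, ← Category.assoc, X.A.t_src (Nat.succ_pos n)]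

theorem i_src₀ (n : ℕ) : X.A.i n ≫ X.src₀ (n + 1) = X.src₀ n := by
  rw [← s_src₀, ← Category.assoc, X.A.is, Category.id_comp]

theorem i_tgt₀ (n : ℕ) : X.A.i n ≫ X.tgt₀ (n + 1) = X.tgt₀ n := by
  rw [← t_tgt₀, ← Category.assoc, X.A.it, Category.id_comp]

theorem idn₀_i (n : ℕ) : X.idn₀ n ≫ X.A.i n = X.idn₀ (n + 1) := by
  rw [idn₀, idn₀, X.A.idn_succ (Nat.zero_le n), Category.assoc]

theorem idn₀_s (n : ℕ) : X.idn₀ (n + 1) ≫ X.A.s n = X.idn₀ n := by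
  rw [← idn₀_i, Category.assoc, X.A.is, Category.comp_id]

theorem idn₀_t (n : ℕ) : X.idn₀ (n + 1) ≫ X.A.t n = X.idn₀ n := by
  rw [← idn₀_i, Category.assoc, X.A.it, Category.comp_id]

variable {X} (hX : exchangeProperty K X)

/-- The reflexive bimodule `A_n ⇉ P`. -/
def cell (n : ℕ) : ReflBimod X.P where
  A := X.A.X n
  s := X.src₀ n
  t := X.tgt₀ n
  i := X.idn₀ n
  i_s := X.idn₀_src₀ n
  i_t := X.idn₀_tgt₀ n
  exchange := by
    rcases Nat.eq_zero_or_pos n with rfl | hn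
    · -- the relation is trivial for `s = t`, which is the case for `n = 0`
      rw [tgt₀_zero, src₀_zero]
      exact linearExchange_self _ _
    · exact hX n hn

/-- A morphism of bimodules compatible with the maps to and from `P` is a morphism of operads. -/
noncomputable def cellMap {m n : ℕ} (g : X.A.X m ⟶ X.A.X n) (hs : g ≫ X.src₀ n = X.src₀ m)
    (ht : g ≫ X.tgt₀ n = X.tgt₀ m) (hi : X.idn₀ m ≫ g = X.idn₀ n) :
    (cell hX m).total ⟶ (cell hX n).total where
  hom := g.hom
  map_mul f a b := (cell hX m).mul_map f (cell hX n) (𝟙 _) g.hom (g.map_lam f) (g.map_rho f)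
    (fun a => congrArg (fun φ : X.A.X m ⟶ X.P.regular => Coll.ap φ.hom a) hs)
    (fun a => congrArg (fun φ : X.A.X m ⟶ X.P.regular => Coll.ap φ.hom a) ht)
    (fun a => congrArg (fun φ : X.P.regular ⟶ X.A.X n => Coll.ap φ.hom a) hi) a b
  map_one := congrArg (fun φ : X.P.regular ⟶ X.A.X n => Coll.ap φ.hom X.P.one) hi

/-- A morphism of bimodules `A_m ⟶ A_0 = P` which is multiplicative to `P` is a morphism of
operads. -/
noncomputable def cellMapZero {m : ℕ} (g : X.A.X m ⟶ X.A.X 0)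
    (hg : ∀ {I J : NonemptyFinLinOrd.{0}} (f : Shuffle I J) (a : (X.A.X m).V.at' J)
      (b : ∀ j, (X.A.X m).V.at' (f.fiber j)),
      Coll.ap (g ≫ X.toBase).hom ((cell hX m).mul f a b) =
        X.P.mul f (Coll.ap (g ≫ X.toBase).hom a) (fun j => Coll.ap (g ≫ X.toBase).hom (b j)))
    (hi : X.idn₀ m ≫ g = X.idn₀ 0) :
    (cell hX m).total ⟶ (cell hX 0).total where
  hom := g.hom
  map_mul f a b := by
    have hg₀ : g = (g ≫ X.toBase) ≫ X.idn₀ 0 := by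
      rw [Category.assoc, toBase_idn₀, RGlob.idn_self, Category.comp_id]
    have h : ∀ {I : NonemptyFinLinOrd.{0}} (a : (X.A.X m).V.at' I),
        Coll.ap g.hom a = (cell hX 0).E (Coll.ap (g ≫ X.toBase).hom a) := fun a =>
      congrArg (fun φ : X.A.X m ⟶ X.A.X 0 => Coll.ap φ.hom a) hg₀
    exact (h _).trans ((congrArg (cell hX 0).E (hg f a b)).trans
      ((((cell hX 0).mul_E f _ _).trans ((cell hX 0).rho_E f _ _)).symm.trans
        (congrArg₂ ((cell hX 0).mul f) (h a).symm (funext fun j => (h (b j)).symm))))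
  map_one := congrArg (fun φ : X.P.regular ⟶ X.A.X 0 => Coll.ap φ.hom X.P.one) hi

/-- The source of cells is a morphism of operads. -/
noncomputable def sHom : ∀ n, (cell hX (n + 1)).total ⟶ (cell hX n).total
  | 0 => cellMapZero hX (X.A.s 0) (by
      have h : X.A.s 0 ≫ X.toBase = X.src₀ 1 := by rw [← X.s_src₀, src₀_zero]
      rw [h]
      intro I J f a b
      exact (cell hX 1).S_mul f a b) (X.idn₀_s 0)
  | n + 1 => cellMap hX (X.A.s (n + 1)) (X.s_src₀ _) (X.s_tgt₀ _) (X.idn₀_s _)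

/-- The target of cells is a morphism of operads. -/
noncomputable def tHom : ∀ n, (cell hX (n + 1)).total ⟶ (cell hX n).total
  | 0 => cellMapZero hX (X.A.t 0) (by
      have h : X.A.t 0 ≫ X.toBase = X.tgt₀ 1 := by rw [← X.t_tgt₀, tgt₀_zero]
      rw [h]
      intro I J f a b
      exact (cell hX 1).T_mul f a b) (X.idn₀_t 0)
  | n + 1 => cellMap hX (X.A.t (n + 1)) (X.t_src₀ _) (X.t_tgt₀ _) (X.idn₀_t _)

theorem sHom_hom (n : ℕ) : (sHom hX n).hom = (X.A.s n).hom := by cases n <;> rfl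

theorem tHom_hom (n : ℕ) : (tHom hX n).hom = (X.A.t n).hom := by cases n <;> rfl

/-- The reflexive globular operad of a reflexive globular bimodule. -/
noncomputable def totalGlob : RGlob (ShuffleOperad.{u, w} K) where
  X n := (cell hX n).total
  s := sHom hX
  t := tHom hX
  i n := cellMap hX (X.A.i n) (X.i_src₀ n) (X.i_tgt₀ n) (X.idn₀_i n)
  ss n := ShuffleOperad.Hom.ext <| by
    change (sHom hX (n + 1)).hom ≫ (sHom hX n).hom = (tHom hX (n + 1)).hom ≫ (sHom hX n).hom
    rw [sHom_hom, sHom_hom, tHom_hom]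
    exact congrArg OperadBimod.Hom.hom (X.A.ss n)
  tt n := ShuffleOperad.Hom.ext <| by
    change (tHom hX (n + 1)).hom ≫ (tHom hX n).hom = (sHom hX (n + 1)).hom ≫ (tHom hX n).hom
    rw [sHom_hom, tHom_hom, tHom_hom]
    exact congrArg OperadBimod.Hom.hom (X.A.tt n)
  is n := ShuffleOperad.Hom.ext <| by
    change (X.A.i n).hom ≫ (sHom hX n).hom = 𝟙 _
    rw [sHom_hom]
    exact congrArg OperadBimod.Hom.hom (X.A.is n)
  it n := ShuffleOperad.Hom.ext <| by
    change (X.A.i n).hom ≫ (tHom hX n).hom = 𝟙 _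
    rw [tHom_hom]
    exact congrArg OperadBimod.Hom.hom (X.A.it n)

/-- The reflexive globular collection underlying a reflexive globular bimodule. -/
abbrev coll (X : BasedGlobBimod.{u, w} K) : RGlob (Coll.{u, w} K) :=
  X.A.map (OperadBimod.forget X.P)

theorem coll_totalGlob : (totalGlob hX).coll = X.coll := by
  have hs : (fun n => (sHom hX n).hom) = fun n => (X.A.s n).hom := funext (sHom_hom hX)
  have ht : (fun n => (tHom hX n).hom) = fun n => (X.A.t n).hom := funext (tHom_hom hX)
  simp only [RGlob.coll, RGlob.map, coll]
  congr 1

theorem src_totalGlob {k l : ℕ} (h : k ≤ l) : ((totalGlob hX).src h).hom = (X.A.src h).hom := by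
  have key : ∀ {A B : RGlob (Coll.{u, w} K)} (_ : A = B), HEq (A.src h) (B.src h) := by
    rintro A _ rfl; rfl
  exact eq_of_heq (((heq_of_eq (RGlob.src_hom h)).trans (key (coll_totalGlob hX))).trans
    (heq_of_eq (X.A.map_src (OperadBimod.forget X.P) h).symm))

theorem tgt_totalGlob {k l : ℕ} (h : k ≤ l) : ((totalGlob hX).tgt h).hom = (X.A.tgt h).hom := by
  have key : ∀ {A B : RGlob (Coll.{u, w} K)} (_ : A = B), HEq (A.tgt h) (B.tgt h) := by
    rintro A _ rfl; rfl
  exact eq_of_heq (((heq_of_eq (RGlob.tgt_hom h)).trans (key (coll_totalGlob hX))).trans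
    (heq_of_eq (X.A.map_tgt (OperadBimod.forget X.P) h).symm))

theorem idn_totalGlob {k l : ℕ} (h : k ≤ l) : ((totalGlob hX).idn h).hom = (X.A.idn h).hom := by
  have key : ∀ {A B : RGlob (Coll.{u, w} K)} (_ : A = B), HEq (A.idn h) (B.idn h) := by
    rintro A _ rfl; rfl
  exact eq_of_heq (((heq_of_eq (RGlob.idn_hom h)).trans (key (coll_totalGlob hX))).trans
    (heq_of_eq (X.A.map_idn (OperadBimod.forget X.P) h).symm))

theorem linMul_totalGlob : (totalGlob hX).LinMul := by
  intro k l h I J f (u : (X.A.X l).V.at' J) (u' : (X.A.X l).V.at' J)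
    (v : ∀ j, (X.A.X l).V.at' (f.fiber j)) (v' : ∀ j, (X.A.X l).V.at' (f.fiber j)) hu hv
  let σ : ∀ {I : NonemptyFinLinOrd.{0}}, (X.A.X l).V.at' I →ₗ[K] (X.A.X k).V.at' I :=
    Coll.ap ((totalGlob hX).src h.le).hom
  let τ : ∀ {I : NonemptyFinLinOrd.{0}}, (X.A.X l).V.at' I →ₗ[K] (X.A.X k).V.at' I :=
    Coll.ap ((totalGlob hX).tgt h.le).hom
  let ι : ∀ {I : NonemptyFinLinOrd.{0}}, (X.A.X k).V.at' I →ₗ[K] (X.A.X l).V.at' I :=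
    Coll.ap ((totalGlob hX).idn h.le).hom
  let R := cell hX l
  have hS : ∀ {I : NonemptyFinLinOrd.{0}} (x : (X.A.X l).V.at' I),
      R.S x = (cell hX k).S (σ x) := fun x => by
    have h₁ := X.A.src_src (Nat.zero_le k) h.le (Nat.zero_le l)
    have h₂ : X.A.src h.le ≫ X.src₀ k = X.src₀ l := by
      rw [src₀, src₀, ← Category.assoc, h₁]
    change Coll.ap (X.src₀ l).hom x = Coll.ap (X.src₀ k).hom (Coll.ap _ x)
    rw [src_totalGlob, ← h₂]
    rfl
  have hT : ∀ {I : NonemptyFinLinOrd.{0}} (x : (X.A.X l).V.at' I),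
      R.T x = (cell hX k).T (τ x) := fun x => by
    have h₁ := X.A.tgt_tgt (Nat.zero_le k) h.le (Nat.zero_le l)
    have h₂ : X.A.tgt h.le ≫ X.tgt₀ k = X.tgt₀ l := by
      rw [tgt₀, tgt₀, ← Category.assoc, h₁]
    change Coll.ap (X.tgt₀ l).hom x = Coll.ap (X.tgt₀ k).hom (Coll.ap _ x)
    rw [tgt_totalGlob, ← h₂]
    rfl
  have hσι : ∀ {I : NonemptyFinLinOrd.{0}} (y : (X.A.X k).V.at' I), σ (ι y) = y := fun y =>
    congrArg (fun φ : (totalGlob hX).X k ⟶ (totalGlob hX).X k => Coll.ap φ.hom y)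
      ((totalGlob hX).idn_src h.le)
  have hτι : ∀ {I : NonemptyFinLinOrd.{0}} (y : (X.A.X k).V.at' I), τ (ι y) = y := fun y =>
    congrArg (fun φ : (totalGlob hX).X k ⟶ (totalGlob hX).X k => Coll.ap φ.hom y)
      ((totalGlob hX).idn_tgt h.le)
  -- a composable pair `(x, y)` differs from `(x, i t x)` by the element `y - i t x` of `ker s`
  have hn : ∀ {I : NonemptyFinLinOrd.{0}} (x y : (X.A.X l).V.at' I), τ x = σ y →
      R.S (y - ι (τ x)) = 0 := fun x y hxy =>
    (hS _).trans ((congrArg (cell hX k).S (by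
      rw [σ.map_sub, hσι, hxy, sub_self]; rfl)).trans ((cell hX k).S.map_zero))
  have hTι : ∀ {I : NonemptyFinLinOrd.{0}} (x : (X.A.X l).V.at' I),
      R.T x = R.T (ι (τ x)) := fun x =>
    (hT x).trans ((congrArg (cell hX k).T (hτι _).symm).trans (hT _).symm)
  have key := R.mul_add_sub f u (ι (τ u)) (u' - ι (τ u)) v (fun j => ι (τ (v j)))
    (fun j => v' j - ι (τ (v j))) (hTι u) (fun j => hTι (v j))
    (hn u u' hu) (fun j => hn (v j) (v' j) (hv j))
  have hlin : ∀ {I : NonemptyFinLinOrd.{0}} (x y : (X.A.X l).V.at' I),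
      (totalGlob hX).linAt h.le x y = x + (y - ι (τ x)) := fun x y => add_sub_assoc x y _
  have hmul : R.mul f (ι (τ u)) (fun j => ι (τ (v j))) = ι (τ (R.mul f u v)) :=
    ((((totalGlob hX).tgt h.le ≫ (totalGlob hX).idn h.le).map_mul f u v)).symm
  have hfill : ∀ {I : NonemptyFinLinOrd.{0}} (x y : R.A.V.at' I), x + (y - x) = y := fun x y =>
    add_sub_cancel x y
  have key' := (key.trans (congrArg₂ (fun p q => p - q) (congrArg₂ (R.mul f) (hfill _ _)
    (funext fun j => hfill _ _)) hmul))
  refine (congrArg₂ (R.mul f) (hlin u u') (funext fun j => hlin (v j) (v' j))).trans ?_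
  refine (sub_add_cancel _ (R.mul f u v)).symm.trans ?_
  refine (congrArg (fun x => x + R.mul f u v) key').trans ?_
  exact (add_comm _ _).trans (hlin _ _).symm

end BasedGlobBimod

/-! ### Morphisms given by equalities of objects -/

/-- The morphism `φ` is `eqToHom` of an equality of objects. -/
def IsEqToHom {C : Type u} [Category.{v} C] {X Y : C} (φ : X ⟶ Y) : Prop :=
  ∃ h : X = Y, φ = eqToHom h

/-- A functor with a natural transformation to the identity, all of whose components are given by
equalities, is equal to the identity. -/
theorem CategoryTheory.Functor.eq_id_of_isEqToHom {C : Type u} [Category.{v} C]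
    (F : C ⥤ C) (θ : F ⟶ 𝟭 C) (h : ∀ X, IsEqToHom (θ.app X)) : F = 𝟭 C := by
  choose e he using h
  refine CategoryTheory.Functor.ext e fun X Y f => ?_
  have hn := θ.naturality f
  rw [he, he] at hn
  rw [← Category.assoc, ← hn, Category.assoc, eqToHom_trans, eqToHom_refl, Category.comp_id]

theorem RGlob.isEqToHom {C : Type u} [Category.{v} C] {A B : RGlob C} (φ : A ⟶ B)
    (h : ∀ n, IsEqToHom (φ.app n)) : IsEqToHom φ := by
  choose hX hφ using h
  obtain ⟨app, hs, ht, hi⟩ := φ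
  obtain ⟨X, s, t, i, _, _, _, _⟩ := A
  obtain ⟨Y, s', t', i', _, _, _, _⟩ := B
  obtain rfl : X = Y := funext hX
  obtain rfl : app = fun n => 𝟙 (X n) := funext hφ
  obtain rfl : s = s' := funext fun n => by simpa using hs n
  obtain rfl : t = t' := funext fun n => by simpa using ht n
  obtain rfl : i = i' := funext fun n => by simpa using hi n
  exact ⟨rfl, rfl⟩

section

variable {K : Type u} [Field K]

theorem ShuffleOperad.isEqToHom {P Q : ShuffleOperad.{u, w} K} (φ : P ⟶ Q)
    (h : IsEqToHom φ.hom) : IsEqToHom φ := by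
  obtain ⟨hV, hφ⟩ := h
  obtain ⟨hom, hm, ho⟩ := φ
  obtain ⟨V, m, o, _, _, _, _, _, _⟩ := P
  obtain ⟨W, m', o', _, _, _, _, _, _⟩ := Q
  obtain rfl : V = W := hV
  obtain rfl : hom = 𝟙 V := hφ
  obtain rfl : @m = @m' := by
    funext I J f a b
    exact hm f a b
  obtain rfl : o = o' := ho
  exact ⟨rfl, rfl⟩

theorem OperadBimod.isEqToHom {P : ShuffleOperad.{u, w} K} {A B : OperadBimod P} (φ : A ⟶ B)
    (h : IsEqToHom φ.hom) : IsEqToHom φ := by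
  obtain ⟨hV, hφ⟩ := h
  obtain ⟨hom, hl, hr⟩ := φ
  obtain ⟨V, l, r, _, _, _, _, _, _, _, _, _, _, _, _⟩ := A
  obtain ⟨W, l', r', _, _, _, _, _, _, _, _, _, _, _, _⟩ := B
  obtain rfl : V = W := hV
  obtain rfl : hom = 𝟙 V := hφ
  obtain rfl : @l = @l' := by
    funext I J f j u p a
    exact hl f j u p a
  obtain rfl : @r = @r' := by
    funext I J f a p
    exact hr f a p
  exact ⟨rfl, rfl⟩

theorem GlobBimod.isEqToHom {X Y : GlobBimod.{u, w} K} (φ : X ⟶ Y) (hP : IsEqToHom φ.base)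
    (hA : ∀ n, IsEqToHom (φ.app n)) : IsEqToHom φ := by
  obtain ⟨hP, hb⟩ := hP
  obtain ⟨base, app, hl, hr, hs, ht, hi⟩ := φ
  obtain ⟨P, A⟩ := X
  obtain ⟨Q, B⟩ := Y
  obtain rfl : P = Q := hP
  obtain rfl : base = 𝟙 P := hb
  let ψ : ∀ n, A.X n ⟶ B.X n := fun n => ⟨app n, hl n, hr n⟩
  let χ : A ⟶ B := ⟨ψ, fun n => OperadBimod.Hom.ext (hs n), fun n => OperadBimod.Hom.ext (ht n),
    fun n => OperadBimod.Hom.ext (hi n)⟩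
  obtain ⟨hAB, hχ⟩ := RGlob.isEqToHom χ fun n => OperadBimod.isEqToHom (ψ n) (hA n)
  subst hAB
  have happ : app = fun n => 𝟙 (A.X n).V :=
    congrArg (fun (χ : A ⟶ A) n => (χ.app n).hom) hχ
  subst happ
  exact ⟨rfl, rfl⟩

theorem BasedGlobBimod.isEqToHom {X Y : BasedGlobBimod.{u, w} K} (φ : X ⟶ Y)
    (h : IsEqToHom φ.hom) : IsEqToHom φ := by
  obtain ⟨hXY, hφ⟩ := h
  obtain ⟨hom, hz⟩ := φ
  obtain ⟨X, hX⟩ := X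
  obtain ⟨Y, hY⟩ := Y
  obtain rfl : X = Y := hXY
  obtain rfl : hom = 𝟙 X := hφ
  exact ⟨rfl, rfl⟩

theorem CategoryTheory.ObjectProperty.isEqToHom {C : Type u} [Category.{v} C]
    {P : ObjectProperty C} {X Y : P.FullSubcategory} (φ : X ⟶ Y) (h : IsEqToHom φ.hom) :
    IsEqToHom φ := by
  obtain ⟨hXY, hφ⟩ := h
  obtain ⟨X, hX⟩ := X
  obtain ⟨Y, hY⟩ := Y
  obtain rfl : X = Y := hXY
  exact ⟨rfl, P.hom_ext hφ⟩

theorem OmegaCat.isEqToHom {O O' : ShuffleOmegaOperad.{u, w} K} (φ : O ⟶ O')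
    (h : IsEqToHom φ.hom) : IsEqToHom φ := by
  obtain ⟨hO, hφ⟩ := h
  obtain rfl := OmegaCat.ext_toRGlob hO
  exact ⟨rfl, OmegaCat.Hom.ext hφ⟩

end

/-! ### The functors between ω-operads and globular bimodules -/

namespace OmegaCat

variable {K : Type u} [Field K]

/-- The morphism of globular bimodules of an ω-functor. -/
def globBimodMap {O O' : ShuffleOmegaOperad.{u, w} K} (F : O ⟶ O') :
    O.globBimod ⟶ O'.globBimod where
  hom :=
    { base := F.hom.app 0
      app := fun n => (F.hom.app n).hom
      map_lam := fun n I J f j u p a => by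
        have h : ∀ {I : NonemptyFinLinOrd.{0}} (x : (O.X 0).V.at' I),
            Coll.ap (F.hom.app n).hom (O.E n x) = O'.E n (Coll.ap (F.hom.app 0).hom x) := fun x =>
          congrArg (fun φ : O.X 0 ⟶ O'.X n => Coll.ap φ.hom x)
            (RGlob.idn_comm F.hom (Nat.zero_le n))
        refine ((F.hom.app n).map_mul f _ _).trans (congrArg₂ ((O'.X n).mul f) (h u) ?_)
        refine (ShuffleOperad.map_insertAt
          (fun j' => Coll.ap (F.hom.app n).hom (I := f.fiber j')) _ _ _).trans ?_
        exact congrArg (fun q => insertAt j q _) (funext fun j' => h (p j'))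
      map_rho := fun n I J f a p => by
        have h : ∀ {I : NonemptyFinLinOrd.{0}} (x : (O.X 0).V.at' I),
            Coll.ap (F.hom.app n).hom (O.E n x) = O'.E n (Coll.ap (F.hom.app 0).hom x) := fun x =>
          congrArg (fun φ : O.X 0 ⟶ O'.X n => Coll.ap φ.hom x)
            (RGlob.idn_comm F.hom (Nat.zero_le n))
        exact ((F.hom.app n).map_mul f _ _).trans
          (congrArg ((O'.X n).mul f _) (funext fun j => h (p j)))
      s_comm := fun n => congrArg ShuffleOperad.Hom.hom (F.hom.s_comm n)
      t_comm := fun n => congrArg ShuffleOperad.Hom.hom (F.hom.t_comm n)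
      i_comm := fun n => congrArg ShuffleOperad.Hom.hom (F.hom.i_comm n) }
  zero_comm := (congrArg ((F.hom.app 0).hom ≫ ·) O'.globBimod_toBase).trans
    (congrArg (· ≫ (F.hom.app 0).hom) O.globBimod_toBase.symm)

end OmegaCat

namespace BasedGlobBimod

variable {K : Type u} [Field K]

/-- The identification `P = A_0`, on underlying collections. -/
def ofBaseColl (X : BasedGlobBimod.{u, w} K) : X.P.V ⟶ (X.A.X 0).V := X.ofBase.hom

theorem ofBaseColl_toBaseColl (X : BasedGlobBimod.{u, w} K) :
    X.ofBaseColl ≫ X.toBaseColl = 𝟙 _ :=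
  congrArg OperadBimod.Hom.hom X.ofBase_toBase

theorem toBaseColl_ofBaseColl (X : BasedGlobBimod.{u, w} K) :
    X.toBaseColl ≫ X.ofBaseColl = 𝟙 _ :=
  congrArg OperadBimod.Hom.hom X.toBase_ofBase

variable {X Y : BasedGlobBimod.{u, w} K}

section

variable (φ : X ⟶ Y)

/-- The underlying morphism of reflexive globular collections. -/
def collMap : X.coll ⟶ Y.coll :=
  RGlob.Hom.mk (A := X.coll) (B := Y.coll) φ.hom.app φ.hom.s_comm φ.hom.t_comm φ.hom.i_comm

theorem src₀_naturality (n : ℕ) :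
    φ.hom.app n ≫ (Y.src₀ n).hom = (X.src₀ n).hom ≫ φ.hom.base.hom := by
  have h := RGlob.src_comm (collMap φ) (Nat.zero_le n)
  have hX := X.A.map_src (OperadBimod.forget X.P) (Nat.zero_le n)
  have hY := Y.A.map_src (OperadBimod.forget Y.P) (Nat.zero_le n)
  change φ.hom.app n ≫ (Y.A.src _).hom ≫ Y.toBaseColl =
    ((X.A.src _).hom ≫ X.toBaseColl) ≫ φ.hom.base.hom
  rw [Category.assoc, ← φ.zero_comm, ← Category.assoc, ← Category.assoc]
  refine congrArg (· ≫ Y.toBaseColl) ?_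
  exact ((congrArg (φ.hom.app n ≫ ·) hY).trans h.symm).trans
    (congrArg (· ≫ φ.hom.app 0) hX.symm)

theorem tgt₀_naturality (n : ℕ) :
    φ.hom.app n ≫ (Y.tgt₀ n).hom = (X.tgt₀ n).hom ≫ φ.hom.base.hom := by
  have h := RGlob.tgt_comm (collMap φ) (Nat.zero_le n)
  have hX := X.A.map_tgt (OperadBimod.forget X.P) (Nat.zero_le n)
  have hY := Y.A.map_tgt (OperadBimod.forget Y.P) (Nat.zero_le n)
  change φ.hom.app n ≫ (Y.A.tgt _).hom ≫ Y.toBaseColl =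
    ((X.A.tgt _).hom ≫ X.toBaseColl) ≫ φ.hom.base.hom
  rw [Category.assoc, ← φ.zero_comm, ← Category.assoc, ← Category.assoc]
  refine congrArg (· ≫ Y.toBaseColl) ?_
  exact ((congrArg (φ.hom.app n ≫ ·) hY).trans h.symm).trans
    (congrArg (· ≫ φ.hom.app 0) hX.symm)

theorem idn₀_naturality (n : ℕ) :
    (X.idn₀ n).hom ≫ φ.hom.app n = φ.hom.base.hom ≫ (Y.idn₀ n).hom := by
  have h := RGlob.idn_comm (collMap φ) (Nat.zero_le n)
  have hX := X.A.map_idn (OperadBimod.forget X.P) (Nat.zero_le n)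
  have hY := Y.A.map_idn (OperadBimod.forget Y.P) (Nat.zero_le n)
  have hof : X.ofBaseColl ≫ φ.hom.app 0 = φ.hom.base.hom ≫ Y.ofBaseColl := by
    rw [← Category.comp_id (φ.hom.app 0), ← toBaseColl_ofBaseColl, ← Category.assoc (φ.hom.app 0),
      φ.zero_comm, ← Category.assoc, ← Category.assoc, ofBaseColl_toBaseColl, Category.id_comp]
  change (X.ofBaseColl ≫ (X.A.idn _).hom) ≫ φ.hom.app n =
    φ.hom.base.hom ≫ Y.ofBaseColl ≫ (Y.A.idn _).hom
  rw [Category.assoc, ← Category.assoc φ.hom.base.hom, ← hof, Category.assoc]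
  refine congrArg (X.ofBaseColl ≫ ·) ?_
  exact ((congrArg (· ≫ φ.hom.app n) hX).trans h).trans (congrArg (φ.hom.app 0 ≫ ·) hY.symm)

variable (hX : exchangeProperty K X) (hY : exchangeProperty K Y)

/-- The morphism of operads of `n`-cells of a morphism of globular bimodules. -/
noncomputable def totalMap (n : ℕ) : (cell hX n).total ⟶ (cell hY n).total where
  hom := φ.hom.app n
  map_mul f a b := (cell hX n).mul_map f (cell hY n) φ.hom.base.hom (φ.hom.app n)
    (φ.hom.map_lam n f) (φ.hom.map_rho n f)
    (fun a => congrArg (fun ψ : (X.A.X n).V ⟶ Y.P.V => Coll.ap ψ a) (src₀_naturality φ n))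
    (fun a => congrArg (fun ψ : (X.A.X n).V ⟶ Y.P.V => Coll.ap ψ a) (tgt₀_naturality φ n))
    (fun p => congrArg (fun ψ : X.P.V ⟶ (Y.A.X n).V => Coll.ap ψ p) (idn₀_naturality φ n)) a b
  map_one := (congrArg (fun ψ : X.P.V ⟶ (Y.A.X n).V => Coll.ap ψ X.P.one)
    (idn₀_naturality φ n)).trans (congrArg (cell hY n).E φ.hom.base.map_one)

/-- The morphism of reflexive globular operads of a morphism of globular bimodules. -/
noncomputable def totalGlobMap : totalGlob hX ⟶ totalGlob hY where
  app := totalMap φ hX hY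
  s_comm n := ShuffleOperad.Hom.ext <| (congrArg (· ≫ φ.hom.app n) (sHom_hom hX n)).trans <|
    (φ.hom.s_comm n).trans (congrArg (φ.hom.app (n + 1) ≫ ·) (sHom_hom hY n).symm)
  t_comm n := ShuffleOperad.Hom.ext <| (congrArg (· ≫ φ.hom.app n) (tHom_hom hX n)).trans <|
    (φ.hom.t_comm n).trans (congrArg (φ.hom.app (n + 1) ≫ ·) (tHom_hom hY n).symm)
  i_comm n := ShuffleOperad.Hom.ext (φ.hom.i_comm n)

end

/-- The ω-category of operads of a reflexive globular bimodule. -/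
noncomputable def omegaCat (hX : exchangeProperty K X) : ShuffleOmegaOperad.{u, w} K :=
  RGlob.toOmegaCat (linMul_totalGlob hX)

theorem omegaCat_idn (hX : exchangeProperty K X) (n : ℕ) {I : NonemptyFinLinOrd.{0}}
    (x : (X.A.X 0).V.at' I) : Coll.ap ((totalGlob hX).idn (Nat.zero_le n)).hom x =
      (cell hX n).E (Coll.ap (cell hX 0).source.hom x) := by
  have h : ((totalGlob hX).idn (Nat.zero_le n)).hom = (X.src₀ 0).hom ≫ (X.idn₀ n).hom := by
    rw [idn_totalGlob, src₀_zero]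
    exact congrArg OperadBimod.Hom.hom (X.toBase_idn₀ n).symm
  exact congrArg (fun φ : (X.A.X 0).V ⟶ (X.A.X n).V => Coll.ap φ x) h

/-- The globular bimodule of the ω-category of `X` is `X`. -/
noncomputable def globBimodOmegaCat (hX : exchangeProperty K X) :
    (omegaCat hX).globBimod ⟶ X where
  hom :=
    { base := (cell hX 0).source
      app := fun n => 𝟙 (X.A.X n).V
      map_lam := fun n _ _ f j u p a =>
        (congrArg₂ (fun u' q => (cell hX n).mul f u' (insertAt j q a)) (omegaCat_idn hX n u)
          (funext fun j' => omegaCat_idn hX n (p j'))).trans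
            ((cell hX n).mul_E_insertAt f j _ _ a)
      map_rho := fun n _ _ f a p =>
        (congrArg ((cell hX n).mul f a) (funext fun j => omegaCat_idn hX n (p j))).trans
          ((cell hX n).mul_E f a _)
      s_comm := fun n => (Category.comp_id _).trans
        ((sHom_hom hX n).trans (Category.id_comp (X.A.s n).hom).symm)
      t_comm := fun n => (Category.comp_id _).trans
        ((tHom_hom hX n).trans (Category.id_comp (X.A.t n).hom).symm)
      i_comm := fun n => (Category.comp_id _).trans (Category.id_comp (X.A.i n).hom).symm }
  zero_comm := (Category.id_comp X.toBaseColl).trans <|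
    (congrArg OperadBimod.Hom.hom X.src₀_zero.symm).trans <|
      ((congrArg (· ≫ (X.src₀ 0).hom) (omegaCat hX).globBimod_toBase).trans
        (Category.id_comp (X.src₀ 0).hom)).symm

theorem globBimodOmegaCat_isEqToHom (hX : exchangeProperty K X) :
    IsEqToHom (globBimodOmegaCat hX) := by
  refine isEqToHom _ (GlobBimod.isEqToHom _ (ShuffleOperad.isEqToHom _ ?_) fun n => ⟨rfl, rfl⟩)
  refine ⟨congrArg OperadBimod.V X.zero, ?_⟩
  exact (congrArg OperadBimod.Hom.hom X.src₀_zero).trans (OperadBimod.eqToHom_hom X.zero)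

end BasedGlobBimod

namespace OmegaCat

variable {K : Type u} [Field K] (O : ShuffleOmegaOperad.{u, w} K)

/-- The multiplication of the operad of `n`-cells is the one built from the bimodule structure. -/
theorem mul_eq_cell_mul (n : ℕ) {I J : NonemptyFinLinOrd.{0}} (f : Shuffle I J)
    (a : (O.X n).V.at' J) (b : ∀ j, (O.X n).V.at' (f.fiber j)) :
    (O.X n).mul f a b = (BasedGlobBimod.cell O.linearExchange n).mul f a b := by
  have hE : ∀ {I : NonemptyFinLinOrd.{0}} (p : (O.X 0).V.at' I),
      Coll.ap (O.globBimod.idn₀ n).hom p = O.E n p := fun p =>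
    congrArg (fun φ : (O.X 0).V ⟶ (O.X n).V => Coll.ap φ p) (O.globBimod_idn₀ n)
  have hS : ∀ {I : NonemptyFinLinOrd.{0}} (a : (O.X n).V.at' I),
      Coll.ap (O.globBimod.src₀ n).hom a = O.S n a := fun a =>
    congrArg (fun φ : (O.X n).V ⟶ (O.X 0).V => Coll.ap φ a) (O.globBimod_src₀ n)
  have hT : ∀ {I : NonemptyFinLinOrd.{0}} (a : (O.X n).V.at' I),
      Coll.ap (O.globBimod.tgt₀ n).hom a = O.T n a := fun a =>
    congrArg (fun φ : (O.X n).V ⟶ (O.X 0).V => Coll.ap φ a) (O.globBimod_tgt₀ n)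
  refine (BasedGlobBimod.cell O.linearExchange n).eq_mul f ((O.X n).mul f)
    (fun a a' b => ((O.X n).linear_root f b).map_add a a') ((O.X n).mul_multiadditive f)
    (fun a b ha => ?_) (fun a b j hj => ?_) (fun p q => ?_) a b
  · refine (O.mul_of_root f a ((hS a).symm.trans ha) b).trans ?_
    exact congrArg ((O.X n).mul f a) (funext fun j => congrArg (O.E n) (hT (b j)).symm)
  · refine (O.mul_of_leaf f a b j ((hS _).symm.trans hj)).trans ?_
    exact congrArg₂ (fun u q => (O.X n).mul f (O.E n u) (insertAt j q (b j))) (hT a).symm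
      (funext fun j' => congrArg (O.E n) (hT (b j'.1)).symm)
  · exact (congrArg₂ ((O.X n).mul f) (hE p) (funext fun j => hE (q j))).trans
      (((O.idn (Nat.zero_le n)).map_mul f p q).symm.trans (hE _).symm)

/-- The ω-category of the globular bimodule of `O` is `O`. -/
noncomputable def omegaCatGlobBimod : BasedGlobBimod.omegaCat O.linearExchange ⟶ O :=
  homOfRGlob
    { app := fun n =>
        { hom := 𝟙 (O.X n).V
          map_mul := fun f a b => (O.mul_eq_cell_mul n f a b).symm
          map_one := (congrArg (fun φ : (O.X 0).V ⟶ (O.X n).V => Coll.ap φ (O.X 0).one)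
            (O.globBimod_idn₀ n)).trans (O.idn (Nat.zero_le n)).map_one }
      s_comm := fun n => ShuffleOperad.Hom.ext <| (Category.comp_id _).trans
        ((BasedGlobBimod.sHom_hom O.linearExchange n).trans (Category.id_comp (O.s n).hom).symm)
      t_comm := fun n => ShuffleOperad.Hom.ext <| (Category.comp_id _).trans
        ((BasedGlobBimod.tHom_hom O.linearExchange n).trans (Category.id_comp (O.t n).hom).symm)
      i_comm := fun n => ShuffleOperad.Hom.ext <| (Category.comp_id _).trans
        (Category.id_comp (O.i n).hom).symm }

theorem omegaCatGlobBimod_isEqToHom : IsEqToHom O.omegaCatGlobBimod :=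
  isEqToHom _ (RGlob.isEqToHom _ fun _ => ShuffleOperad.isEqToHom _ ⟨rfl, rfl⟩)

end OmegaCat

/-- The functor from ω-operads to globular bimodules: `A_n` is the operad of `n`-cells, as a
bimodule over the operad of `0`-cells. -/
def globBimodFunctor (K : Type u) [Field K] :
    ShuffleOmegaOperad.{u, w} K ⥤ ExchangeGlobBimod.{u, w} K where
  obj O := ⟨O.globBimod, O.linearExchange⟩
  map F := ObjectProperty.homMk (OmegaCat.globBimodMap F)
  map_id _ := rfl
  map_comp _ _ := rfl

/-- The functor from globular bimodules to ω-operads. -/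
noncomputable def omegaCatFunctor (K : Type u) [Field K] :
    ExchangeGlobBimod.{u, w} K ⥤ ShuffleOmegaOperad.{u, w} K where
  obj X := BasedGlobBimod.omegaCat X.property
  map φ := OmegaCat.homOfRGlob (BasedGlobBimod.totalGlobMap φ.hom _ _)
  map_id _ := rfl
  map_comp _ _ := rfl

theorem theoremT (K : Type u) [Field K] [CharZero K] :
    ∃ (F : ShuffleOmegaOperad.{u, w} K ⥤ ExchangeGlobBimod.{u, w} K)
      (G : ExchangeGlobBimod.{u, w} K ⥤ ShuffleOmegaOperad.{u, w} K),
      F ⋙ G = 𝟭 (ShuffleOmegaOperad.{u, w} K) ∧ G ⋙ F = 𝟭 (ExchangeGlobBimod.{u, w} K) := by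
  refine ⟨globBimodFunctor K, omegaCatFunctor K,
    Functor.eq_id_of_isEqToHom _ ⟨fun O => O.omegaCatGlobBimod, fun O O' F => ?_⟩
      fun O => O.omegaCatGlobBimod_isEqToHom,
    Functor.eq_id_of_isEqToHom _ ⟨fun X => ObjectProperty.homMk
      (BasedGlobBimod.globBimodOmegaCat X.property), fun X Y φ => ?_⟩
      fun X => ObjectProperty.isEqToHom _ (BasedGlobBimod.globBimodOmegaCat_isEqToHom X.property)⟩
  · refine OmegaCat.Hom.ext (RGlob.Hom.ext (funext fun n => ShuffleOperad.Hom.ext ?_))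
    exact (Category.comp_id (F.hom.app n).hom).trans (Category.id_comp (F.hom.app n).hom).symm
  · refine ObjectProperty.hom_ext _ (BasedGlobBimod.Hom.ext (GlobBimod.Hom.ext
      (ShuffleOperad.Hom.ext ?_) (funext fun n => ?_)))
    · exact BasedGlobBimod.src₀_naturality φ.hom 0
    · exact (Category.comp_id (φ.hom.hom.app n)).trans (Category.id_comp (φ.hom.hom.app n)).symm
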